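/- **Proposition 3.3.** Let $(\Sigma,\tilde g)$ be a compact connected smooth Riemannian surface with boundary $\partial\Sigma$ whose Gaussian curvature $\tilde K$ vanishes identically. Let $K:\Sigma\to\mathbb R$ and $h:\partial\Sigma\to\mathbb R$ be continuous, with $K<0$ on $\Sigma$. Put $\mathfrak D(p)=h(p)/\sqrt{|K(p)|}$ for $p\in\partial\Sigma$, and assume that $\oint_{\partial\Sigma}h<0$ and that $\mathfrak D(p)>1$ for some $p\in\partial\Sigma$. All integrals, gradients and norms are taken with respect to $\tilde g$. Let $H^1(\Sigma)$ be the completion of $C^\infty(\Sigma)$ (functions smooth up to the boundary) for the norm $\left(\int_\Sigma u^2+\int_\Sigma|\nabla u|^2\right)^{1/2}$, and for $u\in H^1(\Sigma)$ let $$I(u)=\int_\Sigma\Big(\tfrac12|\nabla u|^2+2\tilde K u+2|K|e^{u}\Big)-4\oint_{\partial\Sigma}h\,e^{u/2},$$ where $u$ is evaluated on $\partial\Sigma$ in the sense of traces. Then: 1. $I$ is well defined on $H^1(\Sigma)$: the restriction map $C^\infty(\Sigma)\to L^2(\partial\Sigma)$ is bounded for the $H^1$ norm, and for every $u\in H^1(\Sigma)$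 one has $e^{u}\in L^1(\Sigma)$ and $e^{u/2}\in L^1(\partial\Sigma)$. 2. There exist $u_0,u_1\in H^1(\Sigma)$ such that, with $\Gamma$ the set of continuous $\gamma:[0,1]\to H^1(\Sigma)$ with $\gamma(0)=u_0$ and $\gamma(1)=u_1$, the maximum $\max_{t\in[0,1]}I(\gamma(t))$ is attained for every $\gamma\in\Gamma$, and $$\inf_{\gamma\in\Gamma}\ \max_{t\in[0,1]}I(\gamma(t))\;>\;\max\{I(u_0),I(u_1)\}\;>\;0.$$ 3. $I$ is not bounded from below on $H^1(\Sigma)$. -/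

import Mathlib

open MeasureTheory Set Bundle
open scoped Manifold Bundle ContDiff ENNReal

namespace RiemannianSurface

noncomputable section

set_option linter.unusedSectionVars false

/-- The Euclidean plane, in which charts of a surface take their values. -/
abbrev Plane : Type := EuclideanSpace ℝ (Fin 2)

variable {M : Type*} [TopologicalSpace M] [ChartedSpace (EuclideanHalfSpace 2) M]
  [IsManifold (𝓡∂ 2) ∞ M] 

/-- The `i`-th coordinate vector field of the chart centred at `c`, evaluated at `x` in the domain
of that chart (`TangentBundle.symmL_trivializationAt` identifies it with the image of the `i`-th
basis vector under the derivative of the inverse chart). -/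
def coordField (c : M) (i : Fin 2) (x : M) : TangentSpace (𝓡∂ 2) x :=
  (trivializationAt Plane (TangentSpace (𝓡∂ 2)) c).symm x (EuclideanSpace.single i 1)

variable [RiemannianBundle (fun x : M ↦ TangentSpace (𝓡∂ 2) x)]

/-- The coefficients `g_ij` of the metric in the chart centred at `c`. -/
def metricCoeff (c : M) (i j : Fin 2) (x : M) : ℝ :=
  inner ℝ (coordField c i x) (coordField c j x)

instance (x : M) : FiniteDimensional ℝ (TangentSpace (𝓡∂ 2) x) :=
  inferInstanceAs (FiniteDimensional ℝ Plane)

instance (x : M) : CompleteSpace (TangentSpace (𝓡∂ 2) x) :=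
  FiniteDimensional.complete ℝ _

/-- The density `√(det g_ij)` of the Riemannian area in the chart centred at `c`. -/
def areaDensity (c : M) (x : M) : ℝ :=
  Real.sqrt (metricCoeff c 0 0 x * metricCoeff c 1 1 x - metricCoeff c 0 1 x ^ 2)

/-- The Riemannian gradient of a function: the Riesz representative of its differential. -/
def grad (u : M → ℝ) (x : M) : TangentSpace (𝓡∂ 2) x :=
  (InnerProductSpace.toDual ℝ (TangentSpace (𝓡∂ 2) x)).symm (mfderiv (𝓡∂ 2) 𝓘(ℝ, ℝ) u x)

variable [IsContMDiffRiemannianBundle (𝓡∂ 2) ∞ Plane (fun x : M ↦ TangentSpace (𝓡∂ 2) x)]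

theorem exists_eq_coordField (c : M) {x : M} (hx : x ∈ (chartAt (EuclideanHalfSpace 2) c).source)
    (v : TangentSpace (𝓡∂ 2) x) :
    ∃ a b : ℝ, v = a • coordField c 0 x + b • coordField c 1 x := by
  have hx' : x ∈ (trivializationAt Plane (TangentSpace (𝓡∂ 2)) c).baseSet := by simpa using hx
  let e := (trivializationAt Plane (TangentSpace (𝓡∂ 2)) c).linearEquivAt (R := ℝ) x hx'
  refine ⟨(e v) 0, (e v) 1, ?_⟩
  have h1 : e v = (e v) 0 • EuclideanSpace.single 0 1 + (e v) 1 • EuclideanSpace.single 1 1 := by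
    ext i; fin_cases i <;> simp
  have h2 := congrArg e.symm h1
  rw [LinearEquiv.symm_apply_apply, map_add, map_smul, map_smul] at h2
  exact h2

theorem coordField_combination_eq_zero (c : M) {x : M}
    (hx : x ∈ (chartAt (EuclideanHalfSpace 2) c).source) {a b : ℝ}
    (h : a • coordField c 0 x + b • coordField c 1 x = 0) : a = 0 ∧ b = 0 := by
  have hx' : x ∈ (trivializationAt Plane (TangentSpace (𝓡∂ 2)) c).baseSet := by simpa using hx
  let e := (trivializationAt Plane (TangentSpace (𝓡∂ 2)) c).linearEquivAt (R := ℝ) x hx'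
  have h2 : e.symm (a • EuclideanSpace.single 0 1 + b • EuclideanSpace.single 1 1) = 0 := by
    rw [map_add, map_smul, map_smul]; exact h
  have h3 := (LinearEquiv.map_eq_zero_iff _).1 h2
  have h4 := congrArg (fun w : Plane => w 0) h3
  have h5 := congrArg (fun w : Plane => w 1) h3
  simp at h4 h5
  exact ⟨h4, h5⟩

theorem gramDet_pos (c : M) {x : M} (hx : x ∈ (chartAt (EuclideanHalfSpace 2) c).source) :
    0 < metricCoeff c 0 0 x * metricCoeff c 1 1 x - metricCoeff c 0 1 x ^ 2 := by
  have ha : coordField c 0 x ≠ 0 := fun h => by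
    have := (coordField_combination_eq_zero c hx (a := 1) (b := 0) (by simp [h])).1
    norm_num at this
  have hpos : 0 < metricCoeff c 0 0 x := real_inner_self_pos.2 ha
  have hw : metricCoeff c 0 0 x • coordField c 1 x - metricCoeff c 0 1 x • coordField c 0 x ≠ 0 :=
    fun h => by
      have := (coordField_combination_eq_zero c hx (a := -metricCoeff c 0 1 x)
        (b := metricCoeff c 0 0 x) (by rw [← h, neg_smul]; abel)).2
      exact hpos.ne' this
  have h := real_inner_self_pos.2 hw
  rw [inner_sub_sub_self, inner_smul_left, inner_smul_right, inner_smul_left, inner_smul_right,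
    inner_smul_left, inner_smul_right, inner_smul_left, inner_smul_right,
    real_inner_comm (coordField c 0 x) (coordField c 1 x)] at h
  simp only [conj_trivial] at h
  change 0 < metricCoeff c 0 0 x * (metricCoeff c 0 0 x * metricCoeff c 1 1 x)
    - metricCoeff c 0 0 x * (metricCoeff c 0 1 x * metricCoeff c 0 1 x)
    - metricCoeff c 0 1 x * (metricCoeff c 0 0 x * metricCoeff c 0 1 x)
    + metricCoeff c 0 1 x * (metricCoeff c 0 1 x * metricCoeff c 0 0 x) at h
  exact pos_of_mul_pos_right (a := metricCoeff c 0 0 x) (by linarith) hpos.le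

theorem coordField_contMDiffOn (c : M) (i : Fin 2) :
    ContMDiffOn (𝓡∂ 2) ((𝓡∂ 2).prod 𝓘(ℝ, Plane)) ∞
     (fun x : M ↦ (⟨x, coordField c i x⟩ : TangentBundle (𝓡∂ 2) M)) (chartAt (EuclideanHalfSpace 2) c).source := by
  have := (trivializationAt Plane (TangentSpace (𝓡∂ 2)) c).contMDiffOn_localFrame_baseSet (I := 𝓡∂ 2) (n := ∞)
    (EuclideanSpace.basisFun (Fin 2) ℝ).toBasis i
  simp only [TangentBundle.trivializationAt_baseSet] at this
  refine this.congr fun x hx => ?_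
  rw [Bundle.Trivialization.localFrame_apply_of_mem_baseSet _ _ (by simpa using hx)]
  simp only [coordField, Bundle.Trivialization.basisAt, Module.Basis.map_apply, OrthonormalBasis.coe_toBasis, EuclideanSpace.basisFun_apply]
  rfl

theorem metricCoeff_contMDiffOn (c : M) (i j : Fin 2) :
    ContMDiffOn (𝓡∂ 2) 𝓘(ℝ, ℝ) ∞ (metricCoeff c i j) (chartAt (EuclideanHalfSpace 2) c).source :=
  (coordField_contMDiffOn c i).inner_bundle (coordField_contMDiffOn c j)


theorem inner_grad_left (u : M → ℝ) (x : M) (v : TangentSpace (𝓡∂ 2) x) :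
    inner ℝ (grad u x) v = mfderiv (𝓡∂ 2) 𝓘(ℝ, ℝ) u x v :=
  InnerProductSpace.toDual_symm_apply

theorem mfderiv_coordField_continuousOn {u : M → ℝ} (hu : ContMDiff (𝓡∂ 2) 𝓘(ℝ, ℝ) ∞ u)
    (c : M) (i : Fin 2) :
    ContinuousOn (fun x => (inner ℝ (grad u x) (coordField c i x) : ℝ))
      (chartAt (EuclideanHalfSpace 2) c).source := by
  have h1 := (hu.continuous_tangentMap (by simp)).comp_continuousOn
    (coordField_contMDiffOn c i).continuousOn
  have h2 := ((tangentBundleModelSpaceHomeomorph 𝓘(ℝ, ℝ)).continuous.comp_continuousOn h1).snd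
  refine h2.congr fun x _ => ?_
  rw [inner_grad_left]
  rfl

theorem inner_grad_eq (u v : M → ℝ) (c : M) {x : M}
    (hx : x ∈ (chartAt (EuclideanHalfSpace 2) c).source) :
    inner ℝ (grad u x) (grad v x) =
      (metricCoeff c 1 1 x * inner ℝ (grad u x) (coordField c 0 x)
          * inner ℝ (grad v x) (coordField c 0 x)
        - metricCoeff c 0 1 x * (inner ℝ (grad u x) (coordField c 0 x)
            * inner ℝ (grad v x) (coordField c 1 x)
          + inner ℝ (grad u x) (coordField c 1 x) * inner ℝ (grad v x) (coordField c 0 x))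
        + metricCoeff c 0 0 x * inner ℝ (grad u x) (coordField c 1 x)
          * inner ℝ (grad v x) (coordField c 1 x))
      / (metricCoeff c 0 0 x * metricCoeff c 1 1 x - metricCoeff c 0 1 x ^ 2) := by
  rw [eq_div_iff (gramDet_pos c hx).ne']
  obtain ⟨a, b, hab⟩ := exists_eq_coordField c hx (grad u x)
  have h01 : (inner ℝ (coordField c 1 x) (coordField c 0 x) : ℝ) = metricCoeff c 0 1 x :=
    real_inner_comm _ _
  have h0 : (inner ℝ (coordField c 0 x) (grad v x) : ℝ)
    = inner ℝ (grad v x) (coordField c 0 x) := real_inner_comm _ _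
  have h1 : (inner ℝ (coordField c 1 x) (grad v x) : ℝ)
    = inner ℝ (grad v x) (coordField c 1 x) := real_inner_comm _ _
  rw [hab]
  simp only [inner_add_left, inner_smul_left, conj_trivial, h01, h0, h1]
  change _ = metricCoeff c 1 1 x * (a * metricCoeff c 0 0 x + b * metricCoeff c 0 1 x) * _
    - metricCoeff c 0 1 x * ((a * metricCoeff c 0 0 x + b * metricCoeff c 0 1 x) * _
      + (a * metricCoeff c 0 1 x + b * metricCoeff c 1 1 x) * _)
    + metricCoeff c 0 0 x * (a * metricCoeff c 0 1 x + b * metricCoeff c 1 1 x) * _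
  ring

theorem inner_grad_continuous {u v : M → ℝ} (hu : ContMDiff (𝓡∂ 2) 𝓘(ℝ, ℝ) ∞ u)
    (hv : ContMDiff (𝓡∂ 2) 𝓘(ℝ, ℝ) ∞ v) :
    Continuous (fun x => (inner ℝ (grad u x) (grad v x) : ℝ)) := by
  rw [continuous_iff_continuousAt]
  intro c
  have hs := (chartAt (EuclideanHalfSpace 2) c).open_source.mem_nhds (mem_chart_source _ c)
  refine ContinuousOn.continuousAt (s := (chartAt (EuclideanHalfSpace 2) c).source) ?_ hs
  have g := fun i j => (metricCoeff_contMDiffOn c i j).continuousOn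
  have a := mfderiv_coordField_continuousOn hu c
  have b := mfderiv_coordField_continuousOn hv c
  refine ContinuousOn.congr ?_ (fun x hx => inner_grad_eq u v c hx)
  refine ContinuousOn.div ?_ (((g 0 0).mul (g 1 1)).sub ((g 0 1).pow 2))
    (fun x hx => (gramDet_pos c hx).ne')
  exact ((((g 1 1).mul (a 0)).mul (b 0)).sub ((g 0 1).mul (((a 0).mul (b 1)).add
    ((a 1).mul (b 0))))).add (((g 0 0).mul (a 1)).mul (b 1))

theorem coordField_change (c d : M) {x : M} (i : Fin 2)
    (hc : x ∈ (chartAt (EuclideanHalfSpace 2) c).source)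
    (hd : x ∈ (chartAt (EuclideanHalfSpace 2) d).source) :
    coordField c i x =
      (tangentCoordChange (𝓡∂ 2) c d x (EuclideanSpace.single i 1)) 0 • coordField d 0 x
      + (tangentCoordChange (𝓡∂ 2) c d x (EuclideanSpace.single i 1)) 1 • coordField d 1 x := by
  set w : Plane := tangentCoordChange (𝓡∂ 2) c d x (EuclideanSpace.single i 1) with hw
  have hd' : x ∈ (trivializationAt Plane (TangentSpace (𝓡∂ 2)) d).baseSet := by simpa using hd
  let e := (trivializationAt Plane (TangentSpace (𝓡∂ 2)) d).linearEquivAt (R := ℝ) x hd'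
  have h1 : w = w 0 • EuclideanSpace.single 0 1 + w 1 • EuclideanSpace.single 1 1 := by
    ext i; fin_cases i <;> simp
  have h2 := congrArg e.symm h1
  rw [map_add, map_smul, map_smul] at h2
  have h3 : e.symm w = coordField c i x := by
    have h4 := TangentBundle.symmL_trivializationAt_eq_core (I := 𝓡∂ 2) (b₀ := d) hd
    have h5 := TangentBundle.symmL_trivializationAt_eq_core (I := 𝓡∂ 2) (b₀ := c) hc
    have h6 := tangentCoordChange_comp (I := 𝓡∂ 2) (w := c) (x := d) (y := x) (z := x)
      (v := EuclideanSpace.single i 1) (by simp [hc, hd])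
    have h7 := congrArg (fun T => T w) h4
    have h8 := congrArg (fun T => T (EuclideanSpace.single i 1)) h5
    have hc' : x ∈ (trivializationAt Plane (TangentSpace (𝓡∂ 2)) c).baseSet := by simpa using hc
    rw [Trivialization.symmL_apply _ hd'] at h7
    rw [Trivialization.symmL_apply _ hc'] at h8
    exact h7.trans (h6.trans h8.symm)
  rw [← h3, h2]
  rfl

theorem metricCoeff_change (c d : M) {x : M} (i j : Fin 2)
    (hc : x ∈ (chartAt (EuclideanHalfSpace 2) c).source)
    (hd : x ∈ (chartAt (EuclideanHalfSpace 2) d).source) :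
    metricCoeff c i j x =
      (tangentCoordChange (𝓡∂ 2) c d x (EuclideanSpace.single i 1)) 0
        * ((tangentCoordChange (𝓡∂ 2) c d x (EuclideanSpace.single j 1)) 0 * metricCoeff d 0 0 x
        + (tangentCoordChange (𝓡∂ 2) c d x (EuclideanSpace.single j 1)) 1 * metricCoeff d 0 1 x)
      + (tangentCoordChange (𝓡∂ 2) c d x (EuclideanSpace.single i 1)) 1
        * ((tangentCoordChange (𝓡∂ 2) c d x (EuclideanSpace.single j 1)) 0 * metricCoeff d 0 1 x
        + (tangentCoordChange (𝓡∂ 2) c d x (EuclideanSpace.single j 1)) 1 * metricCoeff d 1 1 x)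
      := by
  have h01 : (inner ℝ (coordField d 1 x) (coordField d 0 x) : ℝ) = metricCoeff d 0 1 x :=
    real_inner_comm _ _
  rw [metricCoeff, coordField_change c d i hc hd, coordField_change c d j hc hd]
  simp only [inner_add_left, inner_add_right, inner_smul_left, inner_smul_right, conj_trivial, h01]
  simp only [metricCoeff]
  ring

theorem det_plane (J : Plane →L[ℝ] Plane) :
    J.det = J (EuclideanSpace.single 0 1) 0 * J (EuclideanSpace.single 1 1) 1
      - J (EuclideanSpace.single 1 1) 0 * J (EuclideanSpace.single 0 1) 1 := by
  rw [ContinuousLinearMap.det, ← LinearMap.det_toMatrix (EuclideanSpace.basisFun (Fin 2) ℝ).toBasis,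
    Matrix.det_fin_two]
  simp [LinearMap.toMatrix_apply]

theorem areaDensity_change (c d : M) {x : M}
    (hc : x ∈ (chartAt (EuclideanHalfSpace 2) c).source)
    (hd : x ∈ (chartAt (EuclideanHalfSpace 2) d).source) :
    areaDensity c x = |(tangentCoordChange (𝓡∂ 2) c d x).det| * areaDensity d x := by
  rw [areaDensity, areaDensity, ← Real.sqrt_sq_eq_abs, ← Real.sqrt_mul (sq_nonneg _), det_plane,
    metricCoeff_change c d 0 0 hc hd, metricCoeff_change c d 0 1 hc hd,
    metricCoeff_change c d 1 1 hc hd]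
  congr 1
  ring

/-- The image under the parametrization `p`, defined on the set `S`, of the measure with density `f`
with respect to `lam`. -/
def paramMeasure {X : Type*} [MeasurableSpace X] [MeasurableSpace M] (lam : Measure X) (S : Set X) (p : X → M)
    (f : X → ℝ) : Measure M :=
  ((lam.restrict S).withDensity fun y => ENNReal.ofReal (f y)).map p

variable [MeasurableSpace M] 

/-- The Riemannian area of the part of the surface covered by the chart centred at `c`. -/
def chartArea (c : M) : Measure M :=
  paramMeasure volume (extChartAt (𝓡∂ 2) c).target (extChartAt (𝓡∂ 2) c).symm
    (fun y => areaDensity c ((extChartAt (𝓡∂ 2) c).symm y))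

/-- The point `(0, t)` of the boundary line of the half-plane `{y | 0 ≤ y 0}`. -/
def bdryPt (t : ℝ) : Plane := !₂[0, t]

/-- The Riemannian length on the part of the boundary covered by the chart centred at `c`: the
boundary is parametrized by `t ↦ (0, t)` in the chart, with density `√g_11`. -/
def chartLength (c : M) : Measure M :=
  paramMeasure volume {t : ℝ | bdryPt t ∈ (extChartAt (𝓡∂ 2) c).target}
    (fun t => (extChartAt (𝓡∂ 2) c).symm (bdryPt t))
    (fun t => Real.sqrt (metricCoeff c 1 1 ((extChartAt (𝓡∂ 2) c).symm (bdryPt t))))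

variable (M) in
/-- The Riemannian area measure. The chart measures agree on overlaps of charts, and their supremum
is the measure that agrees with each of them on the domain of the chart (`area_apply`). -/
def area : Measure M := ⨆ c : M, chartArea c

variable (M) in
/-- The Riemannian length measure of the boundary, as a measure on the surface which is carried by
the boundary; see `boundaryLength_apply`. -/
def boundaryLength : Measure M := ⨆ c : M, chartLength c

variable [BorelSpace M]

theorem paramMeasure_apply {X : Type*} [MeasurableSpace X] [TopologicalSpace X]
    [OpensMeasurableSpace X] (lam : Measure X) {S : Set X} (hS : MeasurableSet S) {p : X → M}
    (hp : ContinuousOn p S) (f : X → ℝ) {A : Set M} (hA : MeasurableSet A) :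
    paramMeasure lam S p f A = ∫⁻ y in S ∩ p ⁻¹' A, ENNReal.ofReal (f y) ∂lam := by
  have h1 : AEMeasurable p (lam.restrict S) := hp.aemeasurable hS
  have h2 : NullMeasurableSet (p ⁻¹' A) (lam.restrict S) := h1.nullMeasurableSet_preimage hA
  rw [paramMeasure, Measure.map_apply_of_aemeasurable
    (h1.mono_ac (withDensity_absolutelyContinuous _ _)) hA, withDensity_apply₀ _ h2,
    Measure.restrict_restrict₀ h2, inter_comm]

theorem measurableSet_inter_preimage {X : Type*} [MeasurableSpace X] [TopologicalSpace X]
    [OpensMeasurableSpace X] {S : Set X} (hS : MeasurableSet S) {p : X → M}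
    (hp : ContinuousOn p S) {A : Set M} (hA : MeasurableSet A) : MeasurableSet (S ∩ p ⁻¹' A) := by
  have h := hS.subtype_image ((continuousOn_iff_continuous_domRestrict.1 hp).measurable hA)
  convert h using 1
  ext x
  simp [and_comm]

theorem measurableSet_target (c : M) : MeasurableSet (extChartAt (𝓡∂ 2) c).target := by
  rw [extChartAt_target]
  exact (((chartAt _ c).open_target.preimage (𝓡∂ 2).continuous_symm).measurableSet).inter
    (𝓡∂ 2).isClosed_range.measurableSet

theorem continuous_bdryPt : Continuous bdryPt := by
  unfold bdryPt; fun_prop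

theorem iSup_measure_apply (m : M → Measure M) (V : M → Set M)
    (hV : ∀ c, MeasurableSet (V c)) (h0 : ∀ c, m c (V c)ᶜ = 0)
    (hcomp : ∀ c d A, MeasurableSet A → A ⊆ V c → A ⊆ V d → m d A ≤ m c A)
    (c : M) {A : Set M} (hA : MeasurableSet A) (hAc : A ⊆ V c) : (⨆ d, m d) A = m c A := by
  refine le_antisymm ?_ (le_iSup m c A)
  have hle : (⨆ d, m d) ≤ (m c).restrict (V c) + (⨆ d, m d).restrict (V c)ᶜ := by
    refine iSup_le fun d => Measure.le_iff.2 fun B hB => ?_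
    rw [Measure.add_apply, Measure.restrict_apply hB, Measure.restrict_apply hB]
    have h1 : B ⊆ (B ∩ V c ∩ V d ∪ (V d)ᶜ) ∪ B ∩ (V c)ᶜ := fun x hx => by
      by_cases h : x ∈ V c <;> by_cases h' : x ∈ V d <;> simp [hx, h, h']
    calc m d B ≤ (m d (B ∩ V c ∩ V d) + m d (V d)ᶜ) + m d (B ∩ (V c)ᶜ) :=
          (measure_mono h1).trans ((measure_union_le _ _).trans
            (add_le_add_left (measure_union_le _ _) _))
      _ ≤ m c (B ∩ V c) + (⨆ d, m d) (B ∩ (V c)ᶜ) := by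
          rw [h0, add_zero]
          refine add_le_add ?_ (le_iSup m d _)
          exact (hcomp c d _ ((hB.inter (hV c)).inter (hV d)) (fun x hx => hx.1.2)
            (fun x hx => hx.2)).trans (measure_mono inter_subset_left)
  refine (hle A).trans ?_
  rw [Measure.add_apply, Measure.restrict_apply hA, Measure.restrict_apply hA]
  have h2 : A ∩ (V c)ᶜ = ∅ := by
    ext x
    simpa using fun hx => hAc hx
  rw [h2, measure_empty, add_zero]
  exact measure_mono inter_subset_left

theorem iSup_measure_finite [CompactSpace M] (m : M → Measure M) (V : M → Set M)
    (hV : ∀ c, MeasurableSet (V c)) (h0 : ∀ c, m c (V c)ᶜ = 0)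
    (hcomp : ∀ c d A, MeasurableSet A → A ⊆ V c → A ⊆ V d → m d A ≤ m c A)
    (hloc : ∀ c, ∃ U, IsOpen U ∧ c ∈ U ∧ U ⊆ V c ∧ m c U < (⊤ : ℝ≥0∞)) :
    IsFiniteMeasure (⨆ c, m c) := by
  choose U hUo hcU hUV hUf using hloc
  obtain ⟨F, hF⟩ := isCompact_univ.elim_finite_subcover U hUo
    (fun x _ => mem_iUnion.2 ⟨x, hcU x⟩)
  have hle : (⨆ c, m c) ≤ ∑ i ∈ F, (m i).restrict (U i) := by
    refine iSup_le fun d => Measure.le_iff.2 fun A hA => ?_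
    have hsub : A ⊆ (⋃ i ∈ F, (A ∩ U i ∩ V d)) ∪ (V d)ᶜ := by
      intro x hx
      by_cases hxd : x ∈ V d
      · left
        obtain ⟨i, hi, hxi⟩ := mem_iUnion₂.1 (hF (mem_univ x))
        exact mem_iUnion₂.2 ⟨i, hi, ⟨hx, hxi⟩, hxd⟩
      · exact Or.inr hxd
    calc m d A ≤ m d (⋃ i ∈ F, (A ∩ U i ∩ V d)) + m d (V d)ᶜ :=
          (measure_mono hsub).trans (measure_union_le _ _)
      _ ≤ ∑ i ∈ F, m d (A ∩ U i ∩ V d) := by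
          rw [h0, add_zero]; exact measure_biUnion_finset_le _ _
      _ ≤ ∑ i ∈ F, m i (A ∩ U i) := by
          refine Finset.sum_le_sum fun i _ => ?_
          exact (hcomp i d _ ((hA.inter (hUo i).measurableSet).inter (hV d))
            (fun x hx => hUV i hx.1.2) (fun x hx => hx.2)).trans
            (measure_mono inter_subset_left)
      _ = (∑ i ∈ F, (m i).restrict (U i)) A := by
          rw [Measure.finsetSum_apply]
          exact Finset.sum_congr rfl fun i _ => (Measure.restrict_apply hA).symm
  refine ⟨(hle univ).trans_lt ?_⟩
  rw [Measure.finsetSum_apply]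
  refine ENNReal.sum_lt_top.2 fun i _ => ?_
  simpa using hUf i

theorem paramMeasure_lt_top {X : Type*} [MeasurableSpace X] [TopologicalSpace X]
    [OpensMeasurableSpace X] (lam : Measure X) {S : Set X} (hS : MeasurableSet S) {p : X → M}
    (hp : ContinuousOn p S) (f : X → ℝ) {A : Set M} (hA : MeasurableSet A) {C : ℝ} {B : Set X}
    (hB : lam B < (⊤ : ℝ≥0∞)) (hsub : S ∩ p ⁻¹' A ⊆ B) (hC : ∀ y ∈ S, p y ∈ A → f y ≤ C) :
    paramMeasure lam S p f A < (⊤ : ℝ≥0∞) := by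
  rw [paramMeasure_apply lam hS hp f hA]
  calc ∫⁻ y in S ∩ p ⁻¹' A, ENNReal.ofReal (f y) ∂lam
      ≤ ∫⁻ y in S ∩ p ⁻¹' A, ENNReal.ofReal C ∂lam := by
        refine setLIntegral_mono' ?_ fun y hy => ENNReal.ofReal_le_ofReal (hC y hy.1 hy.2)
        exact measurableSet_inter_preimage hS hp hA
    _ = ENNReal.ofReal C * lam (S ∩ p ⁻¹' A) := by simp
    _ < (⊤ : ℝ≥0∞) := ENNReal.mul_lt_top ENNReal.ofReal_lt_top ((measure_mono hsub).trans_lt hB)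

theorem chartArea_apply (c : M) {A : Set M} (hA : MeasurableSet A) :
    chartArea c A = ∫⁻ y in (extChartAt (𝓡∂ 2) c).target ∩ (extChartAt (𝓡∂ 2) c).symm ⁻¹' A,
      ENNReal.ofReal (areaDensity c ((extChartAt (𝓡∂ 2) c).symm y)) :=
  paramMeasure_apply _ (measurableSet_target c) (continuousOn_extChartAt_symm c) _ hA

theorem chartLength_apply (c : M) {A : Set M} (hA : MeasurableSet A) :
    chartLength c A = ∫⁻ t in {t : ℝ | bdryPt t ∈ (extChartAt (𝓡∂ 2) c).target} ∩
        (fun t => (extChartAt (𝓡∂ 2) c).symm (bdryPt t)) ⁻¹' A,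
      ENNReal.ofReal (Real.sqrt (metricCoeff c 1 1 ((extChartAt (𝓡∂ 2) c).symm (bdryPt t)))) :=
  paramMeasure_apply _ (continuous_bdryPt.measurable (measurableSet_target c))
    ((continuousOn_extChartAt_symm c).comp continuous_bdryPt.continuousOn fun _ h => h) _ hA

theorem image_change (c d : M) {A : Set M} (hc : A ⊆ (chartAt (EuclideanHalfSpace 2) c).source)
    (hd : A ⊆ (chartAt (EuclideanHalfSpace 2) d).source) :
    (extChartAt (𝓡∂ 2) d ∘ (extChartAt (𝓡∂ 2) c).symm) ''
      ((extChartAt (𝓡∂ 2) c).target ∩ (extChartAt (𝓡∂ 2) c).symm ⁻¹' A)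
      = (extChartAt (𝓡∂ 2) d).target ∩ (extChartAt (𝓡∂ 2) d).symm ⁻¹' A := by
  have key : ∀ e : M, A ⊆ (chartAt (EuclideanHalfSpace 2) e).source →
      (extChartAt (𝓡∂ 2) e).target ∩ (extChartAt (𝓡∂ 2) e).symm ⁻¹' A
        = extChartAt (𝓡∂ 2) e '' A := fun e he => by
    rw [← extChartAt_source (𝓡∂ 2)] at he
    exact ((extChartAt (𝓡∂ 2) e).image_eq_target_inter_inv_preimage he).symm
  rw [key c hc, key d hd, image_image]
  refine image_congr fun x hx => ?_
  simp only [Function.comp]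
  rw [(extChartAt (𝓡∂ 2) c).left_inv (by simpa using hc hx)]

theorem chartArea_change (c d : M) {A : Set M} (hA : MeasurableSet A)
    (hc : A ⊆ (chartAt (EuclideanHalfSpace 2) c).source)
    (hd : A ⊆ (chartAt (EuclideanHalfSpace 2) d).source) : chartArea d A = chartArea c A := by
  rw [chartArea_apply c hA, chartArea_apply d hA, ← image_change c d hc hd,
    lintegral_image_eq_lintegral_abs_det_fderiv_mul volume
      (measurableSet_inter_preimage (measurableSet_target c) (continuousOn_extChartAt_symm c) hA)
      (f' := fun y => tangentCoordChange (𝓡∂ 2) c d ((extChartAt (𝓡∂ 2) c).symm y))]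
  · refine setLIntegral_congr_fun (measurableSet_inter_preimage (measurableSet_target c)
      (continuousOn_extChartAt_symm c) hA) fun y hy => ?_
    have h1 := hc hy.2
    have h2 := hd hy.2
    simp only [Function.comp]
    rw [(extChartAt (𝓡∂ 2) d).left_inv (by simpa using h2), areaDensity_change c d h1 h2,
      ENNReal.ofReal_mul (abs_nonneg _)]
  · intro y hy
    have h := hasFDerivWithinAt_tangentCoordChange (I := 𝓡∂ 2) (x := c) (y := d)
      (z := (extChartAt (𝓡∂ 2) c).symm y)
      ⟨by simpa using hc hy.2, by simpa using hd hy.2⟩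
    rw [(extChartAt (𝓡∂ 2) c).right_inv hy.1] at h
    exact h.mono fun z hz => extChartAt_target_subset_range c hz.1
  · intro y hy z hz hyz
    simp only [Function.comp] at hyz
    have h := (extChartAt (𝓡∂ 2) d).injOn (by simpa using hd hy.2) (by simpa using hd hz.2) hyz
    exact (extChartAt (𝓡∂ 2) c).symm.injOn hy.1 hz.1 h

theorem bdryPt_zero (t : ℝ) : bdryPt t 0 = 0 := by simp [bdryPt]

theorem bdryPt_one (t : ℝ) : bdryPt t 1 = t := by simp [bdryPt]

theorem bdryPt_mem_range (t : ℝ) : bdryPt t ∈ range (𝓡∂ 2) := by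
  rw [range_modelWithCornersEuclideanHalfSpace]
  exact (bdryPt_zero t).ge

theorem isOpen_bdryPt_preimage (c : M) {U : Set M} (hU : IsOpen U) :
    IsOpen ({t : ℝ | bdryPt t ∈ (extChartAt (𝓡∂ 2) c).target} ∩
        (fun t => (extChartAt (𝓡∂ 2) c).symm (bdryPt t)) ⁻¹' U) := by
  have h1 := (chartAt (EuclideanHalfSpace 2) c).isOpen_inter_preimage_symm hU
  have h2 := h1.preimage ((𝓡∂ 2).continuous_symm.comp continuous_bdryPt)
  convert h2 using 1
  ext t
  simp only [extChartAt_target, mem_inter_iff, mem_ofPred_eq, mem_preimage, bdryPt_mem_range,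
    and_true, Function.comp, extChartAt_coe_symm]

theorem isBoundaryPoint_iff_coord (c : M) {x : M}
    (hx : x ∈ (chartAt (EuclideanHalfSpace 2) c).source) :
    x ∈ (𝓡∂ 2).boundary M ↔ extChartAt (𝓡∂ 2) c x 0 = 0 := by
  rw [← (𝓡∂ 2).compl_interior, mem_compl_iff]
  have h : x ∈ (𝓡∂ 2).interior M ↔ _ := (𝓡∂ 2).isInteriorPoint_iff_of_mem_atlas (n := ∞)
    (by simp) (chart_mem_atlas _ c) hx
  rw [h]
  have hext : (chartAt (EuclideanHalfSpace 2) c).extend (𝓡∂ 2) x = extChartAt (𝓡∂ 2) c x := rfl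
  have hrange : (chartAt (EuclideanHalfSpace 2) c).extend (𝓡∂ 2) x ∈
      interior ((chartAt (EuclideanHalfSpace 2) c).extend (𝓡∂ 2)).target ↔
      extChartAt (𝓡∂ 2) c x ∈ interior (range (𝓡∂ 2)) :=
    ⟨fun h => OpenPartialHomeomorph.interior_extend_target_subset_interior_range _ h,
      fun h => (chartAt (EuclideanHalfSpace 2) c).mem_interior_extend_target
        ((chartAt _ c).map_source hx) h⟩
  rw [hrange, interior_range_modelWithCornersEuclideanHalfSpace, mem_ofPred_eq, not_lt]
  have hmem : extChartAt (𝓡∂ 2) c x ∈ range (𝓡∂ 2) := extChartAt_target_subset_range c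
    ((extChartAt (𝓡∂ 2) c).map_source (by simpa using hx))
  rw [range_modelWithCornersEuclideanHalfSpace] at hmem
  exact ⟨fun h => le_antisymm h hmem, fun h => h.le⟩

theorem chartLength_change (c d : M) {A : Set M} (hA : MeasurableSet A)
    (hc : A ⊆ (chartAt (EuclideanHalfSpace 2) c).source)
    (hd : A ⊆ (chartAt (EuclideanHalfSpace 2) d).source) : chartLength d A = chartLength c A := by
  have hcoord : ∀ e : M, ∀ t, bdryPt t ∈ (extChartAt (𝓡∂ 2) e).target →
      (extChartAt (𝓡∂ 2) e).symm (bdryPt t) ∈ (chartAt (EuclideanHalfSpace 2) e).source ∧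
      (extChartAt (𝓡∂ 2) e).symm (bdryPt t) ∈ (𝓡∂ 2).boundary M := fun e t ht => by
    have h := (extChartAt (𝓡∂ 2) e).map_target ht
    rw [extChartAt_source] at h
    refine ⟨h, (isBoundaryPoint_iff_coord e h).2 ?_⟩
    rw [(extChartAt (𝓡∂ 2) e).right_inv ht, bdryPt_zero]
  have hback : ∀ e : M, ∀ x ∈ (chartAt (EuclideanHalfSpace 2) e).source,
      x ∈ (𝓡∂ 2).boundary M → bdryPt (extChartAt (𝓡∂ 2) e x 1) = extChartAt (𝓡∂ 2) e x :=
    fun e x hx hb => by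
      have h0 := (isBoundaryPoint_iff_coord e hx).1 hb
      ext i
      fin_cases i
      · exact (bdryPt_zero _).trans h0.symm
      · exact bdryPt_one _
  set s : M → Set ℝ := fun e => {t : ℝ | bdryPt t ∈ (extChartAt (𝓡∂ 2) e).target} ∩
        (fun t => (extChartAt (𝓡∂ 2) e).symm (bdryPt t)) ⁻¹' A with hs
  have hsm : MeasurableSet (s c) := measurableSet_inter_preimage
    (continuous_bdryPt.measurable (measurableSet_target c))
    ((continuousOn_extChartAt_symm c).comp continuous_bdryPt.continuousOn fun _ h => h) hA
  let ψ : ℝ → ℝ := fun t => extChartAt (𝓡∂ 2) d ((extChartAt (𝓡∂ 2) c).symm (bdryPt t)) 1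
  have hψ : ∀ t ∈ s c, bdryPt (ψ t) =
      extChartAt (𝓡∂ 2) d ((extChartAt (𝓡∂ 2) c).symm (bdryPt t)) := fun t ht =>
    hback d _ (hd ht.2) (hcoord c t ht.1).2
  have himg : ψ '' s c = s d := by
    ext r
    constructor
    · rintro ⟨t, ht, rfl⟩
      have hx := hd ht.2
      rw [← extChartAt_source (𝓡∂ 2)] at hx
      refine ⟨?_, ?_⟩
      · rw [mem_ofPred_eq, hψ t ht]
        exact (extChartAt (𝓡∂ 2) d).map_source hx
      · rw [mem_preimage, hψ t ht, (extChartAt (𝓡∂ 2) d).left_inv hx]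
        exact ht.2
    · intro hr
      set x := (extChartAt (𝓡∂ 2) d).symm (bdryPt r) with hx
      have hxA : x ∈ A := hr.2
      have hxc := hc hxA
      have hxb := (hcoord d r hr.1).2
      have h1 := hback c x hxc hxb
      have hxc' := hxc
      rw [← extChartAt_source (𝓡∂ 2)] at hxc'
      have h2 : (extChartAt (𝓡∂ 2) c).symm (bdryPt (extChartAt (𝓡∂ 2) c x 1)) = x := by
        rw [h1, (extChartAt (𝓡∂ 2) c).left_inv hxc']
      refine ⟨extChartAt (𝓡∂ 2) c x 1, ⟨?_, ?_⟩, ?_⟩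
      · rw [mem_ofPred_eq, h1]
        exact (extChartAt (𝓡∂ 2) c).map_source hxc'
      · rw [mem_preimage, h2]; exact hxA
      · simp only [ψ]
        rw [h2, hx, (extChartAt (𝓡∂ 2) d).right_inv hr.1, bdryPt_one]
  have hderiv : ∀ t ∈ s c,
      HasDerivAt ψ (tangentCoordChange (𝓡∂ 2) c d ((extChartAt (𝓡∂ 2) c).symm (bdryPt t))
        (EuclideanSpace.single 1 1) 1) t ∧
      tangentCoordChange (𝓡∂ 2) c d ((extChartAt (𝓡∂ 2) c).symm (bdryPt t))
        (EuclideanSpace.single 1 1) 0 = 0 := by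
    intro t ht
    have h := hasFDerivWithinAt_tangentCoordChange (I := 𝓡∂ 2) (x := c) (y := d)
      (z := (extChartAt (𝓡∂ 2) c).symm (bdryPt t))
      ⟨by simpa using hc ht.2, by simpa using hd ht.2⟩
    rw [(extChartAt (𝓡∂ 2) c).right_inv ht.1] at h
    have hβ : HasDerivAt bdryPt (EuclideanSpace.single 1 1) t := by
      rw [hasDerivAt_iff_hasFDerivAt]
      have : bdryPt = fun t : ℝ => t • (EuclideanSpace.single 1 1 : Plane) := by
        funext t
        ext i
        fin_cases i <;> simp [bdryPt]
      rw [this]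
      simpa using ((hasDerivAt_id t).smul_const (EuclideanSpace.single 1 1 : Plane)).hasFDerivAt
    have h2 := h.comp_hasDerivAt t hβ (Filter.Eventually.of_forall bdryPt_mem_range)
    have h3 : ∀ i, HasDerivAt (fun r => (extChartAt (𝓡∂ 2) d
        ((extChartAt (𝓡∂ 2) c).symm (bdryPt r))) i)
        (tangentCoordChange (𝓡∂ 2) c d ((extChartAt (𝓡∂ 2) c).symm (bdryPt t))
        (EuclideanSpace.single 1 1) i) t := fun i =>
      (EuclideanSpace.proj (𝕜 := ℝ) i).hasFDerivAt.comp_hasDerivAt t h2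
    refine ⟨h3 1, ?_⟩
    have hopen := isOpen_bdryPt_preimage c (chartAt (EuclideanHalfSpace 2) d).open_source
    have hev : (fun r => (extChartAt (𝓡∂ 2) d
        ((extChartAt (𝓡∂ 2) c).symm (bdryPt r))) 0) =ᶠ[nhds t] fun _ => (0 : ℝ) := by
      filter_upwards [hopen.mem_nhds ⟨ht.1, hd ht.2⟩] with r hr
      exact (isBoundaryPoint_iff_coord d hr.2).1 (hcoord c r hr.1).2
    exact (h3 0).unique ((hasDerivAt_const t (0 : ℝ)).congr_of_eventuallyEq hev)
  have hinj : InjOn ψ (s c) := by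
    intro t ht r hr htr
    have h1 := hψ t ht
    rw [show ψ t = ψ r from htr, hψ r hr] at h1
    have h2 := (extChartAt (𝓡∂ 2) d).injOn (by simpa using hd hr.2) (by simpa using hd ht.2) h1
    have h3 := (extChartAt (𝓡∂ 2) c).symm.injOn hr.1 ht.1 h2
    simpa [bdryPt_one] using (congrArg (fun w : Plane => w 1) h3).symm
  rw [chartLength_apply c hA, chartLength_apply d hA]
  change ∫⁻ t in s d, _ = ∫⁻ t in s c, _
  rw [← himg, lintegral_image_eq_lintegral_abs_deriv_mul hsm
    (fun t ht => (hderiv t ht).1.hasDerivWithinAt) hinj]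
  refine setLIntegral_congr_fun hsm fun t ht => ?_
  have h1 := hc ht.2
  have h2 := hd ht.2
  simp only
  rw [hψ t ht, (extChartAt (𝓡∂ 2) d).left_inv (by simpa using h2),
    ← ENNReal.ofReal_mul (abs_nonneg _), ← Real.sqrt_sq_eq_abs, ← Real.sqrt_mul (sq_nonneg _),
    metricCoeff_change c d 1 1 h1 h2, (hderiv t ht).2]
  congr 2
  ring

theorem exists_open_small (c : M) {f : M → ℝ}
    (hf : ContinuousOn f (chartAt (EuclideanHalfSpace 2) c).source) :
    ∃ U : Set M, IsOpen U ∧ c ∈ U ∧ U ⊆ (chartAt (EuclideanHalfSpace 2) c).source ∧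
      ∀ x ∈ U, f x ≤ f c + 1 ∧ extChartAt (𝓡∂ 2) c x ∈ Metric.ball (extChartAt (𝓡∂ 2) c c) 1 := by
  have ho := (chartAt (EuclideanHalfSpace 2) c).open_source
  have hg := hf.prodMk (g := extChartAt (𝓡∂ 2) c)
    (by simpa using continuousOn_extChartAt (I := 𝓡∂ 2) c)
  refine ⟨_, hg.isOpen_inter_preimage ho (isOpen_Iio.prod Metric.isOpen_ball :
    IsOpen (Iio (f c + 1) ×ˢ Metric.ball (extChartAt (𝓡∂ 2) c c) 1)), ?_, inter_subset_left, ?_⟩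
  · exact ⟨mem_chart_source _ c, by simp, by simp⟩
  · rintro x ⟨_, hx1, hx2⟩
    exact ⟨le_of_lt hx1, hx2⟩

theorem chartArea_compl (c : M) :
    chartArea c (chartAt (EuclideanHalfSpace 2) c).sourceᶜ = 0 := by
  rw [chartArea_apply c (chartAt _ c).open_source.measurableSet.compl]
  have : (extChartAt (𝓡∂ 2) c).target ∩ (extChartAt (𝓡∂ 2) c).symm ⁻¹'
    ((chartAt (EuclideanHalfSpace 2) c).source)ᶜ = ∅ := by
    ext y
    simp only [mem_inter_iff, mem_preimage, mem_compl_iff, mem_empty_iff_false, iff_false,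
      not_and, not_not]
    intro hy
    simpa using (extChartAt (𝓡∂ 2) c).map_target hy
  rw [this]; simp

theorem chartLength_compl (c : M) :
    chartLength c (chartAt (EuclideanHalfSpace 2) c).sourceᶜ = 0 := by
  rw [chartLength_apply c (chartAt _ c).open_source.measurableSet.compl]
  have : {t : ℝ | bdryPt t ∈ (extChartAt (𝓡∂ 2) c).target} ∩
      (fun t => (extChartAt (𝓡∂ 2) c).symm (bdryPt t)) ⁻¹'
    ((chartAt (EuclideanHalfSpace 2) c).source)ᶜ = ∅ := by
    ext y
    simp only [mem_inter_iff, mem_preimage, mem_compl_iff, mem_empty_iff_false, iff_false,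
      not_and, not_not]
    intro hy
    simpa using (extChartAt (𝓡∂ 2) c).map_target hy
  rw [this]; simp

theorem area_apply (c : M) {A : Set M} (hA : MeasurableSet A)
    (hc : A ⊆ (chartAt (EuclideanHalfSpace 2) c).source) : area M A = chartArea c A :=
  iSup_measure_apply _ (fun c => (chartAt (EuclideanHalfSpace 2) c).source)
    (fun c => (chartAt _ c).open_source.measurableSet) chartArea_compl
    (fun c d _ hA hc hd => (chartArea_change c d hA hc hd).le) c hA hc

theorem boundaryLength_apply (c : M) {A : Set M} (hA : MeasurableSet A)
    (hc : A ⊆ (chartAt (EuclideanHalfSpace 2) c).source) :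
    boundaryLength M A = chartLength c A :=
  iSup_measure_apply _ (fun c => (chartAt (EuclideanHalfSpace 2) c).source)
    (fun c => (chartAt _ c).open_source.measurableSet) chartLength_compl
    (fun c d _ hA hc hd => (chartLength_change c d hA hc hd).le) c hA hc

theorem area_finite [CompactSpace M] : IsFiniteMeasure (area M) := by
  refine iSup_measure_finite _ (fun c => (chartAt (EuclideanHalfSpace 2) c).source)
    (fun c => (chartAt _ c).open_source.measurableSet) chartArea_compl
    (fun c d A hA hc hd => (chartArea_change c d hA hc hd).le) (fun c => ?_)
  have hf : ContinuousOn (areaDensity c) (chartAt (EuclideanHalfSpace 2) c).source :=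
    (((metricCoeff_contMDiffOn c 0 0).continuousOn.mul
      (metricCoeff_contMDiffOn c 1 1).continuousOn).sub
      ((metricCoeff_contMDiffOn c 0 1).continuousOn.pow 2)).sqrt
  obtain ⟨U, hU, hcU, hUV, hb⟩ := exists_open_small c hf
  refine ⟨U, hU, hcU, hUV, paramMeasure_lt_top _ (measurableSet_target c)
    (continuousOn_extChartAt_symm c) _ hU.measurableSet (Metric.isBounded_ball
      (x := extChartAt (𝓡∂ 2) c c) (r := 1)).measure_lt_top ?_ fun y _ hy => (hb _ hy).1⟩
  rintro y ⟨hy, hyU⟩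
  have := (hb _ hyU).2
  rwa [(extChartAt (𝓡∂ 2) c).right_inv hy] at this

theorem boundaryLength_finite [CompactSpace M] : IsFiniteMeasure (boundaryLength M) := by
  refine iSup_measure_finite _ (fun c => (chartAt (EuclideanHalfSpace 2) c).source)
    (fun c => (chartAt _ c).open_source.measurableSet) chartLength_compl
    (fun c d A hA hc hd => (chartLength_change c d hA hc hd).le) (fun c => ?_)
  have hf : ContinuousOn (fun x => Real.sqrt (metricCoeff c 1 1 x))
      (chartAt (EuclideanHalfSpace 2) c).source :=
    (metricCoeff_contMDiffOn c 1 1).continuousOn.sqrt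
  obtain ⟨U, hU, hcU, hUV, hb⟩ := exists_open_small c hf
  refine ⟨U, hU, hcU, hUV, paramMeasure_lt_top _
    (continuous_bdryPt.measurable (measurableSet_target c))
    ((continuousOn_extChartAt_symm c).comp continuous_bdryPt.continuousOn fun _ h => h) _
    hU.measurableSet (Metric.isBounded_ball
      (x := extChartAt (𝓡∂ 2) c c 1) (r := 1)).measure_lt_top ?_ fun y _ hy => (hb _ hy).1⟩
  rintro y ⟨hy, hyU⟩
  have := (hb _ hyU).2
  simp only [Function.comp] at this
  rw [(extChartAt (𝓡∂ 2) c).right_inv hy, Metric.mem_ball, dist_eq_norm] at this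
  rw [Metric.mem_ball, dist_eq_norm]
  refine lt_of_le_of_lt ?_ this
  simpa [bdryPt_one] using PiLp.norm_apply_le (bdryPt y - extChartAt (𝓡∂ 2) c c) 1

variable (M) in
/-- The real functions on the surface that are smooth up to the boundary. -/
def SmoothFunction : Type _ := C^∞⟮𝓡∂ 2, M; 𝓘(ℝ, ℝ), ℝ⟯

instance : AddCommGroup (SmoothFunction M) :=
  inferInstanceAs (AddCommGroup C^∞⟮𝓡∂ 2, M; 𝓘(ℝ, ℝ), ℝ⟯)

instance : Module ℝ (SmoothFunction M) :=
  inferInstanceAs (Module ℝ C^∞⟮𝓡∂ 2, M; 𝓘(ℝ, ℝ), ℝ⟯)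

instance : FunLike (SmoothFunction M) M ℝ :=
  inferInstanceAs (FunLike C^∞⟮𝓡∂ 2, M; 𝓘(ℝ, ℝ), ℝ⟯ M ℝ)

theorem SmoothFunction.contMDiff (u : SmoothFunction M) : ContMDiff (𝓡∂ 2) 𝓘(ℝ, ℝ) ∞ u :=
  ContMDiffMap.contMDiff u

theorem grad_add (u v : SmoothFunction M) (x : M) :
    grad (u + v : SmoothFunction M) x = grad u x + grad v x := by
  have h := mfderiv_add ((u.contMDiff.mdifferentiable (by simp)) x)
    ((v.contMDiff.mdifferentiable (by simp)) x)
  refine ext_inner_right ℝ fun w => ?_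
  rw [inner_add_left, inner_grad_left, inner_grad_left, inner_grad_left]
  exact congrArg (fun T => T w) h

theorem grad_smul (r : ℝ) (u : SmoothFunction M) (x : M) :
    grad (r • u : SmoothFunction M) x = r • grad u x := by
  have h := const_smul_mfderiv ((u.contMDiff.mdifferentiable (by simp)) x) r
  refine ext_inner_right ℝ fun w => ?_
  rw [real_inner_smul_left, inner_grad_left, inner_grad_left]
  exact congrArg (fun T => T w) h

instance [CompactSpace M] : IsFiniteMeasure (area M) := area_finite

instance [CompactSpace M] : IsFiniteMeasure (boundaryLength M) := boundaryLength_finite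

variable [CompactSpace M]

theorem integrable_h1 (u v : SmoothFunction M) :
    Integrable (fun x => u x * v x + inner ℝ (grad u x) (grad v x)) (area M) :=
  ((u.contMDiff.continuous.mul v.contMDiff.continuous).add
    (inner_grad_continuous u.contMDiff v.contMDiff)).integrable_of_hasCompactSupport
    (HasCompactSupport.of_compactSpace _)

/-- The inner product `∫ u v + ∫ ⟨∇u, ∇v⟩` on smooth functions. -/
@[reducible] def h1Core : PreInnerProductSpace.Core ℝ (SmoothFunction M) where
  inner u v := ∫ x, (u x * v x + inner ℝ (grad u x) (grad v x)) ∂(area M)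
  conj_inner_symm u v := by
    simp only [conj_trivial]
    exact integral_congr_ae (.of_forall fun x => by
      simp only [mul_comm (v x), real_inner_comm (grad v x)])
  re_inner_nonneg u :=
    integral_nonneg fun x => add_nonneg (mul_self_nonneg _) real_inner_self_nonneg
  add_left u v w := by
    rw [← integral_add (integrable_h1 u w) (integrable_h1 v w)]
    refine integral_congr_ae (.of_forall fun x => ?_)
    simp only [grad_add, inner_add_left]
    change (u x + v x) * w x + _ = _
    ring
  smul_left u v r := by
    simp only [conj_trivial]
    rw [← integral_const_mul]
    refine integral_congr_ae (.of_forall fun x => ?_)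
    simp only [grad_smul, real_inner_smul_left]
    change (r * u x) * v x + _ = _
    ring

instance : SeminormedAddCommGroup (SmoothFunction M) :=
  InnerProductSpace.Core.toSeminormedAddCommGroup (𝕜 := ℝ) (c := h1Core)

instance : InnerProductSpace ℝ (SmoothFunction M) := InnerProductSpace.ofCore h1Core

variable (M) in
/-- The Sobolev space `H¹` of the compact surface: the completion of the functions smooth up to the
boundary for the norm `(∫ u² + ∫ |∇u|²)^(1/2)`. -/
abbrev H1 : Type _ := UniformSpace.Completion (SmoothFunction M)

variable (M) in
/-- Smooth functions as continuous functions. -/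
def toContinuousMap : SmoothFunction M →ₗ[ℝ] C(M, ℝ) where
  toFun u := ⟨u, u.contMDiff.continuous⟩
  map_add' _ _ := rfl
  map_smul' _ _ := rfl

variable (M) in
/-- The class in `L²` of a smooth function. -/
def smoothToL2 : SmoothFunction M →ₗ[ℝ] Lp ℝ 2 (area M) :=
  (ContinuousMap.toLp 2 (area M) ℝ).toLinearMap ∘ₗ toContinuousMap M

variable (M) in
/-- The class in `L²` of the boundary of the restriction to the boundary of a smooth function. -/
def smoothTrace : SmoothFunction M →ₗ[ℝ] Lp ℝ 2 (boundaryLength M) :=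
  (ContinuousMap.toLp 2 (boundaryLength M) ℝ).toLinearMap ∘ₗ toContinuousMap M

variable (M) in
/-- The inclusion of the smooth functions in `H¹`. -/
def toH1 : SmoothFunction M →ₗ[ℝ] H1 M :=
  (UniformSpace.Completion.toComplₗᵢ (𝕜 := ℝ) (E := SmoothFunction M)).toLinearMap

variable (M) in
/-- The element of `L²` underlying an element of `H¹`: the continuous extension of the inclusion
of the smooth functions. -/
def toL2 : H1 M →L[ℝ] Lp ℝ 2 (area M) := (smoothToL2 M).extendOfNorm (toH1 M)

variable (M) in
/-- The trace on the boundary of an element of `H¹`: the continuous extension of the restriction of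
smooth functions to the boundary. -/
def trace : H1 M →L[ℝ] Lp ℝ 2 (boundaryLength M) := (smoothTrace M).extendOfNorm (toH1 M)

/-- The Dirichlet integral `∫ |∇u|²` of an element of `H¹`, that is, the continuous extension of
this integral from the smooth functions (`dirichletEnergy_toH1`). -/
def dirichletEnergy (u : H1 M) : ℝ := ‖u‖ ^ 2 - ‖toL2 M u‖ ^ 2

theorem denseRange_toH1 : DenseRange (toH1 M) := UniformSpace.Completion.denseRange_coe

theorem norm_sq_smooth (u : SmoothFunction M) :
    ‖u‖ ^ 2 = ‖smoothToL2 M u‖ ^ 2 + ∫ x, ‖grad u x‖ ^ 2 ∂(area M) := by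
  have h1 : ‖smoothToL2 M u‖ ^ 2 = ∫ x, u x * u x ∂(area M) := by
    rw [← real_inner_self_eq_norm_sq, L2.inner_def]
    refine integral_congr_ae ?_
    filter_upwards [ContinuousMap.coeFn_toLp (p := 2) (𝕜 := ℝ) (area M) (toContinuousMap M u)]
      with x hx
    change inner ℝ ((ContinuousMap.toLp 2 (area M) ℝ (toContinuousMap M u)) x)
      ((ContinuousMap.toLp 2 (area M) ℝ (toContinuousMap M u)) x) = _
    rw [hx]
    rfl
  have h2 : ‖u‖ ^ 2 = ∫ x, (u x * u x + inner ℝ (grad u x) (grad u x)) ∂(area M) :=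
    (real_inner_self_eq_norm_sq u).symm
  rw [h1, h2, integral_add]
  · simp only [real_inner_self_eq_norm_sq]
  · exact (u.contMDiff.continuous.mul u.contMDiff.continuous).integrable_of_hasCompactSupport
      (HasCompactSupport.of_compactSpace _)
  · exact (inner_grad_continuous u.contMDiff u.contMDiff).integrable_of_hasCompactSupport
      (HasCompactSupport.of_compactSpace _)

theorem norm_smoothToL2_le (u : SmoothFunction M) : ‖smoothToL2 M u‖ ≤ 1 * ‖toH1 M u‖ := by
  have h : ‖toH1 M u‖ = ‖u‖ := UniformSpace.Completion.norm_coe u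
  rw [one_mul, h]
  refine le_of_sq_le_sq ?_ (norm_nonneg _)
  rw [norm_sq_smooth]
  have : 0 ≤ ∫ x, ‖grad u x‖ ^ 2 ∂(area M) := integral_nonneg fun _ => sq_nonneg _
  linarith

theorem toL2_toH1 (u : SmoothFunction M) : toL2 M (toH1 M u) = smoothToL2 M u :=
  LinearMap.extendOfNorm_eq denseRange_toH1 ⟨1, norm_smoothToL2_le⟩ u

theorem dirichletEnergy_toH1 (u : SmoothFunction M) :
    dirichletEnergy (toH1 M u) = ∫ x, ‖grad u x‖ ^ 2 ∂(area M) := by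
  have h : ‖toH1 M u‖ = ‖u‖ := UniformSpace.Completion.norm_coe u
  rw [dirichletEnergy, toL2_toH1, h, norm_sq_smooth]
  ring

/-- The coefficient `g_ij` as a function of the coordinates in the chart centred at `c`. -/
def chartMetric (c : M) (i j : Fin 2) (y : Plane) : ℝ :=
  metricCoeff c i j ((extChartAt (𝓡∂ 2) c).symm y)

/-- The `k`-th partial derivative of a function on the half-plane (one-sided at its boundary). -/
def partialDeriv (k : Fin 2) (f : Plane → ℝ) (y : Plane) : ℝ :=
  fderivWithin ℝ f (range (𝓡∂ 2)) y (EuclideanSpace.single k 1)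

/-- The Gaussian curvature of the metric `E du² + 2 F du dv + G dv²`, by Brioschi's formula
in the chart centred at the point. -/
def gaussianCurvature (x : M) : ℝ :=
  let E := chartMetric x 0 0
  let F := chartMetric x 0 1
  let G := chartMetric x 1 1
  let y := extChartAt (𝓡∂ 2) x x
  ((!![-(partialDeriv 1 (partialDeriv 1 E) y) / 2 + partialDeriv 0 (partialDeriv 1 F) y
          - partialDeriv 0 (partialDeriv 0 G) y / 2,
        partialDeriv 0 E y / 2, partialDeriv 0 F y - partialDeriv 1 E y / 2;
      partialDeriv 1 F y - partialDeriv 0 G y / 2, E y, F y;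
      partialDeriv 1 G y / 2, F y, G y] : Matrix (Fin 3) (Fin 3) ℝ).det
    - (!![0, partialDeriv 1 E y / 2, partialDeriv 0 G y / 2;
      partialDeriv 1 E y / 2, E y, F y;
      partialDeriv 0 G y / 2, F y, G y] : Matrix (Fin 3) (Fin 3) ℝ).det)
    / (E y * G y - F y ^ 2) ^ 2

/-- The energy
`I(u) = ∫ (½ |∇u|² + 2 K₀ u + 2 |K| e^u) - 4 ∮ h e^(u/2)` on `H¹`, where `K₀` is the Gaussian
curvature of the background metric. -/
def energy (K h : M → ℝ) (u : H1 M) : ℝ :=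
  1 / 2 * dirichletEnergy u
    + ∫ x, (2 * gaussianCurvature x * toL2 M u x + 2 * |K x| * Real.exp (toL2 M u x)) ∂(area M)
    - 4 * ∫ x, h x * Real.exp (trace M u x / 2) ∂(boundaryLength M)

/-- The function `𝔇 = h / √|K|`. -/
def curvatureRatio (K h : M → ℝ) (x : M) : ℝ := h x / Real.sqrt |K x|

/-- The min-max level `inf_γ max_t I(γ(t))` over the continuous paths in `H¹` from `u₀` to `u₁`. -/
def minMaxLevel (K h : M → ℝ) (u₀ u₁ : H1 M) : ℝ :=
  ⨅ γ : Path u₀ u₁, ⨆ t : unitInterval, energy K h (γ t)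

end

end RiemannianSurface

/-!
All analytic estimates come from the fundamental theorem of calculus on coordinate boxes, which are
rectangles or, at the boundary, rectangles with one side on the boundary. There, a function of two
variables is bounded by integrals of its derivative along either coordinate line, and this gives
`‖u‖_{L²} ≤ K ‖u‖_{W^{1,1}}` (the Gagliardo–Nirenberg argument), the trace inequality in `L¹`, and a
bound for the integral of `|u x - u y|` by the `L¹` norm of the gradient. By compactness, the first
two hold on the surface (`exists_sobolev`, `exists_trace_le`); chaining overlapping boxes on the
connected surface gives the `L¹` Poincaré inequality (`exists_poincare`), and with the Sobolev
inequality the one in `H¹` (`exists_norm_sub_mean_le`).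

*Exponential integrability.* No sharp Trudinger inequality is needed. The Sobolev inequality for
`cosh φ - 1`, whose gradient is at most `|∇φ| cosh φ`, bounds `∫ cosh² φ` by a constant plus a small
multiple of itself as soon as the `H¹` norm of `φ` is small (`exists_integral_cosh_sq_le`). Hence
the integrals of `|e^φ - 1|` over the surface and over its boundary are `O(‖φ‖)` on a small ball
(`exists_integral_abs_exp_sub_one_le`), first for smooth functions, and then on `H¹` by Fatou's
lemma. As smooth functions are bounded and dense, all exponentials are integrable
(`IsRestriction.integrable_exp`), and the energy is continuous (`continuous_energy`).

*Mountain pass.* Where the Dirichlet integral `D` is small, the Poincaré inequality makes the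
boundary term equal to `-4 e^{m/2} (∮ h + O(√D))`, with `m` the mean value. As `∮ h < 0`, the energy
is positive on the region `D ≤ r²`, `e^{m/2} ≤ δ`, and bounded below by a positive constant on the
frontier of this region. The constant functions in this region have positive energy, which tends to
`0` at `-∞`; so a very negative constant and any element with negative energy are separated by the
frontier, which every path between them crosses (`exists_mountain_pass`).

*Unboundedness.* Let `p` be a boundary point with `h > √|K|`, and `s ≥ 0` a smooth function which
vanishes only at `p` and is `a y₀ + (y₁ - q)²` near `p`, with `a` such that `|∇s| = √|K|` at `p`.
For `u = -2 log (s + δ)` all terms of the energy are of the order of `∫ dt / (t² + δ)`: the gradient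
term and the area term contribute equally, and their sum is beaten by the boundary term exactly
because `h > √|K|` at `p`. As `δ → 0` the energy tends to `-∞` (`exists_energy_lt`).
-/

namespace RiemannianSurface

noncomputable section

open Filter Topology

set_option linter.unusedSectionVars false

/-! ### Coordinate boxes at interior and boundary points -/

section Charts

variable {M : Type*} [TopologicalSpace M] [ChartedSpace (EuclideanHalfSpace 2) M]
  [IsManifold (𝓡∂ 2) ∞ M]

/-- The point of the plane with coordinates `(s, t)`. -/
def planePt (s t : ℝ) : Plane := !₂[s, t]

@[simp] theorem planePt_zero (s t : ℝ) : planePt s t 0 = s := by simp [planePt]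

@[simp] theorem planePt_one (s t : ℝ) : planePt s t 1 = t := by simp [planePt]

theorem planePt_eta (y : Plane) : planePt (y 0) (y 1) = y := by
  ext i; fin_cases i <;> simp [planePt]

theorem continuous_planePt : Continuous fun z : ℝ × ℝ => planePt z.1 z.2 := by
  unfold planePt; fun_prop

/-- The point of the surface with coordinates `(s, t)` in the chart centred at `c`. -/
def chartPt (c : M) (s t : ℝ) : M := (extChartAt (𝓡∂ 2) c).symm (planePt s t)

/-- The `i`-th coordinate in the chart centred at `c`. -/
def coord (c : M) (i : Fin 2) (x : M) : ℝ := extChartAt (𝓡∂ 2) c x i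

/-- The points whose coordinates in the chart centred at `c` differ by less than `r` from those
of `c`. -/
def box (c : M) (r : ℝ) : Set M :=
  (chartAt (EuclideanHalfSpace 2) c).source ∩
    {x | |coord c 0 x - coord c 0 c| < r ∧ |coord c 1 x - coord c 1 c| < r}

/-- The radius `r` is so small that the chart centred at `c` maps `box c r` onto a full square, or
onto the part of this square in the closed half-plane. -/
structure IsBox (c : M) (r : ℝ) : Prop where
  pos : 0 < r
  mem_target : ∀ s t, 0 ≤ s → |s - coord c 0 c| < r → |t - coord c 1 c| < r →
    planePt s t ∈ (extChartAt (𝓡∂ 2) c).target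

theorem box_subset_source (c : M) (r : ℝ) :
    box c r ⊆ (chartAt (EuclideanHalfSpace 2) c).source := inter_subset_left

theorem extChartAt_eq_planePt (c x : M) :
    extChartAt (𝓡∂ 2) c x = planePt (coord c 0 x) (coord c 1 x) :=
  (planePt_eta _).symm

theorem coord_nonneg (c : M) {x : M} (hx : x ∈ (chartAt (EuclideanHalfSpace 2) c).source) :
    0 ≤ coord c 0 x := by
  have h := extChartAt_target_subset_range c
    ((extChartAt (𝓡∂ 2) c).map_source (by simpa using hx))
  rw [range_modelWithCornersEuclideanHalfSpace] at h
  exact h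

theorem planePt_mem_range {s : ℝ} (hs : 0 ≤ s) (t : ℝ) : planePt s t ∈ range (𝓡∂ 2) := by
  rw [range_modelWithCornersEuclideanHalfSpace]
  simpa using hs

theorem isOpen_box (c : M) (r : ℝ) : IsOpen (box c r) := by
  have hc : ContinuousOn (extChartAt (𝓡∂ 2) c) (chartAt (EuclideanHalfSpace 2) c).source := by
    simpa using continuousOn_extChartAt (I := 𝓡∂ 2) c
  have hopen : ∀ i : Fin 2, IsOpen {y : Plane | |y i - coord c i c| < r} := fun i =>
    isOpen_lt (by fun_prop) continuous_const
  exact hc.isOpen_inter_preimage (chartAt (EuclideanHalfSpace 2) c).open_source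
    ((hopen 0).inter (hopen 1))

theorem mem_box_self (c : M) {r : ℝ} (hr : 0 < r) : c ∈ box c r :=
  ⟨mem_chart_source _ c, by simpa using hr, by simpa using hr⟩

theorem chartPt_coord (c : M) {x : M} (hx : x ∈ (chartAt (EuclideanHalfSpace 2) c).source) :
    chartPt c (coord c 0 x) (coord c 1 x) = x := by
  rw [chartPt, ← extChartAt_eq_planePt, (extChartAt (𝓡∂ 2) c).left_inv (by simpa using hx)]

theorem coord_zero_chartPt {c : M} {s t : ℝ} (h : planePt s t ∈ (extChartAt (𝓡∂ 2) c).target) :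
    coord c 0 (chartPt c s t) = s := by
  rw [coord, chartPt, (extChartAt (𝓡∂ 2) c).right_inv h, planePt_zero]

theorem coord_one_chartPt {c : M} {s t : ℝ} (h : planePt s t ∈ (extChartAt (𝓡∂ 2) c).target) :
    coord c 1 (chartPt c s t) = t := by
  rw [coord, chartPt, (extChartAt (𝓡∂ 2) c).right_inv h, planePt_one]

theorem chartPt_mem_source {c : M} {s t : ℝ} (h : planePt s t ∈ (extChartAt (𝓡∂ 2) c).target) :
    chartPt c s t ∈ (chartAt (EuclideanHalfSpace 2) c).source := by
  have := (extChartAt (𝓡∂ 2) c).map_target h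
  rwa [extChartAt_source] at this

/-- Every neighbourhood of `c` contains a box around `c` whose coordinates fill a square, or the
part of a square in the closed half-plane. -/
theorem exists_isBox (c : M) {N : Set M} (hN : N ∈ 𝓝 c) : ∃ r, IsBox c r ∧ box c r ⊆ N := by
  have h1 : (extChartAt (𝓡∂ 2) c).symm ⁻¹' N ∩ range (𝓡∂ 2) ∈
      𝓝[range (𝓡∂ 2)] (extChartAt (𝓡∂ 2) c c) := by
    refine inter_mem ?_ self_mem_nhdsWithin
    have := extChartAt_preimage_mem_nhdsWithin (I := 𝓡∂ 2) (s := univ) (x := c)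
      (mem_nhdsWithin_of_mem_nhds hN)
    simpa using this
  have h2 := inter_mem h1 (extChartAt_target_mem_nhdsWithin (I := 𝓡∂ 2) c)
  rw [mem_nhdsWithin] at h2
  obtain ⟨V, hV, hcV, hsub⟩ := h2
  have h3 : (fun z : ℝ × ℝ => planePt z.1 z.2) ⁻¹' V ∈ 𝓝 (coord c 0 c, coord c 1 c) := by
    refine continuous_planePt.continuousAt.preimage_mem_nhds (hV.mem_nhds ?_)
    rw [← extChartAt_eq_planePt]
    exact hcV
  obtain ⟨r, hr, hball⟩ := Metric.mem_nhds_iff.1 h3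
  have h4 : ∀ s t, 0 ≤ s → |s - coord c 0 c| < r → |t - coord c 1 c| < r →
      planePt s t ∈ (extChartAt (𝓡∂ 2) c).target ∧ chartPt c s t ∈ N := by
    intro s t hs h h'
    have h5 : planePt s t ∈ V := by
      have : (s, t) ∈ Metric.ball (coord c 0 c, coord c 1 c) r := by
        rw [Metric.mem_ball, Prod.dist_eq, max_lt_iff, Real.dist_eq, Real.dist_eq]
        exact ⟨h, h'⟩
      exact hball this
    have h6 := hsub ⟨h5, planePt_mem_range hs t⟩
    exact ⟨h6.2, h6.1.1⟩
  refine ⟨r, ⟨hr, fun s t hs h h' => (h4 s t hs h h').1⟩, fun x hx => ?_⟩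
  have := (h4 _ _ (coord_nonneg c hx.1) hx.2.1 hx.2.2).2
  rwa [chartPt_coord c hx.1] at this

theorem IsBox.chartPt_mem {c : M} {r : ℝ} (hb : IsBox c r) {s t : ℝ} (hs : 0 ≤ s)
    (h : |s - coord c 0 c| < r) (h' : |t - coord c 1 c| < r) : chartPt c s t ∈ box c r := by
  have ht := hb.mem_target s t hs h h'
  refine ⟨chartPt_mem_source ht, ?_⟩
  simp only [mem_ofPred_eq]
  rw [coord_zero_chartPt ht, coord_one_chartPt ht]
  exact ⟨h, h'⟩

theorem continuousOn_chartPt (c : M) : ContinuousOn (fun z : ℝ × ℝ => chartPt c z.1 z.2)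
    {z | planePt z.1 z.2 ∈ (extChartAt (𝓡∂ 2) c).target} :=
  (continuousOn_extChartAt_symm c).comp continuous_planePt.continuousOn fun _ h => h

/-- The range of the first coordinate on a box, without its end points. -/
def rangeZero (c : M) (r : ℝ) : Set ℝ := Ioo (max 0 (coord c 0 c - r)) (coord c 0 c + r)

/-- The range of the second coordinate on a box. -/
def rangeOne (c : M) (r : ℝ) : Set ℝ := Ioo (coord c 1 c - r) (coord c 1 c + r)

theorem mem_rangeZero {c : M} {r s : ℝ} :
    s ∈ rangeZero c r ↔ 0 < s ∧ |s - coord c 0 c| < r := by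
  rw [rangeZero, mem_Ioo, max_lt_iff, abs_lt]
  constructor
  · rintro ⟨⟨h1, h2⟩, h3⟩
    exact ⟨h1, by linarith, by linarith⟩
  · rintro ⟨h1, h2, h3⟩
    exact ⟨⟨h1, by linarith⟩, by linarith⟩

theorem mem_rangeOne {c : M} {r t : ℝ} : t ∈ rangeOne c r ↔ |t - coord c 1 c| < r := by
  rw [rangeOne, mem_Ioo, abs_lt]
  constructor <;> rintro ⟨h1, h2⟩ <;> constructor <;> linarith

end Charts

/-! ### Area and boundary length in coordinates -/

section Integration

variable {M : Type*} [TopologicalSpace M] [ChartedSpace (EuclideanHalfSpace 2) M]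
  [IsManifold (𝓡∂ 2) ∞ M]
  [RiemannianBundle (fun x : M ↦ TangentSpace (𝓡∂ 2) x)]
  [IsContMDiffRiemannianBundle (𝓡∂ 2) ∞ Plane (fun x : M ↦ TangentSpace (𝓡∂ 2) x)]
  [MeasurableSpace M] [BorelSpace M]

theorem setLIntegral_paramMeasure {X : Type*} [MeasurableSpace X] [TopologicalSpace X]
    [OpensMeasurableSpace X] (lam : Measure X) {S : Set X} (hS : MeasurableSet S) {p : X → M}
    (hp : ContinuousOn p S) {f : X → ℝ} (hf : ContinuousOn f S) {A : Set M} (hA : MeasurableSet A)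
    {G : M → ℝ≥0∞} (hG : Measurable G) :
    ∫⁻ x in A, G x ∂(paramMeasure lam S p f)
      = ∫⁻ y in S ∩ p ⁻¹' A, G (p y) * ENNReal.ofReal (f y) ∂lam := by
  have hpm : AEMeasurable p (lam.restrict S) := hp.aemeasurable hS
  have hfm : AEMeasurable (fun y => ENNReal.ofReal (f y)) (lam.restrict S) :=
    (hf.aemeasurable hS).ennreal_ofReal
  have hGA : Measurable (A.indicator G) := hG.indicator hA
  have hac := withDensity_absolutelyContinuous (lam.restrict S) fun y => ENNReal.ofReal (f y)
  rw [← lintegral_indicator hA, paramMeasure,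
    lintegral_map' hGA.aemeasurable (hpm.mono_ac hac),
    lintegral_withDensity_eq_lintegral_mul₀' (g := fun y => A.indicator G (p y)) hfm
      (hGA.comp_aemeasurable (hpm.mono_ac hac)), inter_comm,
    ← Measure.restrict_restrict₀ (hpm.nullMeasurableSet_preimage hA),
    ← lintegral_indicator₀ (hpm.nullMeasurableSet_preimage hA)]
  refine lintegral_congr fun y => ?_
  by_cases hy : p y ∈ A
  · rw [indicator_of_mem (show y ∈ p ⁻¹' A from hy)]
    simp [hy, mul_comm]
  · rw [indicator_of_notMem (show y ∉ p ⁻¹' A from hy)]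
    simp [hy]

theorem area_restrict (c : M) {A : Set M} (hA : MeasurableSet A)
    (hc : A ⊆ (chartAt (EuclideanHalfSpace 2) c).source) :
    (area M).restrict A = (chartArea c).restrict A := by
  ext B hB
  rw [Measure.restrict_apply hB, Measure.restrict_apply hB,
    area_apply c (hB.inter hA) (inter_subset_right.trans hc)]

theorem boundaryLength_restrict (c : M) {A : Set M} (hA : MeasurableSet A)
    (hc : A ⊆ (chartAt (EuclideanHalfSpace 2) c).source) :
    (boundaryLength M).restrict A = (chartLength c).restrict A := by
  ext B hB
  rw [Measure.restrict_apply hB, Measure.restrict_apply hB,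
    boundaryLength_apply c (hB.inter hA) (inter_subset_right.trans hc)]

theorem continuousOn_areaDensity (c : M) :
    ContinuousOn (areaDensity c) (chartAt (EuclideanHalfSpace 2) c).source :=
  (((metricCoeff_contMDiffOn c 0 0).continuousOn.mul
    (metricCoeff_contMDiffOn c 1 1).continuousOn).sub
    ((metricCoeff_contMDiffOn c 0 1).continuousOn.pow 2)).sqrt

theorem areaDensity_pos (c : M) {x : M} (hx : x ∈ (chartAt (EuclideanHalfSpace 2) c).source) :
    0 < areaDensity c x := Real.sqrt_pos.2 (gramDet_pos c hx)

/-- The density of the Riemannian length of the second coordinate lines. -/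
def lengthDensity (c : M) (x : M) : ℝ := Real.sqrt (metricCoeff c 1 1 x)

theorem continuousOn_lengthDensity (c : M) :
    ContinuousOn (lengthDensity c) (chartAt (EuclideanHalfSpace 2) c).source :=
  (metricCoeff_contMDiffOn c 1 1).continuousOn.sqrt

theorem setLIntegral_plane {S T : Set ℝ} {H : ℝ → ℝ → ℝ≥0∞}
    (hH : AEMeasurable (fun z : ℝ × ℝ => H z.1 z.2) (volume.restrict (S ×ˢ T))) :
    ∫⁻ y in {y : Plane | y 0 ∈ S ∧ y 1 ∈ T}, H (y 0) (y 1)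
      = ∫⁻ s in S, ∫⁻ t in T, H s t := by
  have e : MeasurePreserving (fun y : Plane => (y 0, y 1)) volume volume :=
    (volume_preserving_finTwoArrow ℝ).comp (PiLp.volume_preserving_ofLp (Fin 2))
  have emb : MeasurableEmbedding (fun y : Plane => (y 0, y 1)) :=
    (MeasurableEquiv.finTwoArrow.measurableEmbedding).comp
      (MeasurableEquiv.toLp 2 (Fin 2 → ℝ)).symm.measurableEmbedding
  rw [show volume.restrict (S ×ˢ T) = ((volume : Measure ℝ).prod volume).restrict (S ×ˢ T)
    from rfl] at hH
  rw [← setLIntegral_prod (fun z : ℝ × ℝ => H z.1 z.2) hH]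
  exact e.setLIntegral_comp_preimage_emb emb (fun z : ℝ × ℝ => H z.1 z.2) (S ×ˢ T)

/-- The Riemannian area on a box in coordinates. -/
theorem setLIntegral_area_box {c : M} {r : ℝ} (hb : IsBox c r) {G : M → ℝ≥0∞}
    (hG : Measurable G) :
    ∫⁻ x in box c r, G x ∂(area M) = ∫⁻ s in rangeZero c r, ∫⁻ t in rangeOne c r,
      G (chartPt c s t) * ENNReal.ofReal (areaDensity c (chartPt c s t)) := by
  have hm := (isOpen_box c r).measurableSet
  have hcont : ContinuousOn (fun y => areaDensity c ((extChartAt (𝓡∂ 2) c).symm y))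
      (extChartAt (𝓡∂ 2) c).target :=
    (continuousOn_areaDensity c).comp (continuousOn_extChartAt_symm c) fun y hy => by
      simpa using (extChartAt (𝓡∂ 2) c).map_target hy
  rw [area_restrict c hm (box_subset_source c r), chartArea,
    setLIntegral_paramMeasure _ (measurableSet_target c) (continuousOn_extChartAt_symm c)
      hcont hm hG]
  have hopen : IsOpen (rangeZero c r ×ˢ rangeOne c r) := isOpen_Ioo.prod isOpen_Ioo
  have hmaps : MapsTo (fun z : ℝ × ℝ => (z.1, z.2)) (rangeZero c r ×ˢ rangeOne c r)
      {z | planePt z.1 z.2 ∈ (extChartAt (𝓡∂ 2) c).target} := fun z hz =>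
    hb.mem_target _ _ (mem_rangeZero.1 hz.1).1.le (mem_rangeZero.1 hz.1).2 (mem_rangeOne.1 hz.2)
  have hcp : ContinuousOn (fun z : ℝ × ℝ => chartPt c z.1 z.2)
      (rangeZero c r ×ˢ rangeOne c r) := (continuousOn_chartPt c).mono hmaps
  have hH : AEMeasurable (fun z : ℝ × ℝ => G (chartPt c z.1 z.2) *
      ENNReal.ofReal (areaDensity c (chartPt c z.1 z.2)))
      (volume.restrict (rangeZero c r ×ˢ rangeOne c r)) := by
    refine AEMeasurable.mul (hG.comp_aemeasurable (hcp.aemeasurable hopen.measurableSet)) ?_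
    exact (((continuousOn_areaDensity c).comp hcp fun z hz =>
      chartPt_mem_source (hmaps hz)).aemeasurable hopen.measurableSet).ennreal_ofReal
  rw [← setLIntegral_plane (H := fun s t => G (chartPt c s t) *
    ENNReal.ofReal (areaDensity c (chartPt c s t))) hH]
  simp only [chartPt, planePt_eta]
  refine setLIntegral_congr ?_
  -- the two sets of coordinates differ by a part of the boundary line, a null set
  have hnull : volume {y : Plane | y 0 = 0} = 0 := by
    have e : MeasurePreserving (fun y : Plane => (y 0, y 1)) volume volume :=
      (volume_preserving_finTwoArrow ℝ).comp (PiLp.volume_preserving_ofLp (Fin 2))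
    have h1 : {y : Plane | y 0 = 0} = (fun y : Plane => (y 0, y 1)) ⁻¹' ({0} ×ˢ univ) := by
      ext y; simp
    rw [h1, e.measure_preimage ((measurableSet_singleton _).prod MeasurableSet.univ
      ).nullMeasurableSet, show (volume : Measure (ℝ × ℝ)) = (volume : Measure ℝ).prod volume
      from rfl, Measure.prod_prod]
    simp
  have hae : ∀ᵐ y : Plane, y 0 ≠ 0 := by
    rw [ae_iff]
    simpa using hnull
  filter_upwards [hae] with y hy
  refine propext ⟨fun h => ?_, fun h => ?_⟩
  · have h2 := h.2.2
    have h0 := coord_nonneg c h.2.1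
    simp only [mem_ofPred_eq, coord, (extChartAt (𝓡∂ 2) c).right_inv h.1] at h2 h0
    exact ⟨mem_rangeZero.2 ⟨lt_of_le_of_ne h0 (Ne.symm hy), h2.1⟩, mem_rangeOne.2 h2.2⟩
  · have h1 := mem_rangeZero.1 h.1
    have h2 := mem_rangeOne.1 h.2
    have h3 := hb.mem_target _ _ h1.1.le h1.2 h2
    have h4 := hb.chartPt_mem h1.1.le h1.2 h2
    rw [planePt_eta] at h3
    rw [chartPt, planePt_eta] at h4
    exact ⟨h3, h4⟩

/-- The Riemannian length of the boundary on a box in coordinates; the box meets the boundary only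
if its first coordinate reaches zero. -/
theorem setLIntegral_boundaryLength_box {c : M} {r : ℝ} (hb : IsBox c r) {G : M → ℝ≥0∞}
    (hG : Measurable G) :
    ∫⁻ x in box c r, G x ∂(boundaryLength M) = if coord c 0 c < r then
      ∫⁻ t in rangeOne c r,
        G (chartPt c 0 t) * ENNReal.ofReal (lengthDensity c (chartPt c 0 t)) else 0 := by
  have hm := (isOpen_box c r).measurableSet
  have hmS : MeasurableSet {t : ℝ | bdryPt t ∈ (extChartAt (𝓡∂ 2) c).target} :=
    continuous_bdryPt.measurable (measurableSet_target c)
  have hp : ContinuousOn (fun t => (extChartAt (𝓡∂ 2) c).symm (bdryPt t))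
      {t : ℝ | bdryPt t ∈ (extChartAt (𝓡∂ 2) c).target} :=
    (continuousOn_extChartAt_symm c).comp continuous_bdryPt.continuousOn fun _ h => h
  have hd : ContinuousOn
      (fun t => Real.sqrt (metricCoeff c 1 1 ((extChartAt (𝓡∂ 2) c).symm (bdryPt t))))
      {t : ℝ | bdryPt t ∈ (extChartAt (𝓡∂ 2) c).target} :=
    (continuousOn_lengthDensity c).comp hp fun t ht => by
      simpa using (extChartAt (𝓡∂ 2) c).map_target ht
  rw [boundaryLength_restrict c hm (box_subset_source c r), chartLength,
    setLIntegral_paramMeasure _ hmS hp hd hm hG]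
  have h00 := coord_nonneg c (mem_chart_source _ c)
  have key : {t : ℝ | bdryPt t ∈ (extChartAt (𝓡∂ 2) c).target} ∩
      (fun t => (extChartAt (𝓡∂ 2) c).symm (bdryPt t)) ⁻¹' box c r
      = if coord c 0 c < r then rangeOne c r else ∅ := by
    ext t
    constructor
    · rintro ⟨h1, h2⟩
      have h3 : |0 - coord c 0 c| < r := by
        have := h2.2.1
        rwa [show coord c 0 ((extChartAt (𝓡∂ 2) c).symm (bdryPt t)) = 0
          from coord_zero_chartPt (s := 0) h1] at this
      have h4 : |t - coord c 1 c| < r := by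
        have := h2.2.2
        rwa [show coord c 1 ((extChartAt (𝓡∂ 2) c).symm (bdryPt t)) = t
          from coord_one_chartPt (s := 0) h1] at this
      rw [zero_sub, abs_neg, abs_of_nonneg h00] at h3
      rw [if_pos h3]
      exact mem_rangeOne.2 h4
    · split_ifs with h3
      · intro ht
        have h4 : |0 - coord c 0 c| < r := by rwa [zero_sub, abs_neg, abs_of_nonneg h00]
        exact ⟨hb.mem_target 0 t le_rfl h4 (mem_rangeOne.1 ht),
          hb.chartPt_mem le_rfl h4 (mem_rangeOne.1 ht)⟩
      · exact fun h => h.elim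
  rw [key]
  split_ifs
  · rfl
  · simp

theorem volume_rangeZero_pos {c : M} {r : ℝ} (hr : 0 < r) : 0 < volume (rangeZero c r) := by
  have h00 := coord_nonneg c (mem_chart_source _ c)
  rw [rangeZero, Real.volume_Ioo, ENNReal.ofReal_pos, sub_pos, max_lt_iff]
  constructor <;> linarith

theorem volume_rangeOne_pos {c : M} {r : ℝ} (hr : 0 < r) : 0 < volume (rangeOne c r) := by
  rw [rangeOne, Real.volume_Ioo, ENNReal.ofReal_pos]
  linarith

instance area_isOpenPosMeasure : (area M).IsOpenPosMeasure := by
  refine ⟨fun U hU ⟨c, hc⟩ h0 => ?_⟩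
  have hev : ∀ᶠ x in 𝓝 c, areaDensity c c / 2 < areaDensity c x :=
    ((continuousOn_areaDensity c).continuousAt
      ((chartAt _ c).open_source.mem_nhds (mem_chart_source _ c))).eventually_const_lt
      (half_lt_self (areaDensity_pos c (mem_chart_source _ c)))
  obtain ⟨r, hb, hsub⟩ := exists_isBox c (inter_mem (hU.mem_nhds hc) hev)
  have h1 := setLIntegral_area_box hb (G := fun _ => 1) measurable_const
  rw [setLIntegral_one, measure_mono_null (hsub.trans inter_subset_left) h0] at h1
  have h2 : ∫⁻ _ in rangeZero c r, ∫⁻ _ in rangeOne c r, ENNReal.ofReal (areaDensity c c / 2)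
      ≤ 0 := by
    rw [h1]
    refine setLIntegral_mono' measurableSet_Ioo fun s hs =>
      setLIntegral_mono' measurableSet_Ioo fun t ht => ?_
    rw [one_mul]
    have hs' := mem_rangeZero.1 hs
    exact ENNReal.ofReal_le_ofReal
      (hsub (hb.chartPt_mem hs'.1.le hs'.2 (mem_rangeOne.1 ht))).2.le
  rw [setLIntegral_const, setLIntegral_const, nonpos_iff_eq_zero, mul_eq_zero, mul_eq_zero] at h2
  have hd := ENNReal.ofReal_pos.2 (half_pos (areaDensity_pos c (mem_chart_source _ c)))
  rcases h2 with (h2 | h2) | h2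
  · exact hd.ne' h2
  · exact (volume_rangeOne_pos hb.pos).ne' h2
  · exact (volume_rangeZero_pos hb.pos).ne' h2

end Integration

/-! ### One-dimensional estimates on rectangles of the plane -/

section Plane

theorem enorm_sub_le_lintegral_deriv {a b : ℝ} {g g' : ℝ → ℝ}
    (hg : ∀ s ∈ Ioo a b, HasDerivAt g (g' s) s) (hg' : ContinuousOn g' (Ioo a b))
    {s t : ℝ} (hs : s ∈ Ioo a b) (ht : t ∈ Ioo a b) :
    ‖g s - g t‖ₑ ≤ ∫⁻ σ in Ioo a b, ‖g' σ‖ₑ := by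
  have hsub : uIcc t s ⊆ Ioo a b := ordConnected_Ioo.uIcc_subset ht hs
  rw [← intervalIntegral.integral_eq_sub_of_hasDerivAt (fun x hx => hg x (hsub hx))
    ((hg'.mono hsub).intervalIntegrable), ← Real.enorm_abs,
    intervalIntegral.abs_integral_eq_abs_integral_uIoc, Real.enorm_abs]
  exact (enorm_integral_le_lintegral_enorm _).trans
    (lintegral_mono_set (uIoc_subset_uIcc.trans hsub))

theorem enorm_sub_left_le_lintegral_deriv {a b : ℝ} {g g' : ℝ → ℝ}
    (hg : ∀ s ∈ Ioo a b, HasDerivAt g (g' s) s) (hg' : ContinuousOn g' (Ioo a b))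
    (hc : ContinuousWithinAt g (Ioo a b) a) {t : ℝ} (ht : t ∈ Ioo a b) :
    ‖g a - g t‖ₑ ≤ ∫⁻ σ in Ioo a b, ‖g' σ‖ₑ := by
  have hne : (𝓝[Ioo a b] a).NeBot := by
    rw [← mem_closure_iff_nhdsWithin_neBot, closure_Ioo (ht.1.trans ht.2).ne]
    exact left_mem_Icc.2 (ht.1.trans ht.2).le
  refine le_of_tendsto (((hc.tendsto).sub_const (g t)).enorm) ?_
  filter_upwards [self_mem_nhdsWithin] with s hs
  exact enorm_sub_le_lintegral_deriv hg hg' hs ht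

/-- A value which differs from `g` by at most `d` is bounded by the mean of `|g|` plus `d`. -/
theorem enorm_le_of_enorm_sub_le {S : Set ℝ} (hS : MeasurableSet S) (h0 : volume S ≠ 0)
    (h1 : volume S ≠ ⊤) {z : ℝ} {g : ℝ → ℝ} {F : ℝ → ℝ≥0∞}
    (hgF : ∀ t ∈ S, ‖g t‖ₑ ≤ F t) (hz : ∀ t ∈ S, ‖z - g t‖ₑ ≤ ∫⁻ σ in S, F σ) :
    ‖z‖ₑ ≤ ((volume S)⁻¹ + 1) * ∫⁻ σ in S, F σ := by
  have h : volume S * ‖z‖ₑ ≤ (1 + volume S) * ∫⁻ σ in S, F σ := by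
    calc volume S * ‖z‖ₑ = ∫⁻ _ in S, ‖z‖ₑ := by rw [setLIntegral_const, mul_comm]
      _ ≤ ∫⁻ t in S, (F t + ∫⁻ σ in S, F σ) := by
          refine setLIntegral_mono' hS fun t ht => ?_
          calc ‖z‖ₑ = ‖g t + (z - g t)‖ₑ := by rw [add_sub_cancel]
            _ ≤ _ := (enorm_add_le _ _).trans (add_le_add (hgF t ht) (hz t ht))
      _ = (1 + volume S) * ∫⁻ σ in S, F σ := by
          rw [lintegral_add_right _ measurable_const, setLIntegral_const]
          ring
  calc ‖z‖ₑ = (volume S)⁻¹ * (volume S * ‖z‖ₑ) := by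
        rw [← mul_assoc, ENNReal.inv_mul_cancel h0 h1, one_mul]
    _ ≤ (volume S)⁻¹ * ((1 + volume S) * ∫⁻ σ in S, F σ) := by gcongr
    _ = _ := by rw [← mul_assoc, mul_add, mul_one, ENNReal.inv_mul_cancel h0 h1]

variable {S T : Set ℝ} {F : ℝ → ℝ → ℝ≥0∞}

/-- The two-dimensional Gagliardo–Nirenberg argument: a function of two variables which is bounded
by a function of either variable alone has its `L²` norm bounded by the `L¹` norms of the bounds. -/
theorem lintegral_sq_le_of_le
    (hF : AEMeasurable (Function.uncurry F) ((volume.restrict S).prod (volume.restrict T)))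
    (hS : MeasurableSet S) (hT : MeasurableSet T) {C : ℝ≥0∞} {f : ℝ → ℝ → ℝ≥0∞}
    (h0 : ∀ s ∈ S, ∀ t ∈ T, f s t ≤ C * ∫⁻ σ in S, F σ t)
    (h1 : ∀ s ∈ S, ∀ t ∈ T, f s t ≤ C * ∫⁻ τ in T, F s τ) :
    ∫⁻ s in S, ∫⁻ t in T, f s t ^ 2 ≤ (C * ∫⁻ s in S, ∫⁻ t in T, F s t) ^ 2 := by
  have hA : AEMeasurable (fun t => ∫⁻ σ in S, F σ t) (volume.restrict T) :=
    hF.lintegral_prod_left'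
  have hB : AEMeasurable (fun s => ∫⁻ τ in T, F s τ) (volume.restrict S) :=
    hF.lintegral_prod_right'
  calc ∫⁻ s in S, ∫⁻ t in T, f s t ^ 2
      ≤ ∫⁻ s in S, ∫⁻ t in T, (C * ∫⁻ τ in T, F s τ) * (C * ∫⁻ σ in S, F σ t) := by
        refine setLIntegral_mono' hS fun s hs => setLIntegral_mono' hT fun t ht => ?_
        rw [sq]
        exact mul_le_mul' (h1 s hs t ht) (h0 s hs t ht)
    _ = (C * ∫⁻ s in S, ∫⁻ t in T, F s t) * (C * ∫⁻ t in T, ∫⁻ s in S, F s t) := by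
        simp_rw [lintegral_const_mul'' _ (hA.const_mul C)]
        rw [lintegral_mul_const'' _ (hB.const_mul C), lintegral_const_mul'' _ hA,
          lintegral_const_mul'' _ hB]
    _ = _ := by rw [← lintegral_lintegral_swap hF, sq]

/-- The Poincaré inequality on a rectangle, for the `L¹` norm of all differences of values. -/
theorem lintegral_enorm_sub_le
    (hF : AEMeasurable (Function.uncurry F) ((volume.restrict S).prod (volume.restrict T)))
    (hS : MeasurableSet S) (hT : MeasurableSet T) {f : ℝ → ℝ → ℝ}
    (h0 : ∀ s ∈ S, ∀ s' ∈ S, ∀ t ∈ T, ‖f s t - f s' t‖ₑ ≤ ∫⁻ σ in S, F σ t)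
    (h1 : ∀ s ∈ S, ∀ t ∈ T, ∀ t' ∈ T, ‖f s t - f s t'‖ₑ ≤ ∫⁻ τ in T, F s τ) :
    ∫⁻ s in S, ∫⁻ t in T, ∫⁻ s' in S, ∫⁻ t' in T, ‖f s t - f s' t'‖ₑ
      ≤ (volume S * volume S * volume T + volume S * volume T * volume T)
        * ∫⁻ s in S, ∫⁻ t in T, F s t := by
  have hA : AEMeasurable (fun t => ∫⁻ σ in S, F σ t) (volume.restrict T) :=
    hF.lintegral_prod_left'
  have hB : AEMeasurable (fun s => ∫⁻ τ in T, F s τ) (volume.restrict S) :=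
    hF.lintegral_prod_right'
  calc ∫⁻ s in S, ∫⁻ t in T, ∫⁻ s' in S, ∫⁻ t' in T, ‖f s t - f s' t'‖ₑ
      ≤ ∫⁻ _ in S, ∫⁻ t in T, ∫⁻ s' in S, ∫⁻ _ in T,
          ((∫⁻ σ in S, F σ t) + ∫⁻ τ in T, F s' τ) := by
        refine setLIntegral_mono' hS fun s hs => setLIntegral_mono' hT fun t ht =>
          setLIntegral_mono' hS fun s' hs' => setLIntegral_mono' hT fun t' ht' => ?_
        calc ‖f s t - f s' t'‖ₑ = ‖(f s t - f s' t) + (f s' t - f s' t')‖ₑ := by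
              rw [sub_add_sub_cancel]
          _ ≤ _ := (enorm_add_le _ _).trans
              (add_le_add (h0 s hs s' hs' t ht) (h1 s' hs' t ht t' ht'))
    _ = ∫⁻ _ in S, ∫⁻ t in T, ((∫⁻ σ in S, F σ t) * volume T * volume S
          + (∫⁻ s in S, ∫⁻ t in T, F s t) * volume T) := by
        refine lintegral_congr fun s => lintegral_congr fun t => ?_
        simp_rw [setLIntegral_const, add_mul]
        rw [lintegral_add_right' _ (hB.mul_const _), setLIntegral_const,
          lintegral_mul_const'' _ hB]
    _ = ((∫⁻ t in T, ∫⁻ s in S, F s t) * volume T * volume S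
          + (∫⁻ s in S, ∫⁻ t in T, F s t) * volume T * volume T) * volume S := by
        rw [setLIntegral_const, lintegral_add_right' _ aemeasurable_const, setLIntegral_const,
          lintegral_mul_const'' _ (hA.mul_const _), lintegral_mul_const'' _ hA]
    _ = _ := by
        rw [← lintegral_lintegral_swap hF]
        ring

end Plane

/-! ### Coordinate derivatives of functions on the surface -/

section CoordinateDerivative

variable {M : Type*} [TopologicalSpace M] [ChartedSpace (EuclideanHalfSpace 2) M]
  [IsManifold (𝓡∂ 2) ∞ M]
  [RiemannianBundle (fun x : M ↦ TangentSpace (𝓡∂ 2) x)]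
  [IsContMDiffRiemannianBundle (𝓡∂ 2) ∞ Plane (fun x : M ↦ TangentSpace (𝓡∂ 2) x)]

/-- The derivative of `u` along the `i`-th coordinate vector field of the chart centred at `c`. -/
def coordDeriv (u : M → ℝ) (c : M) (i : Fin 2) (x : M) : ℝ :=
  inner ℝ (grad u x) (coordField c i x)

theorem coordField_eq_mfderivWithin (c : M) (i : Fin 2) {x : M}
    (hx : x ∈ (chartAt (EuclideanHalfSpace 2) c).source) :
    coordField c i x = mfderivWithin 𝓘(ℝ, Plane) (𝓡∂ 2) (extChartAt (𝓡∂ 2) c).symm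
      (range (𝓡∂ 2)) (extChartAt (𝓡∂ 2) c x) (EuclideanSpace.single i 1) := by
  have hx' : x ∈ (trivializationAt Plane (TangentSpace (𝓡∂ 2)) c).baseSet := by simpa using hx
  have h := TangentBundle.symmL_trivializationAt (I := 𝓡∂ 2) hx
  rw [coordField, ← Trivialization.symmL_apply (R := ℝ) _ hx', h]
  rfl

/-- The coordinate derivatives of `u` are the partial derivatives of `u` in the chart. -/
theorem exists_hasFDerivWithinAt {u : M → ℝ} (hu : ContMDiff (𝓡∂ 2) 𝓘(ℝ, ℝ) ∞ u) (c : M)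
    {y : Plane} (hy : y ∈ (extChartAt (𝓡∂ 2) c).target) :
    ∃ L : Plane →L[ℝ] ℝ,
      HasFDerivWithinAt (fun z => u ((extChartAt (𝓡∂ 2) c).symm z)) L (range (𝓡∂ 2)) y ∧
      ∀ i, L (EuclideanSpace.single i 1) = coordDeriv u c i ((extChartAt (𝓡∂ 2) c).symm y) := by
  have h1 := (mdifferentiableWithinAt_extChartAt_symm hy).hasMFDerivWithinAt
  have h2 := ((hu.mdifferentiable (by simp)) ((extChartAt (𝓡∂ 2) c).symm y)).hasMFDerivAt
  have h3 := h2.comp_hasMFDerivWithinAt y h1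
  refine ⟨_, h3.hasFDerivWithinAt, fun i => ?_⟩
  have hx : (extChartAt (𝓡∂ 2) c).symm y ∈ (chartAt (EuclideanHalfSpace 2) c).source := by
    have := (extChartAt (𝓡∂ 2) c).map_target hy
    rwa [extChartAt_source] at this
  rw [coordDeriv, inner_grad_left, coordField_eq_mfderivWithin c i hx,
    (extChartAt (𝓡∂ 2) c).right_inv hy]
  rfl

theorem hasDerivAt_planePt_zero (s t : ℝ) :
    HasDerivAt (fun s => planePt s t) (EuclideanSpace.single 0 1) s := by
  have : (fun s => planePt s t) =
      fun s : ℝ => s • (EuclideanSpace.single 0 1 : Plane) + planePt 0 t := by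
    funext s
    ext i
    fin_cases i <;> simp [planePt]
  rw [this]
  simpa using ((hasDerivAt_id s).smul_const (EuclideanSpace.single 0 1 : Plane)).add_const
    (planePt 0 t)

theorem hasDerivAt_planePt_one (s t : ℝ) :
    HasDerivAt (fun t => planePt s t) (EuclideanSpace.single 1 1) t := by
  have : (fun t => planePt s t) =
      fun t : ℝ => t • (EuclideanSpace.single 1 1 : Plane) + planePt s 0 := by
    funext t
    ext i
    fin_cases i <;> simp [planePt]
  rw [this]
  simpa using ((hasDerivAt_id t).smul_const (EuclideanSpace.single 1 1 : Plane)).add_const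
    (planePt s 0)

theorem hasDerivAt_chartPt_zero {u : M → ℝ} (hu : ContMDiff (𝓡∂ 2) 𝓘(ℝ, ℝ) ∞ u) (c : M)
    {s t : ℝ} (hs : 0 < s) (hy : planePt s t ∈ (extChartAt (𝓡∂ 2) c).target) :
    HasDerivAt (fun s => u (chartPt c s t)) (coordDeriv u c 0 (chartPt c s t)) s := by
  obtain ⟨L, hL, hi⟩ := exists_hasFDerivWithinAt hu c hy
  rw [chartPt, ← hi 0]
  refine hL.comp_hasDerivAt s (hasDerivAt_planePt_zero s t) ?_
  filter_upwards [lt_mem_nhds hs] with σ hσ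
  exact planePt_mem_range hσ.le t

theorem hasDerivAt_chartPt_one {u : M → ℝ} (hu : ContMDiff (𝓡∂ 2) 𝓘(ℝ, ℝ) ∞ u) (c : M)
    {s t : ℝ} (hs : 0 ≤ s) (hy : planePt s t ∈ (extChartAt (𝓡∂ 2) c).target) :
    HasDerivAt (fun t => u (chartPt c s t)) (coordDeriv u c 1 (chartPt c s t)) t := by
  obtain ⟨L, hL, hi⟩ := exists_hasFDerivWithinAt hu c hy
  rw [chartPt, ← hi 1]
  exact hL.comp_hasDerivAt t (hasDerivAt_planePt_one s t)
    (.of_forall fun τ => planePt_mem_range hs τ)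

theorem continuous_norm_grad {u : M → ℝ} (hu : ContMDiff (𝓡∂ 2) 𝓘(ℝ, ℝ) ∞ u) :
    Continuous fun x => ‖grad u x‖ := by
  have h := (inner_grad_continuous hu hu).sqrt
  simp only [real_inner_self_eq_norm_sq, Real.sqrt_sq (norm_nonneg _)] at h
  exact h

theorem abs_coordDeriv_le (u : M → ℝ) (c : M) (i : Fin 2) (x : M) :
    |coordDeriv u c i x| ≤ ‖grad u x‖ * Real.sqrt (metricCoeff c i i x) := by
  rw [metricCoeff, real_inner_self_eq_norm_sq, Real.sqrt_sq (norm_nonneg _)]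
  exact abs_real_inner_le_norm _ _

end CoordinateDerivative

/-! ### Sobolev, trace and Poincaré inequalities on a box -/

section LocalEstimates

variable {M : Type*} [TopologicalSpace M] [ChartedSpace (EuclideanHalfSpace 2) M]
  [IsManifold (𝓡∂ 2) ∞ M]
  [RiemannianBundle (fun x : M ↦ TangentSpace (𝓡∂ 2) x)]
  [IsContMDiffRiemannianBundle (𝓡∂ 2) ∞ Plane (fun x : M ↦ TangentSpace (𝓡∂ 2) x)]
  [MeasurableSpace M] [BorelSpace M]

/-- A box on which the metric of the surface is comparable to the Euclidean metric of the chart,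
with constant `C`. -/
structure IsTameBox (c : M) (r C : ℝ) : Prop extends IsBox c r where
  one_le : 1 ≤ C
  area_le : ∀ x ∈ box c r, areaDensity c x ≤ C
  one_le_area : ∀ x ∈ box c r, 1 ≤ C * areaDensity c x
  metric_le : ∀ i, ∀ x ∈ box c r, Real.sqrt (metricCoeff c i i x) ≤ C

theorem exists_isTameBox (c : M) : ∃ r C, IsTameBox c r C := by
  have hs := (chartAt (EuclideanHalfSpace 2) c).open_source.mem_nhds (mem_chart_source _ c)
  have hd := (continuousOn_areaDensity c).continuousAt hs
  have hd0 := areaDensity_pos c (mem_chart_source _ c)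
  have hg := fun i => ((metricCoeff_contMDiffOn c i i).continuousOn.sqrt).continuousAt hs
  have h1 := hd.eventually_const_lt (half_lt_self hd0)
  have h2 := hd.eventually_lt_const (lt_add_one (areaDensity c c))
  have h3 := fun i => (hg i).eventually_lt_const (lt_add_one _)
  obtain ⟨r, hb, hsub⟩ := exists_isBox c (h1.and (h2.and ((h3 0).and (h3 1))))
  set C : ℝ := 1 + areaDensity c c + (areaDensity c c / 2)⁻¹ + Real.sqrt (metricCoeff c 0 0 c)
    + Real.sqrt (metricCoeff c 1 1 c) with hC
  have e1 : 0 < (areaDensity c c / 2)⁻¹ := by positivity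
  have e2 := Real.sqrt_nonneg (metricCoeff c 0 0 c)
  have e3 := Real.sqrt_nonneg (metricCoeff c 1 1 c)
  refine ⟨r, C, ⟨hb, by linarith, fun x hx => ?_, fun x hx => ?_, fun i x hx => ?_⟩⟩
  · linarith [(hsub hx).2.1]
  · have h4 := (hsub hx).1
    calc 1 = (areaDensity c c / 2)⁻¹ * (areaDensity c c / 2) := by
          rw [inv_mul_cancel₀ (by positivity)]
      _ ≤ C * areaDensity c x := by
          refine mul_le_mul ?_ h4.le (by positivity) ?_ <;> linarith
  · have h5 := (hsub hx).2.2
    fin_cases i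
    · have := h5.1
      simp only [Fin.zero_eta] at this ⊢
      linarith
    · have := h5.2
      simp only [Fin.mk_one] at this ⊢
      linarith

variable {c : M} {r C : ℝ}

theorem IsBox.planePt_mem_target (hb : IsBox c r) {s t : ℝ} (hs : s ∈ rangeZero c r)
    (ht : t ∈ rangeOne c r) : planePt s t ∈ (extChartAt (𝓡∂ 2) c).target :=
  hb.mem_target s t (mem_rangeZero.1 hs).1.le (mem_rangeZero.1 hs).2 (mem_rangeOne.1 ht)

theorem IsBox.chartPt_mem_box (hb : IsBox c r) {s t : ℝ} (hs : s ∈ rangeZero c r)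
    (ht : t ∈ rangeOne c r) : chartPt c s t ∈ box c r :=
  hb.chartPt_mem (mem_rangeZero.1 hs).1.le (mem_rangeZero.1 hs).2 (mem_rangeOne.1 ht)

theorem IsBox.continuousOn_chartPt (hb : IsBox c r) :
    ContinuousOn (fun z : ℝ × ℝ => chartPt c z.1 z.2) (rangeZero c r ×ˢ rangeOne c r) :=
  (RiemannianSurface.continuousOn_chartPt c).mono fun _ hz => hb.planePt_mem_target hz.1 hz.2

theorem IsBox.continuousOn_chartPt_zero (hb : IsBox c r) {t : ℝ} (ht : t ∈ rangeOne c r) :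
    ContinuousOn (fun s => chartPt c s t) (rangeZero c r) :=
  hb.continuousOn_chartPt.comp (f := fun s => (s, t)) (by fun_prop) fun _ hs => ⟨hs, ht⟩

theorem IsBox.continuousOn_chartPt_one (hb : IsBox c r) {s : ℝ} (hs : s ∈ rangeZero c r) :
    ContinuousOn (fun t => chartPt c s t) (rangeOne c r) :=
  hb.continuousOn_chartPt.comp (f := fun t => (s, t)) (by fun_prop) fun _ ht => ⟨hs, ht⟩

theorem IsBox.enorm_sub_zero_le (hb : IsBox c r) {u : M → ℝ}
    (hu : ContMDiff (𝓡∂ 2) 𝓘(ℝ, ℝ) ∞ u) {s s' t : ℝ} (hs : s ∈ rangeZero c r)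
    (hs' : s' ∈ rangeZero c r) (ht : t ∈ rangeOne c r) :
    ‖u (chartPt c s t) - u (chartPt c s' t)‖ₑ
      ≤ ∫⁻ σ in rangeZero c r, ‖coordDeriv u c 0 (chartPt c σ t)‖ₑ :=
  enorm_sub_le_lintegral_deriv (g := fun s => u (chartPt c s t))
    (fun _ hσ => hasDerivAt_chartPt_zero hu c (mem_rangeZero.1 hσ).1
      (hb.planePt_mem_target hσ ht))
    ((mfderiv_coordField_continuousOn hu c 0).comp (hb.continuousOn_chartPt_zero ht)
      fun _ hσ => (hb.chartPt_mem_box hσ ht).1) hs hs'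

theorem IsBox.enorm_sub_one_le (hb : IsBox c r) {u : M → ℝ}
    (hu : ContMDiff (𝓡∂ 2) 𝓘(ℝ, ℝ) ∞ u) {s t t' : ℝ} (hs : s ∈ rangeZero c r)
    (ht : t ∈ rangeOne c r) (ht' : t' ∈ rangeOne c r) :
    ‖u (chartPt c s t) - u (chartPt c s t')‖ₑ
      ≤ ∫⁻ τ in rangeOne c r, ‖coordDeriv u c 1 (chartPt c s τ)‖ₑ :=
  enorm_sub_le_lintegral_deriv (g := fun t => u (chartPt c s t))
    (fun _ hτ => hasDerivAt_chartPt_one hu c (mem_rangeZero.1 hs).1.le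
      (hb.planePt_mem_target hs hτ))
    ((mfderiv_coordField_continuousOn hu c 1).comp (hb.continuousOn_chartPt_one hs)
      fun _ hτ => (hb.chartPt_mem_box hs hτ).1) ht ht'

/-- The first-coordinate estimate with one of the points on the boundary. -/
theorem IsBox.enorm_sub_boundary_le (hb : IsBox c r) (hr : coord c 0 c < r) {u : M → ℝ}
    (hu : ContMDiff (𝓡∂ 2) 𝓘(ℝ, ℝ) ∞ u) {s t : ℝ} (hs : s ∈ rangeZero c r)
    (ht : t ∈ rangeOne c r) :
    ‖u (chartPt c 0 t) - u (chartPt c s t)‖ₑ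
      ≤ ∫⁻ σ in rangeZero c r, ‖coordDeriv u c 0 (chartPt c σ t)‖ₑ := by
  have hderiv : ∀ σ ∈ rangeZero c r, HasDerivAt (fun s => u (chartPt c s t))
      (coordDeriv u c 0 (chartPt c σ t)) σ := fun σ hσ =>
    hasDerivAt_chartPt_zero hu c (mem_rangeZero.1 hσ).1 (hb.planePt_mem_target hσ ht)
  have hcont : ContinuousOn (fun σ => coordDeriv u c 0 (chartPt c σ t)) (rangeZero c r) :=
    (mfderiv_coordField_continuousOn hu c 0).comp (hb.continuousOn_chartPt_zero ht)
      fun _ hσ => (hb.chartPt_mem_box hσ ht).1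
  have hc0 : ContinuousWithinAt (fun s => u (chartPt c s t)) (rangeZero c r) 0 := by
    have h1 : ContinuousOn (fun s => chartPt c s t)
        {s | planePt s t ∈ (extChartAt (𝓡∂ 2) c).target} :=
      (RiemannianSurface.continuousOn_chartPt c).comp (f := fun s => (s, t)) (by fun_prop)
        fun _ hs => hs
    have h0 : |0 - coord c 0 c| < r := by
      rwa [zero_sub, abs_neg, abs_of_nonneg (coord_nonneg c (mem_chart_source _ c))]
    have h2 := h1 0 (hb.mem_target 0 t le_rfl h0 (mem_rangeOne.1 ht))
    exact (hu.continuous.continuousAt.comp_continuousWithinAt h2).mono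
      fun σ hσ => hb.planePt_mem_target hσ ht
  have hle : max 0 (coord c 0 c - r) = 0 := max_eq_left (by linarith)
  simp only [rangeZero, hle] at hderiv hcont hc0 hs ⊢
  exact enorm_sub_left_le_lintegral_deriv (g := fun s => u (chartPt c s t)) hderiv hcont hc0 hs

theorem IsTameBox.enorm_coordDeriv_le (hb : IsTameBox c r C) (u : M → ℝ) (i : Fin 2) {x : M}
    (hx : x ∈ box c r) : ‖coordDeriv u c i x‖ₑ ≤ ENNReal.ofReal (C * ‖grad u x‖) := by
  rw [← ofReal_norm, Real.norm_eq_abs]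
  refine ENNReal.ofReal_le_ofReal ((abs_coordDeriv_le u c i x).trans ?_)
  rw [mul_comm]
  exact mul_le_mul_of_nonneg_right (hb.metric_le i x hx) (norm_nonneg _)

theorem volume_rangeZero_ne_top : volume (rangeZero c r) ≠ ⊤ := by simp [rangeZero]

theorem volume_rangeOne_ne_top : volume (rangeOne c r) ≠ ⊤ := by simp [rangeOne]

theorem IsTameBox.lintegral_coord_le (hb : IsTameBox c r C) {G : M → ℝ≥0∞} (hG : Measurable G) :
    ∫⁻ s in rangeZero c r, ∫⁻ t in rangeOne c r, G (chartPt c s t)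
      ≤ ENNReal.ofReal C * ∫⁻ x in box c r, G x ∂(area M) := by
  rw [setLIntegral_area_box hb.toIsBox hG, ← lintegral_const_mul' _ _ ENNReal.ofReal_ne_top]
  simp_rw [← lintegral_const_mul' _ _ ENNReal.ofReal_ne_top]
  refine setLIntegral_mono' measurableSet_Ioo fun s hs =>
    setLIntegral_mono' measurableSet_Ioo fun t ht => ?_
  calc G (chartPt c s t) = ENNReal.ofReal 1 * G (chartPt c s t) := by simp
    _ ≤ ENNReal.ofReal (C * areaDensity c (chartPt c s t)) * G (chartPt c s t) := by
        gcongr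
        exact hb.one_le_area _ (hb.chartPt_mem_box hs ht)
    _ = _ := by
        rw [ENNReal.ofReal_mul (zero_le_one.trans hb.one_le)]
        ring

theorem IsTameBox.lintegral_area_le (hb : IsTameBox c r C) {G : M → ℝ≥0∞} (hG : Measurable G) :
    ∫⁻ x in box c r, G x ∂(area M) ≤
      ENNReal.ofReal C * ∫⁻ s in rangeZero c r, ∫⁻ t in rangeOne c r, G (chartPt c s t) := by
  rw [setLIntegral_area_box hb.toIsBox hG, ← lintegral_const_mul' _ _ ENNReal.ofReal_ne_top]
  simp_rw [← lintegral_const_mul' _ _ ENNReal.ofReal_ne_top]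
  refine setLIntegral_mono' measurableSet_Ioo fun s hs =>
    setLIntegral_mono' measurableSet_Ioo fun t ht => ?_
  rw [mul_comm]
  gcongr
  exact hb.area_le _ (hb.chartPt_mem_box hs ht)

/-- The integrand `|u| + |∇u|` of the norm of `W^{1,1}`. -/
def firstOrder (u : M → ℝ) (x : M) : ℝ≥0∞ := ENNReal.ofReal (|u x| + ‖grad u x‖)

theorem measurable_firstOrder {u : M → ℝ} (hu : ContMDiff (𝓡∂ 2) 𝓘(ℝ, ℝ) ∞ u) :
    Measurable (firstOrder u) :=
  (hu.continuous.abs.add (continuous_norm_grad hu)).measurable.ennreal_ofReal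

theorem measurable_ofReal_norm_grad {u : M → ℝ} (hu : ContMDiff (𝓡∂ 2) 𝓘(ℝ, ℝ) ∞ u) :
    Measurable fun x => ENNReal.ofReal ‖grad u x‖ :=
  (continuous_norm_grad hu).measurable.ennreal_ofReal

theorem IsTameBox.enorm_le (hb : IsTameBox c r C) (u : M → ℝ) (x : M) :
    ‖u x‖ₑ ≤ ENNReal.ofReal C * firstOrder u x := by
  rw [← ofReal_norm, Real.norm_eq_abs, firstOrder,
    ← ENNReal.ofReal_mul (zero_le_one.trans hb.one_le)]
  refine ENNReal.ofReal_le_ofReal ?_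
  have h1 := hb.one_le
  nlinarith [abs_nonneg (u x), norm_nonneg (grad u x)]

theorem IsTameBox.enorm_coordDeriv_le_firstOrder (hb : IsTameBox c r C) (u : M → ℝ) (i : Fin 2)
    {x : M} (hx : x ∈ box c r) : ‖coordDeriv u c i x‖ₑ ≤ ENNReal.ofReal C * firstOrder u x := by
  refine (hb.enorm_coordDeriv_le u i hx).trans ?_
  rw [firstOrder, ← ENNReal.ofReal_mul (zero_le_one.trans hb.one_le)]
  refine ENNReal.ofReal_le_ofReal ?_
  have h1 := hb.one_le
  nlinarith [abs_nonneg (u x), norm_nonneg (grad u x)]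

theorem IsBox.aemeasurable_chartPt (hb : IsBox c r) {G : M → ℝ≥0∞} (hG : Measurable G) :
    AEMeasurable (Function.uncurry fun s t => G (chartPt c s t))
      ((volume.restrict (rangeZero c r)).prod (volume.restrict (rangeOne c r))) := by
  rw [Measure.prod_restrict]
  exact hG.comp_aemeasurable (hb.continuousOn_chartPt.aemeasurable
    (measurableSet_Ioo.prod measurableSet_Ioo))

/-- The Sobolev inequality `‖u‖_{L²} ≤ K ‖u‖_{W^{1,1}}` on a box. -/
theorem IsTameBox.exists_sobolev (hb : IsTameBox c r C) : ∃ K : ℝ≥0∞, K ≠ ⊤ ∧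
    ∀ u : M → ℝ, ContMDiff (𝓡∂ 2) 𝓘(ℝ, ℝ) ∞ u →
      ∫⁻ x in box c r, ‖u x‖ₑ ^ 2 ∂(area M)
        ≤ K * (∫⁻ x in box c r, firstOrder u x ∂(area M)) ^ 2 := by
  set A : ℝ≥0∞ := (volume (rangeZero c r))⁻¹ + 1 + (volume (rangeOne c r))⁻¹ with hA
  have hz := volume_rangeZero_pos (c := c) hb.pos
  have ho := volume_rangeOne_pos (c := c) hb.pos
  have hAtop : A ≠ ⊤ := by simp [hA, hz.ne', ho.ne']
  set k := ENNReal.ofReal C with hk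
  have hktop : k ≠ ⊤ := ENNReal.ofReal_ne_top
  refine ⟨k * (A * (k * k)) ^ 2, by finiteness, fun u hu => ?_⟩
  have hm := measurable_firstOrder hu
  have key := lintegral_sq_le_of_le (S := rangeZero c r) (T := rangeOne c r)
    (F := fun s t => k * firstOrder u (chartPt c s t)) (C := A)
    (f := fun s t => ‖u (chartPt c s t)‖ₑ)
    ((hb.aemeasurable_chartPt (hm.const_mul k))) measurableSet_Ioo measurableSet_Ioo
    (fun s hs t ht => ?_) (fun s hs t ht => ?_)
  · calc ∫⁻ x in box c r, ‖u x‖ₑ ^ 2 ∂(area M)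
        ≤ k * ∫⁻ s in rangeZero c r, ∫⁻ t in rangeOne c r, ‖u (chartPt c s t)‖ₑ ^ 2 :=
          hb.lintegral_area_le (G := fun x => ‖u x‖ₑ ^ 2)
            (hu.continuous.measurable.enorm.pow_const 2)
      _ ≤ k * (A * (k * (k * ∫⁻ x in box c r, firstOrder u x ∂(area M)))) ^ 2 := by
          refine mul_le_mul_right (key.trans ?_) _
          gcongr
          simp_rw [lintegral_const_mul' _ _ hktop]
          exact mul_le_mul_right (hb.lintegral_coord_le hm) _
      _ = _ := by ring
  · refine (enorm_le_of_enorm_sub_le measurableSet_Ioo hz.ne' volume_rangeZero_ne_top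
      (g := fun s => u (chartPt c s t)) (F := fun s => k * firstOrder u (chartPt c s t))
      (fun σ _ => hb.enorm_le u _) (fun σ hσ => ?_)).trans
      (mul_le_mul_left (le_self_add) _)
    exact (hb.enorm_sub_zero_le hu hs hσ ht).trans (setLIntegral_mono' measurableSet_Ioo
      fun _ h => hb.enorm_coordDeriv_le_firstOrder u 0 (hb.chartPt_mem_box h ht))
  · refine (enorm_le_of_enorm_sub_le measurableSet_Ioo ho.ne' volume_rangeOne_ne_top
      (g := fun t => u (chartPt c s t)) (F := fun t => k * firstOrder u (chartPt c s t))
      (fun σ _ => hb.enorm_le u _) (fun σ hσ => ?_)).trans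
      (mul_le_mul_left ?_ _)
    · exact (hb.enorm_sub_one_le hu hs ht hσ).trans (setLIntegral_mono' measurableSet_Ioo
        fun _ h => hb.enorm_coordDeriv_le_firstOrder u 1 (hb.chartPt_mem_box hs h))
    · rw [hA, add_assoc, add_comm 1]
      exact le_add_self

/-- The trace inequality `‖u‖_{L¹(∂)} ≤ K ‖u‖_{W^{1,1}}` on a box. -/
theorem IsTameBox.exists_trace (hb : IsTameBox c r C) : ∃ K : ℝ≥0∞, K ≠ ⊤ ∧
    ∀ u : M → ℝ, ContMDiff (𝓡∂ 2) 𝓘(ℝ, ℝ) ∞ u →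
      ∫⁻ x in box c r, ‖u x‖ₑ ∂(boundaryLength M)
        ≤ K * ∫⁻ x in box c r, firstOrder u x ∂(area M) := by
  have hz := volume_rangeZero_pos (c := c) hb.pos
  set A : ℝ≥0∞ := (volume (rangeZero c r))⁻¹ + 1 with hA
  have hAtop : A ≠ ⊤ := by simp [hA, hz.ne']
  set k := ENNReal.ofReal C with hk
  have hktop : k ≠ ⊤ := ENNReal.ofReal_ne_top
  refine ⟨k * A * (k * k), by finiteness, fun u hu => ?_⟩
  have hm := measurable_firstOrder hu
  rw [setLIntegral_boundaryLength_box hb.toIsBox (hu.continuous.measurable.enorm)]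
  split_ifs with hr
  · calc ∫⁻ t in rangeOne c r, ‖u (chartPt c 0 t)‖ₑ *
          ENNReal.ofReal (lengthDensity c (chartPt c 0 t))
        ≤ ∫⁻ t in rangeOne c r, A * (∫⁻ s in rangeZero c r,
            k * firstOrder u (chartPt c s t)) * k := by
          refine setLIntegral_mono' measurableSet_Ioo fun t ht => mul_le_mul' ?_ ?_
          · refine enorm_le_of_enorm_sub_le measurableSet_Ioo hz.ne' volume_rangeZero_ne_top
              (g := fun s => u (chartPt c s t)) (fun σ _ => hb.enorm_le u _) (fun σ hσ => ?_)
            exact (hb.enorm_sub_boundary_le hr hu hσ ht).trans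
              (setLIntegral_mono' measurableSet_Ioo
              fun _ h => hb.enorm_coordDeriv_le_firstOrder u 0 (hb.chartPt_mem_box h ht))
          · have h0 : |0 - coord c 0 c| < r := by
              rwa [zero_sub, abs_neg, abs_of_nonneg (coord_nonneg c (mem_chart_source _ c))]
            exact ENNReal.ofReal_le_ofReal (hb.metric_le 1 _
              (hb.chartPt_mem le_rfl h0 (mem_rangeOne.1 ht)))
      _ = k * A * (k * ∫⁻ s in rangeZero c r, ∫⁻ t in rangeOne c r,
            firstOrder u (chartPt c s t)) := by
          rw [lintegral_lintegral_swap (hb.aemeasurable_chartPt hm)]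
          simp_rw [lintegral_const_mul' _ _ hktop]
          rw [lintegral_mul_const' _ _ hktop, lintegral_const_mul' _ _ hAtop,
            lintegral_const_mul' _ _ hktop]
          ring
      _ ≤ k * A * (k * (k * ∫⁻ x in box c r, firstOrder u x ∂(area M))) := by
          gcongr
          exact hb.lintegral_coord_le hm
      _ = _ := by ring
  · exact zero_le

theorem measurable_lintegral_enorm_sub {ν : Measure M} [SFinite ν] {u : M → ℝ}
    (hu : Measurable u) : Measurable fun x => ∫⁻ y, ‖u x - u y‖ₑ ∂ν :=
  Measurable.lintegral_prod_right' (f := fun z : M × M => ‖u z.1 - u z.2‖ₑ)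
    ((hu.comp measurable_fst).sub (hu.comp measurable_snd)).enorm

variable [CompactSpace M]

/-- The `L¹` Poincaré inequality on a box. -/
theorem IsTameBox.exists_poincare (hb : IsTameBox c r C) : ∃ K : ℝ≥0∞, K ≠ ⊤ ∧
    ∀ u : M → ℝ, ContMDiff (𝓡∂ 2) 𝓘(ℝ, ℝ) ∞ u →
      ∫⁻ x in box c r, ∫⁻ y in box c r, ‖u x - u y‖ₑ ∂(area M) ∂(area M)
        ≤ K * ∫⁻ x in box c r, ENNReal.ofReal ‖grad u x‖ ∂(area M) := by
  set k := ENNReal.ofReal C with hk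
  have hktop : k ≠ ⊤ := ENNReal.ofReal_ne_top
  set S := rangeZero c r
  set T := rangeOne c r
  have hz : volume S ≠ ⊤ := volume_rangeZero_ne_top
  have ho : volume T ≠ ⊤ := volume_rangeOne_ne_top
  refine ⟨k * (k * ((volume S * volume S * volume T + volume S * volume T * volume T)
    * (k * k))), by finiteness, fun u hu => ?_⟩
  have hm := measurable_ofReal_norm_grad hu
  have hle : ∀ i, ∀ x ∈ box c r, ‖coordDeriv u c i x‖ₑ ≤ k * ENNReal.ofReal ‖grad u x‖ :=
    fun i x hx => by
      rw [← ENNReal.ofReal_mul (zero_le_one.trans hb.one_le)]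
      exact hb.enorm_coordDeriv_le u i hx
  have key := lintegral_enorm_sub_le (S := S) (T := T)
    (F := fun s t => k * ENNReal.ofReal ‖grad u (chartPt c s t)‖)
    (f := fun s t => u (chartPt c s t))
    (hb.aemeasurable_chartPt (hm.const_mul k)) measurableSet_Ioo measurableSet_Ioo
    (fun s hs s' hs' t ht => (hb.enorm_sub_zero_le hu hs hs' ht).trans
      (setLIntegral_mono' measurableSet_Ioo fun _ h => hle 0 _ (hb.chartPt_mem_box h ht)))
    (fun s hs t ht t' ht' => (hb.enorm_sub_one_le hu hs ht ht').trans
      (setLIntegral_mono' measurableSet_Ioo fun _ h => hle 1 _ (hb.chartPt_mem_box hs h)))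
  have hum := hu.continuous.measurable
  have hm2 : Measurable fun x => ∫⁻ y in box c r, ‖u x - u y‖ₑ ∂(area M) :=
    measurable_lintegral_enorm_sub hum
  calc ∫⁻ x in box c r, ∫⁻ y in box c r, ‖u x - u y‖ₑ ∂(area M) ∂(area M)
      ≤ k * ∫⁻ s in S, ∫⁻ t in T, ∫⁻ y in box c r, ‖u (chartPt c s t) - u y‖ₑ ∂(area M) :=
        hb.lintegral_area_le hm2
    _ ≤ k * ∫⁻ s in S, ∫⁻ t in T, k * ∫⁻ s' in S, ∫⁻ t' in T,
          ‖u (chartPt c s t) - u (chartPt c s' t')‖ₑ := by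
        refine mul_le_mul_right (lintegral_mono fun s => lintegral_mono fun t => ?_) _
        exact hb.lintegral_area_le (hum.const_sub _).enorm
    _ ≤ k * (k * ((volume S * volume S * volume T + volume S * volume T * volume T)
        * (k * (k * ∫⁻ x in box c r, ENNReal.ofReal ‖grad u x‖ ∂(area M))))) := by
        simp_rw [lintegral_const_mul' _ _ hktop]
        refine mul_le_mul_right (mul_le_mul_right (key.trans (mul_le_mul_right ?_ _)) _) _
        simp_rw [lintegral_const_mul' _ _ hktop]
        exact mul_le_mul_right (hb.lintegral_coord_le hm) _
    _ = _ := by ring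

end LocalEstimates

/-! ### Sobolev, trace and Poincaré inequalities on the surface -/

section GlobalEstimates

variable {M : Type*} [TopologicalSpace M] [ChartedSpace (EuclideanHalfSpace 2) M]
  [IsManifold (𝓡∂ 2) ∞ M]
  [RiemannianBundle (fun x : M ↦ TangentSpace (𝓡∂ 2) x)]
  [IsContMDiffRiemannianBundle (𝓡∂ 2) ∞ Plane (fun x : M ↦ TangentSpace (𝓡∂ 2) x)]
  [MeasurableSpace M] [BorelSpace M] [CompactSpace M]

theorem lintegral_enorm_of_continuous {μ : Measure M} [IsFiniteMeasure μ] {f : M → ℝ}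
    (hf : Continuous f) : ∫⁻ x, ‖f x‖ₑ ∂μ = ENNReal.ofReal (∫ x, |f x| ∂μ) := by
  rw [ofReal_integral_eq_lintegral_ofReal]
  · simp_rw [← ofReal_norm, Real.norm_eq_abs]
  · exact hf.abs.integrable_of_hasCompactSupport (HasCompactSupport.of_compactSpace _)
  · exact .of_forall fun _ => abs_nonneg _

theorem integrable_of_continuous {μ : Measure M} [IsFiniteMeasure μ] {f : M → ℝ}
    (hf : Continuous f) : Integrable f μ :=
  hf.integrable_of_hasCompactSupport (HasCompactSupport.of_compactSpace _)

theorem continuous_firstOrder {u : M → ℝ} (hu : ContMDiff (𝓡∂ 2) 𝓘(ℝ, ℝ) ∞ u) :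
    Continuous fun x => |u x| + ‖grad u x‖ :=
  hu.continuous.abs.add (continuous_norm_grad hu)

theorem lintegral_firstOrder {u : M → ℝ} (hu : ContMDiff (𝓡∂ 2) 𝓘(ℝ, ℝ) ∞ u) :
    ∫⁻ x, firstOrder u x ∂(area M) = ENNReal.ofReal (∫ x, (|u x| + ‖grad u x‖) ∂(area M)) :=
  (ofReal_integral_eq_lintegral_ofReal (integrable_of_continuous (continuous_firstOrder hu))
    (.of_forall fun _ => add_nonneg (abs_nonneg _) (norm_nonneg _))).symm

variable (M) in
/-- The Sobolev inequality `‖u‖_{L²} ≤ K ‖u‖_{W^{1,1}}`. -/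
theorem exists_sobolev : ∃ K : ℝ, 0 ≤ K ∧ ∀ u : M → ℝ, ContMDiff (𝓡∂ 2) 𝓘(ℝ, ℝ) ∞ u →
    ∫ x, u x ^ 2 ∂(area M) ≤ K * (∫ x, (|u x| + ‖grad u x‖) ∂(area M)) ^ 2 := by
  have h : ∃ K : ℝ≥0∞, K ≠ ⊤ ∧ ∀ u : M → ℝ, ContMDiff (𝓡∂ 2) 𝓘(ℝ, ℝ) ∞ u →
      ∫⁻ x in univ, ‖u x‖ₑ ^ 2 ∂(area M) ≤ K * (∫⁻ x, firstOrder u x ∂(area M)) ^ 2 := by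
    refine isCompact_univ.induction_on (p := fun s => ∃ K : ℝ≥0∞, K ≠ ⊤ ∧ ∀ u : M → ℝ,
      ContMDiff (𝓡∂ 2) 𝓘(ℝ, ℝ) ∞ u →
      ∫⁻ x in s, ‖u x‖ₑ ^ 2 ∂(area M) ≤ K * (∫⁻ x, firstOrder u x ∂(area M)) ^ 2)
      ⟨0, by simp, by simp⟩ ?_ ?_ ?_
    · rintro s t hst ⟨K, hK, h⟩
      exact ⟨K, hK, fun u hu => (lintegral_mono_set hst).trans (h u hu)⟩
    · rintro s t ⟨K, hK, h⟩ ⟨L, hL, h'⟩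
      refine ⟨K + L, by finiteness, fun u hu => (lintegral_union_le _ _ _).trans ?_⟩
      rw [add_mul]
      exact add_le_add (h u hu) (h' u hu)
    · intro c _
      obtain ⟨r, C, hb⟩ := exists_isTameBox c
      obtain ⟨K, hK, h⟩ := hb.exists_sobolev
      refine ⟨box c r, mem_nhdsWithin_of_mem_nhds
        ((isOpen_box c r).mem_nhds (mem_box_self c hb.pos)), K, hK, fun u hu => ?_⟩
      refine (h u hu).trans ?_
      gcongr
      exact Measure.restrict_le_self
  obtain ⟨K, hK, h⟩ := h
  refine ⟨K.toReal, ENNReal.toReal_nonneg, fun u hu => ?_⟩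
  have h1 := h u hu
  have hn : 0 ≤ ∫ x, (|u x| + ‖grad u x‖) ∂(area M) :=
    integral_nonneg fun _ => add_nonneg (abs_nonneg _) (norm_nonneg _)
  have h2 : ∫⁻ x, ‖u x‖ₑ ^ 2 ∂(area M) = ENNReal.ofReal (∫ x, u x ^ 2 ∂(area M)) := by
    rw [ofReal_integral_eq_lintegral_ofReal (f := fun x => u x ^ 2)
      (integrable_of_continuous (hu.continuous.pow 2))
      (.of_forall fun _ => sq_nonneg _)]
    refine lintegral_congr fun x => ?_
    rw [← ofReal_norm, ← ENNReal.ofReal_pow (norm_nonneg _), Real.norm_eq_abs, sq_abs]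
  rw [Measure.restrict_univ, h2, lintegral_firstOrder hu, ← ENNReal.ofReal_toReal hK,
    ← ENNReal.ofReal_pow hn, ← ENNReal.ofReal_mul ENNReal.toReal_nonneg,
    ENNReal.ofReal_le_ofReal_iff (by positivity)] at h1
  exact h1

variable (M) in
/-- The trace inequality `‖u‖_{L¹(∂)} ≤ K ‖u‖_{W^{1,1}}`. -/
theorem exists_trace_le : ∃ K : ℝ, 0 ≤ K ∧ ∀ u : M → ℝ, ContMDiff (𝓡∂ 2) 𝓘(ℝ, ℝ) ∞ u →
    ∫ x, |u x| ∂(boundaryLength M) ≤ K * ∫ x, (|u x| + ‖grad u x‖) ∂(area M) := by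
  have h : ∃ K : ℝ≥0∞, K ≠ ⊤ ∧ ∀ u : M → ℝ, ContMDiff (𝓡∂ 2) 𝓘(ℝ, ℝ) ∞ u →
      ∫⁻ x in univ, ‖u x‖ₑ ∂(boundaryLength M) ≤ K * ∫⁻ x, firstOrder u x ∂(area M) := by
    refine isCompact_univ.induction_on (p := fun s => ∃ K : ℝ≥0∞, K ≠ ⊤ ∧ ∀ u : M → ℝ,
      ContMDiff (𝓡∂ 2) 𝓘(ℝ, ℝ) ∞ u →
      ∫⁻ x in s, ‖u x‖ₑ ∂(boundaryLength M) ≤ K * ∫⁻ x, firstOrder u x ∂(area M))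
      ⟨0, by simp, by simp⟩ ?_ ?_ ?_
    · rintro s t hst ⟨K, hK, h⟩
      exact ⟨K, hK, fun u hu => (lintegral_mono_set hst).trans (h u hu)⟩
    · rintro s t ⟨K, hK, h⟩ ⟨L, hL, h'⟩
      refine ⟨K + L, by finiteness, fun u hu => (lintegral_union_le _ _ _).trans ?_⟩
      rw [add_mul]
      exact add_le_add (h u hu) (h' u hu)
    · intro c _
      obtain ⟨r, C, hb⟩ := exists_isTameBox c
      obtain ⟨K, hK, h⟩ := hb.exists_trace
      refine ⟨box c r, mem_nhdsWithin_of_mem_nhds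
        ((isOpen_box c r).mem_nhds (mem_box_self c hb.pos)), K, hK, fun u hu => ?_⟩
      refine (h u hu).trans ?_
      gcongr
      exact Measure.restrict_le_self
  obtain ⟨K, hK, h⟩ := h
  refine ⟨K.toReal, ENNReal.toReal_nonneg, fun u hu => ?_⟩
  have h1 := h u hu
  have hn : 0 ≤ ∫ x, (|u x| + ‖grad u x‖) ∂(area M) :=
    integral_nonneg fun _ => add_nonneg (abs_nonneg _) (norm_nonneg _)
  rw [Measure.restrict_univ, lintegral_enorm_of_continuous hu.continuous, lintegral_firstOrder hu,
    ← ENNReal.ofReal_toReal hK, ← ENNReal.ofReal_mul ENNReal.toReal_nonneg,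
    ENNReal.ofReal_le_ofReal_iff (by positivity)] at h1
  exact h1

/-- The integral of `|u x - u y|` over `x ∈ A` and `y ∈ B`. -/
def crossDiff (u : M → ℝ) (A B : Set M) : ℝ≥0∞ :=
  ∫⁻ x in A, ∫⁻ y in B, ‖u x - u y‖ₑ ∂(area M) ∂(area M)

theorem crossDiff_comm {u : M → ℝ} (hu : Measurable u) (A B : Set M) :
    crossDiff u A B = crossDiff u B A := by
  rw [crossDiff, lintegral_lintegral_swap]
  · simp_rw [crossDiff, enorm_sub_rev]
  · exact ((hu.comp measurable_fst).sub (hu.comp measurable_snd)).enorm.aemeasurable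

theorem crossDiff_mono (u : M → ℝ) {A A' B B' : Set M} (hA : A ⊆ A') (hB : B ⊆ B') :
    crossDiff u A B ≤ crossDiff u A' B' :=
  (lintegral_mono fun _ => lintegral_mono_set hB).trans (lintegral_mono_set hA)

theorem crossDiff_union_left_le (u : M → ℝ) (A A' B : Set M) :
    crossDiff u (A ∪ A') B ≤ crossDiff u A B + crossDiff u A' B :=
  lintegral_union_le _ _ _

/-- The triangle inequality for `crossDiff`. -/
theorem crossDiff_mul_area_le {u : M → ℝ} (hu : Measurable u) (A B C : Set M) :
    crossDiff u A C * area M B ≤ crossDiff u A B * area M C + area M A * crossDiff u B C := by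
  have hfin : ∀ D : Set M, area M D ≠ ⊤ := fun D => measure_ne_top _ _
  calc crossDiff u A C * area M B
      = ∫⁻ x in A, ∫⁻ y in C, ∫⁻ _ in B, ‖u x - u y‖ₑ ∂(area M) ∂(area M) ∂(area M) := by
        simp_rw [setLIntegral_const, lintegral_mul_const' _ _ (hfin B)]
        rfl
    _ ≤ ∫⁻ x in A, ∫⁻ y in C, ((∫⁻ z in B, ‖u x - u z‖ₑ ∂(area M))
          + ∫⁻ z in B, ‖u y - u z‖ₑ ∂(area M)) ∂(area M) ∂(area M) := by
        refine lintegral_mono fun x => lintegral_mono fun y => ?_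
        rw [← lintegral_add_left (hu.const_sub _).enorm]
        refine lintegral_mono fun z => ?_
        calc ‖u x - u y‖ₑ = ‖(u x - u z) - (u y - u z)‖ₑ := by rw [sub_sub_sub_cancel_right]
          _ ≤ _ := enorm_sub_le
    _ = crossDiff u A B * area M C + area M A * crossDiff u C B := by
        simp_rw [lintegral_add_left measurable_const, setLIntegral_const]
        rw [lintegral_add_right _ measurable_const, lintegral_mul_const' _ _ (hfin C),
          setLIntegral_const, mul_comm (area M A)]
        rfl
    _ = _ := by rw [crossDiff_comm hu C B]

/-- The `L¹` norm of the gradient. -/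
def gradL1 (u : M → ℝ) : ℝ≥0∞ := ∫⁻ x, ENNReal.ofReal ‖grad u x‖ ∂(area M)

/-- The integral of `|u x - u y|` over `x ∈ A` and `y ∈ B` is bounded by the `L¹` norm of the
gradient on the whole surface, with a constant which does not depend on the smooth function `u`. -/
def PoincarePair (A B : Set M) : Prop :=
  ∃ K : ℝ≥0∞, K ≠ ⊤ ∧ ∀ u : M → ℝ, ContMDiff (𝓡∂ 2) 𝓘(ℝ, ℝ) ∞ u →
    crossDiff u A B ≤ K * gradL1 u

theorem PoincarePair.symm {A B : Set M} (h : PoincarePair A B) : PoincarePair B A := by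
  obtain ⟨K, hK, h⟩ := h
  exact ⟨K, hK, fun u hu => (crossDiff_comm hu.continuous.measurable B A).trans_le (h u hu)⟩

theorem PoincarePair.mono {A A' B B' : Set M} (h : PoincarePair A' B') (hA : A ⊆ A')
    (hB : B ⊆ B') : PoincarePair A B := by
  obtain ⟨K, hK, h⟩ := h
  exact ⟨K, hK, fun u hu => (crossDiff_mono u hA hB).trans (h u hu)⟩

theorem PoincarePair.trans {A B C : Set M} (h : PoincarePair A B) (h' : PoincarePair B C)
    (hB : area M B ≠ 0) : PoincarePair A C := by
  obtain ⟨K, hK, h⟩ := h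
  obtain ⟨L, hL, h'⟩ := h'
  have hfin : ∀ D : Set M, area M D ≠ ⊤ := fun D => measure_ne_top _ _
  refine ⟨(K * area M C + area M A * L) * (area M B)⁻¹, ?_, fun u hu => ?_⟩
  · have := hfin A
    have := hfin C
    have := ENNReal.inv_ne_top.2 hB
    finiteness
  have h1 := crossDiff_mul_area_le hu.continuous.measurable A B C
  calc crossDiff u A C = crossDiff u A C * area M B * (area M B)⁻¹ := by
        rw [mul_assoc, ENNReal.mul_inv_cancel hB (hfin B), mul_one]
    _ ≤ (K * gradL1 u * area M C + area M A * (L * gradL1 u)) * (area M B)⁻¹ := by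
        refine mul_le_mul_left (h1.trans ?_) _
        gcongr
        · exact h u hu
        · exact h' u hu
    _ = _ := by ring

theorem PoincarePair.union_left {A A' B : Set M} (h : PoincarePair A B)
    (h' : PoincarePair A' B) : PoincarePair (A ∪ A') B := by
  obtain ⟨K, hK, h⟩ := h
  obtain ⟨L, hL, h'⟩ := h'
  refine ⟨K + L, by finiteness, fun u hu => (crossDiff_union_left_le u A A' B).trans ?_⟩
  rw [add_mul]
  exact add_le_add (h u hu) (h' u hu)

theorem PoincarePair.univ_left {B : Set M} {U : M → Set M} (hU : ∀ c, U c ∈ 𝓝 c)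
    (h : ∀ c, PoincarePair (U c) B) : PoincarePair univ B := by
  refine isCompact_univ.induction_on (p := fun s => PoincarePair s B)
    ⟨0, by simp, by simp [crossDiff]⟩ (fun s t hst ht => ht.mono hst subset_rfl)
    (fun s t hs ht => hs.union_left ht) fun c _ =>
    ⟨U c, mem_nhdsWithin_of_mem_nhds (hU c), h c⟩

variable (M) in
/-- Local Poincaré inequalities on overlapping boxes chain up, as the surface is connected. -/
theorem poincarePair_univ [ConnectedSpace M] : PoincarePair (univ : Set M) univ := by
  choose r C hb using fun c : M => exists_isTameBox c
  have hself : ∀ c, PoincarePair (box c (r c)) (box c (r c)) := fun c => by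
    obtain ⟨K, hK, h⟩ := (hb c).exists_poincare
    refine ⟨K, hK, fun u hu => (h u hu).trans ?_⟩
    rw [gradL1]
    gcongr
    exact Measure.restrict_le_self
  have hpos : ∀ U : Set M, IsOpen U → U.Nonempty → area M U ≠ 0 := fun U hU hne =>
    (hU.measure_pos _ hne).ne'
  have hmem : ∀ c, c ∈ box c (r c) := fun c => mem_box_self c (hb c).pos
  have hall : ∀ c d, PoincarePair (box c (r c)) (box d (r d)) := by
    intro c d
    refine @PreconnectedSpace.induction₂ M _ _
      (fun c d => PoincarePair (box c (r c)) (box d (r d))) ⟨fun _ _ h => h.symm⟩ (fun c => ?_)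
      ⟨fun a b c h h' => h.trans h' (hpos _ (isOpen_box b (r b)) ⟨b, hmem b⟩)⟩ c d
    filter_upwards [(isOpen_box c (r c)).mem_nhds (hmem c)] with d hd
    exact ((hself c).mono subset_rfl inter_subset_left).trans
      ((hself d).mono inter_subset_right subset_rfl)
      (hpos _ ((isOpen_box c (r c)).inter (isOpen_box d (r d))) ⟨d, hd, hmem d⟩)
  have hnhds : ∀ c, box c (r c) ∈ 𝓝 c := fun c => (isOpen_box c (r c)).mem_nhds (hmem c)
  exact .univ_left hnhds fun c => (PoincarePair.univ_left hnhds fun d => hall d c).symm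

variable (M) in
/-- The total area of the surface, as a real number. -/
def totalArea : ℝ := (area M).real univ

variable (M) in
theorem totalArea_pos [Nonempty M] : 0 < totalArea M := by
  rw [totalArea, measureReal_def, ENNReal.toReal_pos_iff]
  exact ⟨isOpen_univ.measure_pos _ univ_nonempty, measure_lt_top _ _⟩

variable (M) in
/-- The `L¹` Poincaré inequality. -/
theorem exists_poincare [ConnectedSpace M] :
    ∃ K : ℝ, 0 ≤ K ∧ ∀ u : M → ℝ, ContMDiff (𝓡∂ 2) 𝓘(ℝ, ℝ) ∞ u →
      ∫ x, |u x - (∫ y, u y ∂(area M)) / totalArea M| ∂(area M)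
        ≤ K * ∫ x, ‖grad u x‖ ∂(area M) := by
  obtain ⟨K, hK, h⟩ := poincarePair_univ M
  have hA := totalArea_pos M
  refine ⟨K.toReal / totalArea M, by positivity, fun u hu => ?_⟩
  have h1 := h u hu
  set m := (∫ y, u y ∂(area M)) / totalArea M with hm
  have hint : Integrable u (area M) := integrable_of_continuous hu.continuous
  have h2 : ∀ x, ENNReal.ofReal (totalArea M * |u x - m|) ≤ ∫⁻ y, ‖u x - u y‖ₑ ∂(area M) := by
    intro x
    rw [lintegral_enorm_of_continuous (f := fun y => u x - u y)
      (continuous_const.sub hu.continuous)]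
    refine ENNReal.ofReal_le_ofReal ?_
    have h3 : totalArea M * (u x - m) = ∫ y, (u x - u y) ∂(area M) := by
      rw [integral_sub (integrable_const _) hint, integral_const, smul_eq_mul, hm]
      change _ = totalArea M * _ - _
      field_simp
    calc totalArea M * |u x - m| = |totalArea M * (u x - m)| := by
          rw [abs_mul, abs_of_pos hA]
      _ ≤ _ := by
          rw [h3]
          exact abs_integral_le_integral_abs
  have h4 : ENNReal.ofReal (totalArea M * ∫ x, |u x - m| ∂(area M)) ≤ K * gradL1 u := by
    rw [← integral_const_mul, ofReal_integral_eq_lintegral_ofReal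
      (f := fun x => totalArea M * |u x - m|)
      (integrable_of_continuous ((hu.continuous.sub continuous_const).abs.const_mul _))
      (.of_forall fun x => by positivity)]
    refine le_trans (lintegral_mono h2) ?_
    simpa [crossDiff] using h1
  have h5 : gradL1 u = ENNReal.ofReal (∫ x, ‖grad u x‖ ∂(area M)) :=
    (ofReal_integral_eq_lintegral_ofReal (integrable_of_continuous (continuous_norm_grad hu))
      (.of_forall fun _ => norm_nonneg _)).symm
  have h6 : 0 ≤ ∫ x, ‖grad u x‖ ∂(area M) := integral_nonneg fun _ => norm_nonneg _
  rw [h5, ← ENNReal.ofReal_toReal hK, ← ENNReal.ofReal_mul ENNReal.toReal_nonneg,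
    ENNReal.ofReal_le_ofReal_iff (by positivity)] at h4
  rw [div_mul_eq_mul_div, le_div_iff₀ hA, mul_comm _ (totalArea M)]
  exact h4

end GlobalEstimates

/-! ### Exponentials, hyperbolic functions and the Cauchy–Schwarz inequality -/

section Exponential

theorem abs_exp_sub_one_le (x : ℝ) : |Real.exp x - 1| ≤ 2 * (|x| * Real.cosh x) := by
  have h1 := Real.add_one_le_exp x
  have h2 := Real.add_one_le_exp (-x)
  have h3 := Real.exp_pos x
  have h4 := Real.exp_pos (-x)
  have h5 : Real.exp x * Real.exp (-x) = 1 := by rw [← Real.exp_add, add_neg_cancel, Real.exp_zero]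
  rw [Real.cosh_eq, abs_le]
  rcases le_total 0 x with hx | hx
  · rw [abs_of_nonneg hx]
    constructor <;> nlinarith
  · rw [abs_of_nonpos hx]
    constructor <;> nlinarith

theorem exp_le_two_mul_cosh (x : ℝ) : Real.exp x ≤ 2 * Real.cosh x := by
  rw [Real.cosh_eq]
  linarith [Real.exp_pos (-x)]

theorem abs_sinh_le_cosh (x : ℝ) : |Real.sinh x| ≤ Real.cosh x := by
  rw [Real.cosh_eq, Real.sinh_eq, abs_le]
  constructor <;> linarith [Real.exp_pos x, Real.exp_pos (-x)]

theorem cosh_sub_one_le (x : ℝ) : Real.cosh x - 1 ≤ |x| * Real.cosh x := by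
  have h1 : Real.exp x - 1 ≤ x * Real.exp x := by
    have h2 := Real.add_one_le_exp (-x)
    have h5 : Real.exp x * Real.exp (-x) = 1 := by
      rw [← Real.exp_add, add_neg_cancel, Real.exp_zero]
    nlinarith [Real.exp_pos x]
  have h2 : Real.exp (-x) - 1 ≤ -x * Real.exp (-x) := by
    have h2 := Real.add_one_le_exp x
    have h5 : Real.exp x * Real.exp (-x) = 1 := by
      rw [← Real.exp_add, add_neg_cancel, Real.exp_zero]
    nlinarith [Real.exp_pos (-x)]
  have h3 : x * Real.sinh x ≤ |x| * Real.cosh x := by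
    refine (le_abs_self _).trans ?_
    rw [abs_mul]
    exact mul_le_mul_of_nonneg_left (abs_sinh_le_cosh x) (abs_nonneg x)
  refine le_trans ?_ h3
  rw [Real.cosh_eq, Real.sinh_eq]
  linarith

/-- The Cauchy–Schwarz inequality. -/
theorem integral_abs_mul_le {X : Type*} [MeasurableSpace X] {μ : Measure X} {f g : X → ℝ}
    (hf : MemLp f 2 μ) (hg : MemLp g 2 μ) :
    ∫ x, |f x * g x| ∂μ ≤ √(∫ x, f x ^ 2 ∂μ) * √(∫ x, g x ^ 2 ∂μ) := by
  have h := integral_mul_norm_le_Lp_mul_Lq (μ := μ) (f := f) (g := g) Real.HolderConjugate.two_two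
    (by simpa using hf) (by simpa using hg)
  simp only [Real.norm_eq_abs, ← abs_mul, Real.rpow_two, sq_abs, ← Real.sqrt_eq_rpow] at h
  exact h

end Exponential

/-! ### Exponential integrals of smooth functions -/

section SmoothEstimates

variable {M : Type*} [TopologicalSpace M] [ChartedSpace (EuclideanHalfSpace 2) M]
  [IsManifold (𝓡∂ 2) ∞ M]
  [RiemannianBundle (fun x : M ↦ TangentSpace (𝓡∂ 2) x)]
  [IsContMDiffRiemannianBundle (𝓡∂ 2) ∞ Plane (fun x : M ↦ TangentSpace (𝓡∂ 2) x)]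

theorem grad_comp {u : M → ℝ} (hu : ContMDiff (𝓡∂ 2) 𝓘(ℝ, ℝ) ∞ u) {g : ℝ → ℝ} {x : M} {g' : ℝ}
    (hg : HasDerivAt g g' (u x)) : grad (fun y => g (u y)) x = g' • grad u x := by
  have h1 := ((hu.mdifferentiable (by simp)) x).hasMFDerivAt
  have h2 := (hg.hasFDerivAt.hasMFDerivAt).comp x h1
  refine ext_inner_right ℝ fun w => ?_
  rw [real_inner_smul_left, inner_grad_left, inner_grad_left]
  have h3 := congrArg (fun T => T w) h2.mfderiv
  exact h3.trans (mul_comm (show ℝ from mfderiv (𝓡∂ 2) 𝓘(ℝ, ℝ) u x w) g')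

theorem norm_grad_comp {u : M → ℝ} (hu : ContMDiff (𝓡∂ 2) 𝓘(ℝ, ℝ) ∞ u) {g : ℝ → ℝ} {x : M}
    {g' : ℝ} (hg : HasDerivAt g g' (u x)) :
    ‖grad (fun y => g (u y)) x‖ = |g'| * ‖grad u x‖ := by
  rw [grad_comp hu hg, norm_smul, Real.norm_eq_abs]

theorem contMDiff_comp {u : M → ℝ} (hu : ContMDiff (𝓡∂ 2) 𝓘(ℝ, ℝ) ∞ u) {g : ℝ → ℝ}
    (hg : ContDiff ℝ ∞ g) : ContMDiff (𝓡∂ 2) 𝓘(ℝ, ℝ) ∞ fun y => g (u y) :=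
  hg.contMDiff.comp hu

variable [MeasurableSpace M] [BorelSpace M] [CompactSpace M]

theorem memLp_two_of_continuous {μ : Measure M} [IsFiniteMeasure μ] {f : M → ℝ}
    (hf : Continuous f) : MemLp f 2 μ :=
  (memLp_two_iff_integrable_sq hf.aestronglyMeasurable).2 (integrable_of_continuous (hf.pow 2))

theorem SmoothFunction.norm_sq (φ : SmoothFunction M) :
    ‖φ‖ ^ 2 = ∫ x, φ x ^ 2 ∂(area M) + ∫ x, ‖grad φ x‖ ^ 2 ∂(area M) := by
  have h2 : ‖φ‖ ^ 2 = ∫ x, (φ x * φ x + inner ℝ (grad φ x) (grad φ x)) ∂(area M) :=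
    (real_inner_self_eq_norm_sq φ).symm
  rw [h2, ← integral_add (f := fun x => φ x ^ 2) (g := fun x => ‖grad φ x‖ ^ 2)
    (integrable_of_continuous (φ.contMDiff.continuous.pow 2))
    (integrable_of_continuous ((continuous_norm_grad φ.contMDiff).pow 2))]
  simp only [real_inner_self_eq_norm_sq, sq]

theorem SmoothFunction.sqrt_integral_sq_le (φ : SmoothFunction M) :
    √(∫ x, φ x ^ 2 ∂(area M)) ≤ ‖φ‖ := by
  refine Real.sqrt_le_iff.2 ⟨norm_nonneg _, ?_⟩
  rw [φ.norm_sq]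
  exact le_add_of_nonneg_right (integral_nonneg fun _ => sq_nonneg _)

theorem SmoothFunction.sqrt_integral_grad_sq_le (φ : SmoothFunction M) :
    √(∫ x, ‖grad φ x‖ ^ 2 ∂(area M)) ≤ ‖φ‖ := by
  refine Real.sqrt_le_iff.2 ⟨norm_nonneg _, ?_⟩
  rw [φ.norm_sq]
  exact le_add_of_nonneg_left (integral_nonneg fun _ => sq_nonneg _)

theorem SmoothFunction.integral_abs_mul_le (φ : SmoothFunction M) {g : M → ℝ}
    (hg : Continuous g) :
    ∫ x, |φ x * g x| ∂(area M) ≤ ‖φ‖ * √(∫ x, g x ^ 2 ∂(area M)) :=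
  (RiemannianSurface.integral_abs_mul_le (memLp_two_of_continuous φ.contMDiff.continuous)
    (memLp_two_of_continuous hg)).trans
    (mul_le_mul_of_nonneg_right φ.sqrt_integral_sq_le (Real.sqrt_nonneg _))

theorem SmoothFunction.integral_grad_mul_le (φ : SmoothFunction M) {g : M → ℝ}
    (hg : Continuous g) :
    ∫ x, |‖grad φ x‖ * g x| ∂(area M) ≤ ‖φ‖ * √(∫ x, g x ^ 2 ∂(area M)) :=
  (RiemannianSurface.integral_abs_mul_le
    (memLp_two_of_continuous (continuous_norm_grad φ.contMDiff)) (memLp_two_of_continuous hg)).trans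
    (mul_le_mul_of_nonneg_right φ.sqrt_integral_grad_sq_le (Real.sqrt_nonneg _))

variable (M) in
/-- A weak form of the Trudinger inequality. The Sobolev inequality for `cosh φ - 1`, whose gradient
is bounded by `|∇φ| cosh φ`, can be absorbed as soon as the `H¹` norm of `φ` is small. -/
theorem exists_integral_cosh_sq_le : ∃ ε : ℝ, 0 < ε ∧ ∀ φ : SmoothFunction M, ‖φ‖ ≤ ε →
    ∫ x, Real.cosh (φ x) ^ 2 ∂(area M) ≤ 4 * totalArea M := by
  obtain ⟨K, hK, hS⟩ := exists_sobolev M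
  refine ⟨1 / (4 * (K + 1)), by positivity, fun φ hφ => ?_⟩
  have hc := φ.contMDiff.continuous
  have hcosh : Continuous fun x => Real.cosh (φ x) := Real.continuous_cosh.comp hc
  set Y := ∫ x, Real.cosh (φ x) ^ 2 ∂(area M) with hY
  have hY0 : 0 ≤ Y := integral_nonneg fun _ => sq_nonneg _
  have h1 := hS (fun x => Real.cosh (φ x) - 1)
    (contMDiff_comp (g := fun z => Real.cosh z - 1) φ.contMDiff
      (Real.contDiff_cosh.sub contDiff_const))
  have h2 : ∫ x, (|Real.cosh (φ x) - 1| + ‖grad (fun x => Real.cosh (φ x) - 1) x‖) ∂(area M)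
      ≤ 2 * (‖φ‖ * √Y) := by
    calc _ ≤ ∫ x, (|φ x * Real.cosh (φ x)| + |‖grad φ x‖ * Real.cosh (φ x)|) ∂(area M) := by
          refine integral_mono_of_nonneg (.of_forall fun _ =>
            add_nonneg (abs_nonneg _) (norm_nonneg _))
            (integrable_of_continuous ((hc.mul hcosh).abs.add
              ((continuous_norm_grad φ.contMDiff).mul hcosh).abs)) (.of_forall fun x => ?_)
          have h3 := Real.one_le_cosh (φ x)
          have h4 := cosh_sub_one_le (φ x)
          have h5 : ‖grad (fun x => Real.cosh (φ x) - 1) x‖ = |Real.sinh (φ x)| * ‖grad φ x‖ :=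
            norm_grad_comp (g := fun z => Real.cosh z - 1) φ.contMDiff
              ((Real.hasDerivAt_cosh _).sub_const 1)
          simp only
          rw [h5, abs_mul, abs_mul, abs_of_nonneg (sub_nonneg.2 h3),
            abs_of_nonneg (norm_nonneg (grad φ x)), abs_of_pos (Real.cosh_pos _),
            mul_comm ‖grad φ x‖]
          exact add_le_add h4 (mul_le_mul_of_nonneg_right (abs_sinh_le_cosh _) (norm_nonneg _))
      _ ≤ ‖φ‖ * √Y + ‖φ‖ * √Y := by
          rw [integral_add (f := fun x => |φ x * Real.cosh (φ x)|)
            (g := fun x => |‖grad φ x‖ * Real.cosh (φ x)|)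
            (integrable_of_continuous (hc.mul hcosh).abs)
            (integrable_of_continuous ((continuous_norm_grad φ.contMDiff).mul hcosh).abs)]
          exact add_le_add (φ.integral_abs_mul_le hcosh) (φ.integral_grad_mul_le hcosh)
      _ = _ := by ring
  have h3 : ∫ x, (Real.cosh (φ x) - 1) ^ 2 ∂(area M) ≤ K * (4 * ‖φ‖ ^ 2 * Y) := by
    refine h1.trans (mul_le_mul_of_nonneg_left ?_ hK)
    calc _ ≤ (2 * (‖φ‖ * √Y)) ^ 2 := by
          refine pow_le_pow_left₀ (integral_nonneg fun _ =>
            add_nonneg (abs_nonneg _) (norm_nonneg _)) h2 2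
      _ = _ := by rw [mul_pow, mul_pow, Real.sq_sqrt hY0]; ring
  have h4 : Y ≤ 2 * ∫ x, (Real.cosh (φ x) - 1) ^ 2 ∂(area M) + 2 * totalArea M := by
    calc Y ≤ ∫ x, (2 * (Real.cosh (φ x) - 1) ^ 2 + 2) ∂(area M) := by
          refine integral_mono (integrable_of_continuous (hcosh.pow 2))
            (integrable_of_continuous (((hcosh.sub continuous_const).pow 2).const_mul 2 |>.add
              continuous_const)) fun x => ?_
          simp only
          nlinarith [sq_nonneg (Real.cosh (φ x) - 2)]
      _ = _ := by
          rw [integral_add (f := fun x => 2 * (Real.cosh (φ x) - 1) ^ 2) (integrable_of_continuous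
            (((hcosh.sub continuous_const).pow 2).const_mul 2)) (integrable_const _),
            integral_const_mul, integral_const, smul_eq_mul, totalArea]
          ring
  have h5 : 16 * K * ‖φ‖ ^ 2 ≤ 1 := by
    have h6 : ‖φ‖ ^ 2 ≤ (1 / (4 * (K + 1))) ^ 2 := pow_le_pow_left₀ (norm_nonneg _) hφ 2
    calc 16 * K * ‖φ‖ ^ 2 ≤ 16 * K * (1 / (4 * (K + 1))) ^ 2 := by gcongr
      _ = K / (K + 1) ^ 2 := by field_simp; ring
      _ ≤ 1 := by
          rw [div_le_one (by positivity)]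
          nlinarith
  nlinarith

variable (M) in
/-- On a small ball of `H¹`, the integrals of `|e^φ - 1|` over the surface and over its boundary
are bounded by the `H¹` norm. -/
theorem exists_integral_abs_exp_sub_one_le : ∃ ε B : ℝ, 0 < ε ∧ 0 ≤ B ∧
    ∀ φ : SmoothFunction M, ‖φ‖ ≤ ε →
      ∫ x, |Real.exp (φ x) - 1| ∂(area M) ≤ B * ‖φ‖ ∧
      ∫ x, |Real.exp (φ x) - 1| ∂(boundaryLength M) ≤ B * ‖φ‖ := by
  obtain ⟨ε, hε, hY⟩ := exists_integral_cosh_sq_le M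
  obtain ⟨K, hK, hT⟩ := exists_trace_le M
  set A := √(4 * totalArea M) with hA
  refine ⟨ε, 4 * A * (K + 1), hε, by positivity, fun φ hφ => ?_⟩
  have hc := φ.contMDiff.continuous
  have hcosh : Continuous fun x => Real.cosh (φ x) := Real.continuous_cosh.comp hc
  have hle : √(∫ x, Real.cosh (φ x) ^ 2 ∂(area M)) ≤ A := Real.sqrt_le_sqrt (hY φ hφ)
  have hn := norm_nonneg φ
  have h0 : ∫ x, |φ x * Real.cosh (φ x)| ∂(area M) ≤ ‖φ‖ * A :=
    (φ.integral_abs_mul_le hcosh).trans (mul_le_mul_of_nonneg_left hle hn)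
  have h0' : ∫ x, |‖grad φ x‖ * Real.cosh (φ x)| ∂(area M) ≤ ‖φ‖ * A :=
    (φ.integral_grad_mul_le hcosh).trans (mul_le_mul_of_nonneg_left hle hn)
  have hi1 : Integrable (fun x => |φ x * Real.cosh (φ x)|) (area M) :=
    integrable_of_continuous (hc.mul hcosh).abs
  have hi2 : Integrable (fun x => |‖grad φ x‖ * Real.cosh (φ x)|) (area M) :=
    integrable_of_continuous ((continuous_norm_grad φ.contMDiff).mul hcosh).abs
  have hpt : ∀ x, |Real.exp (φ x) - 1| ≤ 2 * |φ x * Real.cosh (φ x)| := fun x => by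
    rw [abs_mul, abs_of_pos (Real.cosh_pos _)]
    exact abs_exp_sub_one_le _
  have h1 : ∫ x, |Real.exp (φ x) - 1| ∂(area M) ≤ 2 * (‖φ‖ * A) := by
    calc _ ≤ ∫ x, 2 * |φ x * Real.cosh (φ x)| ∂(area M) :=
          integral_mono_of_nonneg (.of_forall fun _ => abs_nonneg _) (hi1.const_mul 2)
            (.of_forall hpt)
      _ ≤ _ := by
          rw [integral_const_mul]
          linarith
  have h2 := hT (fun x => Real.exp (φ x) - 1) (contMDiff_comp (g := fun z => Real.exp z - 1)
    φ.contMDiff (Real.contDiff_exp.sub contDiff_const))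
  have h3 : ∫ x, (|Real.exp (φ x) - 1| + ‖grad (fun x => Real.exp (φ x) - 1) x‖) ∂(area M)
      ≤ 4 * (‖φ‖ * A) := by
    calc _ ≤ ∫ x, (2 * |φ x * Real.cosh (φ x)| + 2 * |‖grad φ x‖ * Real.cosh (φ x)|) ∂(area M) := by
          refine integral_mono_of_nonneg (.of_forall fun _ =>
            add_nonneg (abs_nonneg _) (norm_nonneg _)) ((hi1.const_mul 2).add (hi2.const_mul 2))
            (.of_forall fun x => ?_)
          have h5 : ‖grad (fun x => Real.exp (φ x) - 1) x‖ = |Real.exp (φ x)| * ‖grad φ x‖ :=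
            norm_grad_comp (g := fun z => Real.exp z - 1) φ.contMDiff
              ((Real.hasDerivAt_exp _).sub_const 1)
          simp only
          rw [h5]
          refine add_le_add (hpt x) ?_
          rw [abs_of_pos (Real.exp_pos _), abs_mul, abs_of_nonneg (norm_nonneg (grad φ x)),
            abs_of_pos (Real.cosh_pos _), mul_comm ‖grad φ x‖, ← mul_assoc]
          exact mul_le_mul_of_nonneg_right (exp_le_two_mul_cosh _) (norm_nonneg _)
      _ ≤ _ := by
          rw [integral_add (hi1.const_mul 2) (hi2.const_mul 2), integral_const_mul,
            integral_const_mul]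
          linarith
  have hA0 : 0 ≤ A := Real.sqrt_nonneg _
  constructor
  · refine h1.trans ?_
    nlinarith [mul_nonneg hn hA0, mul_nonneg (mul_nonneg hn hA0) hK]
  · refine h2.trans ((mul_le_mul_of_nonneg_left h3 hK).trans ?_)
    nlinarith [mul_nonneg hn hA0, mul_nonneg (mul_nonneg hn hA0) hK]

variable (M) in
/-- The `L¹` trace inequality for `φ²` bounds the boundary values of `φ` in `L²`. -/
theorem exists_integral_boundary_sq_le : ∃ C : ℝ, 0 ≤ C ∧ ∀ φ : SmoothFunction M,
    ∫ x, φ x ^ 2 ∂(boundaryLength M) ≤ C * ‖φ‖ ^ 2 := by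
  obtain ⟨K, hK, hT⟩ := exists_trace_le M
  refine ⟨3 * K, by positivity, fun φ => ?_⟩
  have hc := φ.contMDiff.continuous
  have h1 := hT (fun x => φ x ^ 2)
    (contMDiff_comp (g := fun z => z ^ 2) φ.contMDiff (contDiff_id.pow 2))
  have hg : ∀ x, ‖grad (fun x => φ x ^ 2) x‖ = 2 * |‖grad φ x‖ * φ x| := fun x => by
    have h5 := norm_grad_comp (g := fun z => z ^ 2) (x := x) φ.contMDiff (hasDerivAt_pow 2 (φ x))
    rw [h5]
    simp only [Nat.cast_ofNat, Nat.add_one_sub_one, pow_one, abs_mul, abs_two, abs_norm]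
    ring
  simp only [hg, abs_sq] at h1
  have hn := norm_nonneg φ
  have h2 : ∫ x, φ x ^ 2 ∂(area M) ≤ ‖φ‖ ^ 2 := by
    rw [φ.norm_sq]
    exact le_add_of_nonneg_right (integral_nonneg fun _ => sq_nonneg _)
  have h3 : ∫ x, |‖grad φ x‖ * φ x| ∂(area M) ≤ ‖φ‖ * ‖φ‖ :=
    (φ.integral_grad_mul_le hc).trans (mul_le_mul_of_nonneg_left φ.sqrt_integral_sq_le hn)
  rw [integral_add (f := fun x => φ x ^ 2) (g := fun x => 2 * |‖grad φ x‖ * φ x|)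
    (integrable_of_continuous (hc.pow 2)) ((integrable_of_continuous
    ((continuous_norm_grad φ.contMDiff).mul hc).abs).const_mul 2), integral_const_mul] at h1
  refine h1.trans ?_
  nlinarith

end SmoothEstimates

/-! ### Exponential integrals on the Sobolev space -/

section Sobolev

variable {M : Type*} [TopologicalSpace M] [ChartedSpace (EuclideanHalfSpace 2) M]
  [IsManifold (𝓡∂ 2) ∞ M]
  [RiemannianBundle (fun x : M ↦ TangentSpace (𝓡∂ 2) x)]
  [IsContMDiffRiemannianBundle (𝓡∂ 2) ∞ Plane (fun x : M ↦ TangentSpace (𝓡∂ 2) x)]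
  [MeasurableSpace M] [BorelSpace M] [CompactSpace M]

theorem norm_toLp_sq {μ : Measure M} [IsFiniteMeasure μ] (φ : SmoothFunction M) :
    ‖ContinuousMap.toLp 2 μ ℝ (toContinuousMap M φ)‖ ^ 2 = ∫ x, φ x ^ 2 ∂μ := by
  rw [← real_inner_self_eq_norm_sq, L2.inner_def]
  refine integral_congr_ae ?_
  filter_upwards [ContinuousMap.coeFn_toLp (p := 2) (𝕜 := ℝ) μ (toContinuousMap M φ)] with x hx
  rw [hx, real_inner_self_eq_norm_sq, Real.norm_eq_abs, sq_abs]
  rfl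

theorem norm_toH1 (φ : SmoothFunction M) : ‖toH1 M φ‖ = ‖φ‖ := UniformSpace.Completion.norm_coe φ

variable (M) in
/-- The restriction of smooth functions to the boundary is bounded for the `H¹` norm. -/
theorem exists_norm_smoothTrace_le : ∃ C : ℝ, ∀ φ : SmoothFunction M,
    ‖smoothTrace M φ‖ ≤ C * ‖φ‖ := by
  obtain ⟨C, hC, h⟩ := exists_integral_boundary_sq_le M
  refine ⟨√C, fun φ => ?_⟩
  refine le_of_sq_le_sq ?_ (by positivity)
  rw [mul_pow, Real.sq_sqrt hC]
  exact (norm_toLp_sq φ).trans_le (h φ)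

theorem trace_toH1 (φ : SmoothFunction M) : trace M (toH1 M φ) = smoothTrace M φ := by
  obtain ⟨C, h⟩ := exists_norm_smoothTrace_le M
  exact LinearMap.extendOfNorm_eq denseRange_toH1
    ⟨C, fun φ => (h φ).trans_eq (by rw [norm_toH1])⟩ φ

/-- An operator on `H¹` which maps every smooth function to its class in `L²(μ)`: the inclusion in
`L²` and the trace are of this kind. -/
def IsRestriction {μ : Measure M} (T : H1 M →L[ℝ] Lp ℝ 2 μ) : Prop :=
  ∀ φ : SmoothFunction M, T (toH1 M φ) =ᵐ[μ] φ

theorem isRestriction_toL2 : IsRestriction (toL2 M) := fun φ => by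
  rw [toL2_toH1]
  exact ContinuousMap.coeFn_toLp (p := 2) (𝕜 := ℝ) (area M) (toContinuousMap M φ)

theorem isRestriction_trace : IsRestriction (trace M) := fun φ => by
  rw [trace_toH1]
  exact ContinuousMap.coeFn_toLp (p := 2) (𝕜 := ℝ) (boundaryLength M) (toContinuousMap M φ)

/-- The bound `∫ |e^φ - 1| ∂μ ≤ B ‖φ‖` for the smooth functions `φ` in the ball of radius `ε`
of `H¹`. -/
def ExpBound (μ : Measure M) (ε B : ℝ) : Prop :=
  ∀ φ : SmoothFunction M, ‖φ‖ ≤ ε → ∫ x, |Real.exp (φ x) - 1| ∂μ ≤ B * ‖φ‖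

theorem exists_norm_sub_toH1_lt (u : H1 M) {δ : ℝ} (hδ : 0 < δ) :
    ∃ φ : SmoothFunction M, ‖u - toH1 M φ‖ < δ := by
  obtain ⟨_, ⟨φ, rfl⟩, h⟩ := Metric.mem_closure_iff.1 ((denseRange_toH1 (M := M)) u) δ hδ
  exact ⟨φ, by rwa [← dist_eq_norm]⟩

variable {μ : Measure M} [IsFiniteMeasure μ] {T : H1 M →L[ℝ] Lp ℝ 2 μ} {ε B : ℝ}

theorem aestronglyMeasurable_exp (u : H1 M) :
    AEStronglyMeasurable (fun x => Real.exp (T u x)) μ :=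
  Real.continuous_exp.comp_aestronglyMeasurable (Lp.aestronglyMeasurable (T u))

/-- The exponential bound passes from smooth functions to their limits in `H¹`, by Fatou's lemma
along a subsequence which converges almost everywhere. -/
theorem IsRestriction.lintegral_exp_sub_one_le (hT : IsRestriction T) (hB : ExpBound μ ε B)
    {u : H1 M} (hu : ‖u‖ < ε) :
    ∫⁻ x, ‖Real.exp (T u x) - 1‖ₑ ∂μ ≤ ENNReal.ofReal (B * ‖u‖) := by
  have hseq : ∀ n : ℕ, ∃ φ : SmoothFunction M, ‖u - toH1 M φ‖ < 1 / ((n : ℝ) + 1) := fun n =>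
    exists_norm_sub_toH1_lt u (by positivity)
  choose φ hφ using hseq
  have hlim : Tendsto (fun n => toH1 M (φ n)) atTop (𝓝 u) := by
    rw [tendsto_iff_norm_sub_tendsto_zero]
    refine squeeze_zero (fun _ => norm_nonneg _) (fun n => ?_)
      tendsto_one_div_add_atTop_nhds_zero_nat
    rw [norm_sub_rev]
    exact (hφ n).le
  have hlimT : Tendsto (fun n => T (toH1 M (φ n))) atTop (𝓝 (T u)) :=
    (T.continuous.tendsto u).comp hlim
  obtain ⟨ns, hns, hae⟩ := (tendstoInMeasure_of_tendsto_Lp hlimT).exists_seq_tendsto_ae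
  have hlim' := hlim.comp hns.tendsto_atTop
  have hnorm : Tendsto (fun n => ‖φ (ns n)‖) atTop (𝓝 ‖u‖) := by
    simpa only [Function.comp_def, norm_toH1] using hlim'.norm
  have hsm : ∀ᶠ n in atTop, ‖φ (ns n)‖ < ε := hnorm.eventually_lt_const hu
  have hbd : ∀ᶠ n in atTop, ∫⁻ x, ‖Real.exp (T (toH1 M (φ (ns n))) x) - 1‖ₑ ∂μ
      ≤ ENNReal.ofReal (B * ‖φ (ns n)‖) := by
    filter_upwards [hsm] with n hn
    have h1 : ∫⁻ x, ‖Real.exp (T (toH1 M (φ (ns n))) x) - 1‖ₑ ∂μ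
        = ∫⁻ x, ‖Real.exp (φ (ns n) x) - 1‖ₑ ∂μ := by
      refine lintegral_congr_ae ?_
      filter_upwards [hT (φ (ns n))] with x hx
      rw [hx]
    rw [h1, lintegral_enorm_of_continuous (f := fun x => Real.exp (φ (ns n) x) - 1)
      ((Real.continuous_exp.comp (φ (ns n)).contMDiff.continuous).sub continuous_const)]
    exact ENNReal.ofReal_le_ofReal (hB _ hn.le)
  calc ∫⁻ x, ‖Real.exp (T u x) - 1‖ₑ ∂μ
      = ∫⁻ x, liminf (fun n => ‖Real.exp (T (toH1 M (φ (ns n))) x) - 1‖ₑ) atTop ∂μ := by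
        refine lintegral_congr_ae ?_
        filter_upwards [hae] with x hx
        exact ((((Real.continuous_exp.tendsto _).comp hx).sub_const 1).enorm).liminf_eq.symm
    _ ≤ liminf (fun n => ∫⁻ x, ‖Real.exp (T (toH1 M (φ (ns n))) x) - 1‖ₑ ∂μ) atTop :=
        lintegral_liminf_le' fun n =>
          ((aestronglyMeasurable_exp _).sub aestronglyMeasurable_const).enorm
    _ ≤ liminf (fun n => ENNReal.ofReal (B * ‖φ (ns n)‖)) atTop := liminf_le_liminf hbd
    _ = ENNReal.ofReal (B * ‖u‖) :=
        (ENNReal.tendsto_ofReal (hnorm.const_mul B)).liminf_eq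

theorem IsRestriction.integrable_exp_sub_one (hT : IsRestriction T) (hB : ExpBound μ ε B)
    {u : H1 M} (hu : ‖u‖ < ε) : Integrable (fun x => Real.exp (T u x) - 1) μ :=
  ⟨(aestronglyMeasurable_exp u).sub aestronglyMeasurable_const,
    (hT.lintegral_exp_sub_one_le hB hu).trans_lt ENNReal.ofReal_lt_top⟩

theorem IsRestriction.integral_abs_exp_sub_one_le (hT : IsRestriction T) (hB : ExpBound μ ε B)
    (hB0 : 0 ≤ B) {u : H1 M} (hu : ‖u‖ < ε) : ∫ x, |Real.exp (T u x) - 1| ∂μ ≤ B * ‖u‖ := by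
  have h := hT.lintegral_exp_sub_one_le hB hu
  have h1 : ENNReal.ofReal (∫ x, |Real.exp (T u x) - 1| ∂μ) ≤ ENNReal.ofReal (B * ‖u‖) := by
    rw [ofReal_integral_eq_lintegral_ofReal (hT.integrable_exp_sub_one hB hu).abs
      (.of_forall fun _ => abs_nonneg _)]
    simpa only [← ofReal_norm, Real.norm_eq_abs] using h
  rwa [ENNReal.ofReal_le_ofReal_iff (by positivity)] at h1

/-- The exponential of any element of `H¹` is integrable: the element is the sum of a smooth, hence
bounded function and of a small element of `H¹`. -/
theorem IsRestriction.integrable_exp (hT : IsRestriction T) (hB : ExpBound μ ε B) (hε : 0 < ε)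
    (u : H1 M) : Integrable (fun x => Real.exp (T u x)) μ := by
  obtain ⟨φ, hφ⟩ := exists_norm_sub_toH1_lt u hε
  obtain ⟨C, hC⟩ := isCompact_univ.exists_bound_of_continuousOn
    (Real.continuous_exp.comp φ.contMDiff.continuous).continuousOn
  have h1 : Integrable (fun x => Real.exp (T (u - toH1 M φ) x)) μ := by
    exact ((hT.integrable_exp_sub_one hB hφ).add (integrable_const 1)).congr
      (.of_forall fun x => sub_add_cancel _ _)
  refine (h1.const_mul C).mono' (aestronglyMeasurable_exp u) ?_
  have hsub := Lp.coeFn_sub (T u) (T (toH1 M φ))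
  rw [← map_sub] at hsub
  filter_upwards [hT φ, hsub] with x hx hx2
  have h2 : T u x = φ x + T (u - toH1 M φ) x := by
    rw [hx2, Pi.sub_apply, hx]
    ring
  rw [h2, Real.exp_add, norm_mul, Real.norm_of_nonneg (Real.exp_pos (T (u - toH1 M φ) x)).le]
  exact mul_le_mul_of_nonneg_right (hC x (mem_univ x)) (Real.exp_pos _).le

theorem coeFn_two_smul (u : H1 M) : T ((2 : ℝ) • u) =ᵐ[μ] fun x => 2 * T u x := by
  rw [map_smul]
  filter_upwards [Lp.coeFn_smul (2 : ℝ) (T u)] with x hx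
  rw [hx, Pi.smul_apply, smul_eq_mul]

theorem IsRestriction.memLp_exp (hT : IsRestriction T) (hB : ExpBound μ ε B) (hε : 0 < ε)
    (u : H1 M) : MemLp (fun x => Real.exp (T u x)) 2 μ := by
  rw [memLp_two_iff_integrable_sq (aestronglyMeasurable_exp u)]
  refine (hT.integrable_exp hB hε ((2 : ℝ) • u)).congr ?_
  filter_upwards [coeFn_two_smul (T := T) u] with x hx
  rw [hx, ← Real.exp_nat_mul]
  norm_num

theorem IsRestriction.integral_exp_sub_one_sq_le (hT : IsRestriction T) (hB : ExpBound μ ε B)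
    (hB0 : 0 ≤ B) {u : H1 M} (hu : ‖u‖ < ε / 2) :
    ∫ x, (Real.exp (T u x) - 1) ^ 2 ∂μ ≤ 4 * B * ‖u‖ := by
  have hn := norm_nonneg u
  have hu1 : ‖u‖ < ε := by linarith
  have hu2 : ‖(2 : ℝ) • u‖ < ε := by
    rw [norm_smul, Real.norm_ofNat]
    linarith
  have h1 := hT.integral_abs_exp_sub_one_le hB hB0 hu1
  have h2 := hT.integral_abs_exp_sub_one_le hB hB0 hu2
  have hi1 := (hT.integrable_exp_sub_one hB hu1).abs
  have hi2 := (hT.integrable_exp_sub_one hB hu2).abs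
  calc ∫ x, (Real.exp (T u x) - 1) ^ 2 ∂μ
      ≤ ∫ x, (|Real.exp (T ((2 : ℝ) • u) x) - 1| + 2 * |Real.exp (T u x) - 1|) ∂μ := by
        refine integral_mono_of_nonneg (.of_forall fun _ => sq_nonneg _)
          (hi2.add (hi1.const_mul 2)) ?_
        filter_upwards [coeFn_two_smul (T := T) u] with x hx
        have h3 : Real.exp (2 * T u x) = Real.exp (T u x) ^ 2 := by
          rw [← Real.exp_nat_mul]
          norm_num
        rw [hx, h3]
        have h4 := le_abs_self (Real.exp (T u x) ^ 2 - 1)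
        have h5 := neg_abs_le (Real.exp (T u x) - 1)
        nlinarith
    _ = ∫ x, |Real.exp (T ((2 : ℝ) • u) x) - 1| ∂μ + 2 * ∫ x, |Real.exp (T u x) - 1| ∂μ := by
        rw [integral_add hi2 (hi1.const_mul 2), integral_const_mul]
    _ ≤ B * ‖(2 : ℝ) • u‖ + 2 * (B * ‖u‖) := by gcongr
    _ = 4 * B * ‖u‖ := by
        rw [norm_smul, Real.norm_ofNat]
        ring

/-- The integrals of exponentials depend continuously on the element of `H¹`, because
`e^v - e^u = e^u (e^(v - u) - 1)`, where the second factor is small in `L²`. -/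
theorem IsRestriction.continuous_integral_exp (hT : IsRestriction T) (hB : ExpBound μ ε B)
    (hε : 0 < ε) (hB0 : 0 ≤ B) {g : M → ℝ} (hg : AEStronglyMeasurable g μ) {G : ℝ}
    (hG : ∀ᵐ x ∂μ, |g x| ≤ G) : Continuous fun u : H1 M => ∫ x, g x * Real.exp (T u x) ∂μ := by
  have hint : ∀ u : H1 M, Integrable (fun x => g x * Real.exp (T u x)) μ := fun u =>
    (hT.integrable_exp hB hε u).bdd_mul hg hG
  rw [continuous_iff_continuousAt]
  intro u
  set A := √(∫ x, Real.exp (T u x) ^ 2 ∂μ)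
  rw [ContinuousAt, tendsto_iff_norm_sub_tendsto_zero]
  have hlim : Tendsto (fun v : H1 M => |G| * (A * √(4 * B * ‖v - u‖))) (𝓝 u) (𝓝 0) := by
    have : Continuous fun v : H1 M => |G| * (A * √(4 * B * ‖v - u‖)) := by fun_prop
    simpa using this.tendsto u
  refine squeeze_zero' (.of_forall fun _ => norm_nonneg _) ?_ hlim
  have hev : ∀ᶠ v in 𝓝 u, ‖v - u‖ < ε / 2 := by
    have := Metric.ball_mem_nhds u (half_pos hε)
    filter_upwards [this] with v hv
    rwa [← dist_eq_norm]
  filter_upwards [hev] with v hv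
  have hL2 : MemLp (fun x => Real.exp (T (v - u) x) - 1) 2 μ :=
    (hT.memLp_exp hB hε (v - u)).sub (memLp_const 1)
  have hcs := integral_abs_mul_le (hT.memLp_exp hB hε u) hL2
  have hi : Integrable (fun x => |Real.exp (T u x) * (Real.exp (T (v - u) x) - 1)|) μ :=
    ((hT.memLp_exp hB hε u).integrable_mul hL2).abs
  rw [← integral_sub (hint v) (hint u)]
  calc ‖∫ x, (g x * Real.exp (T v x) - g x * Real.exp (T u x)) ∂μ‖
      ≤ ∫ x, |G| * |Real.exp (T u x) * (Real.exp (T (v - u) x) - 1)| ∂μ := by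
        refine norm_integral_le_of_norm_le (hi.const_mul _) ?_
        have hsub := Lp.coeFn_sub (T v) (T u)
        rw [← map_sub] at hsub
        filter_upwards [hG, hsub] with x hx hx2
        have h1 : Real.exp (T u x) * (Real.exp (T (v - u) x) - 1)
            = Real.exp (T v x) - Real.exp (T u x) := by
          rw [hx2, Pi.sub_apply, mul_sub, ← Real.exp_add]
          ring_nf
        rw [h1, ← mul_sub, norm_mul]
        exact mul_le_mul_of_nonneg_right (hx.trans (le_abs_self _)) (abs_nonneg _)
    _ = |G| * ∫ x, |Real.exp (T u x) * (Real.exp (T (v - u) x) - 1)| ∂μ :=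
        integral_const_mul _ _
    _ ≤ |G| * (A * √(4 * B * ‖v - u‖)) := by
        refine mul_le_mul_of_nonneg_left (hcs.trans ?_) (abs_nonneg _)
        exact mul_le_mul_of_nonneg_left
          (Real.sqrt_le_sqrt (hT.integral_exp_sub_one_sq_le hB hB0 hv)) (Real.sqrt_nonneg _)

end Sobolev

/-! ### Continuity of the energy and mountain-pass geometry -/

section MountainPass

variable {M : Type*} [TopologicalSpace M] [ChartedSpace (EuclideanHalfSpace 2) M]
  [IsManifold (𝓡∂ 2) ∞ M]
  [RiemannianBundle (fun x : M ↦ TangentSpace (𝓡∂ 2) x)]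
  [IsContMDiffRiemannianBundle (𝓡∂ 2) ∞ Plane (fun x : M ↦ TangentSpace (𝓡∂ 2) x)]
  [MeasurableSpace M] [BorelSpace M] [CompactSpace M]

/-- The element of `SmoothFunction M` with underlying function `u`. -/
def SmoothFunction.mk (u : M → ℝ) (hu : ContMDiff (𝓡∂ 2) 𝓘(ℝ, ℝ) ∞ u) : SmoothFunction M :=
  (⟨u, hu⟩ : C^∞⟮𝓡∂ 2, M; 𝓘(ℝ, ℝ), ℝ⟯)

@[simp] theorem SmoothFunction.mk_apply (u : M → ℝ) (hu : ContMDiff (𝓡∂ 2) 𝓘(ℝ, ℝ) ∞ u) (x : M) :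
    SmoothFunction.mk u hu x = u x := rfl

variable (M) in
/-- The constant function `1` in `H¹`. -/
def oneH1 : H1 M := toH1 M (SmoothFunction.mk (fun _ => 1) contMDiff_const)

theorem IsRestriction.smul_oneH1 {μ : Measure M} {T : H1 M →L[ℝ] Lp ℝ 2 μ}
    (hT : IsRestriction T) (a : ℝ) : T (a • oneH1 M) =ᵐ[μ] fun _ => a := by
  rw [map_smul]
  filter_upwards [Lp.coeFn_smul a (T (oneH1 M)),
    hT (SmoothFunction.mk (fun _ => 1) contMDiff_const)] with x hx hx2
  rw [hx, Pi.smul_apply, oneH1, hx2]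
  simp

/-- The mean value of an element of `H¹`, as the `L²` inner product with `1` over the total area. -/
def mean (u : H1 M) : ℝ := inner ℝ (toL2 M (oneH1 M)) (toL2 M u) / totalArea M

theorem continuous_mean : Continuous (mean : H1 M → ℝ) :=
  (continuous_const.inner (toL2 M).continuous).div_const _

theorem mean_toH1 (φ : SmoothFunction M) :
    mean (toH1 M φ) = (∫ x, φ x ∂(area M)) / totalArea M := by
  rw [mean, L2.inner_def]
  congr 1
  refine integral_congr_ae ?_
  filter_upwards [isRestriction_toL2 φ,
    isRestriction_toL2 (SmoothFunction.mk (fun _ => (1 : ℝ)) contMDiff_const)] with x hx hx2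
  rw [hx, oneH1, hx2]
  simp

theorem continuous_dirichletEnergy : Continuous (dirichletEnergy : H1 M → ℝ) := by
  unfold dirichletEnergy
  fun_prop

theorem dirichletEnergy_nonneg (u : H1 M) : 0 ≤ dirichletEnergy u := by
  refine denseRange_toH1.induction_on (p := fun u => 0 ≤ dirichletEnergy u) u
    (isClosed_le continuous_const continuous_dirichletEnergy) fun φ => ?_
  rw [dirichletEnergy_toH1]
  exact integral_nonneg fun _ => sq_nonneg _

theorem dirichletEnergy_smul_oneH1 (a : ℝ) : dirichletEnergy (a • oneH1 M) = 0 := by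
  have h1 : a • oneH1 M = toH1 M (SmoothFunction.mk (fun _ => a) contMDiff_const) := by
    rw [oneH1, ← map_smul]
    congr 1
    refine DFunLike.coe_injective (funext fun x => ?_)
    change a * 1 = a
    rw [mul_one]
  rw [h1, dirichletEnergy_toH1, integral_eq_zero_of_ae (.of_forall fun x => ?_)]
  have h2 := norm_grad_comp (u := fun _ : M => (0 : ℝ)) (g := fun _ => a) (x := x)
    contMDiff_const (hasDerivAt_const _ a)
  rw [abs_zero, zero_mul] at h2
  have h3 : ‖grad (SmoothFunction.mk (fun _ : M => a) contMDiff_const) x‖ = 0 := h2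
  simp [h3]

theorem mean_smul_oneH1 [Nonempty M] (a : ℝ) : mean (a • oneH1 M) = a := by
  have h1 : mean (oneH1 M) = 1 := by
    rw [oneH1, mean_toH1]
    simp only [SmoothFunction.mk_apply, integral_const, smul_eq_mul, mul_one]
    exact div_self (totalArea_pos M).ne'
  rw [mean, map_smul, inner_smul_right, mul_div_assoc, ← mean, h1, mul_one]

variable (M) in
/-- The Poincaré inequality in `H¹`. -/
theorem exists_norm_sub_mean_le [ConnectedSpace M] : ∃ C : ℝ, 0 ≤ C ∧
    ∀ u : H1 M, ‖u - mean u • oneH1 M‖ ≤ C * √(dirichletEnergy u) := by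
  obtain ⟨K, hK, hS⟩ := exists_sobolev M
  obtain ⟨L, hL, hP⟩ := exists_poincare M
  have hA := totalArea_pos M
  set C := K * (L + 1) ^ 2 * totalArea M + 1 with hC
  have hC0 : 0 ≤ C := by positivity
  refine ⟨√C, Real.sqrt_nonneg _, fun u => ?_⟩
  rw [← Real.sqrt_mul hC0]
  refine Real.le_sqrt_of_sq_le ?_
  refine denseRange_toH1.induction_on
    (p := fun u : H1 M => ‖u - mean u • oneH1 M‖ ^ 2 ≤ C * dirichletEnergy u) u
    (isClosed_le (((continuous_id.sub (continuous_mean.smul continuous_const)).norm).pow 2)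
      (continuous_const.mul continuous_dirichletEnergy)) fun φ => ?_
  set m := mean (toH1 M φ) with hm
  have hφ := φ.contMDiff
  let ψ : SmoothFunction M := SmoothFunction.mk (fun x => φ x - m)
    (contMDiff_comp (g := fun z => z - m) hφ (contDiff_id.sub contDiff_const))
  have hψ : toH1 M φ - m • oneH1 M = toH1 M ψ := by
    rw [oneH1, ← map_smul, ← map_sub]
    congr 1
    refine DFunLike.coe_injective (funext fun x => ?_)
    change φ x - m * 1 = φ x - m
    rw [mul_one]
  have hg : ∀ x, ‖grad ψ x‖ = ‖grad φ x‖ := fun x => by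
    have := norm_grad_comp (g := fun z => z - m) (x := x) hφ ((hasDerivAt_id _).sub_const m)
    rw [abs_one, one_mul] at this
    exact this
  have hgc := continuous_norm_grad hφ
  set g1 := ∫ x, ‖grad φ x‖ ∂(area M) with hg1
  set g2 := ∫ x, ‖grad φ x‖ ^ 2 ∂(area M) with hg2
  have hg10 : 0 ≤ g1 := integral_nonneg fun _ => norm_nonneg _
  have hg20 : 0 ≤ g2 := integral_nonneg fun _ => sq_nonneg _
  have hcs : g1 ^ 2 ≤ totalArea M * g2 := by
    have h1 := integral_abs_mul_le (memLp_two_of_continuous (μ := area M) hgc)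
      (memLp_const (1 : ℝ))
    simp only [mul_one, abs_norm, one_pow, integral_const, smul_eq_mul] at h1
    calc g1 ^ 2 ≤ (√g2 * √(totalArea M)) ^ 2 := pow_le_pow_left₀ hg10 h1 2
      _ = _ := by
        rw [mul_pow, Real.sq_sqrt hg20, Real.sq_sqrt hA.le, mul_comm]
  have h2 := hS ψ ψ.contMDiff
  have h3 := hP φ hφ
  rw [← mean_toH1, ← hm] at h3
  have h4 : ∫ x, (|ψ x| + ‖grad ψ x‖) ∂(area M) ≤ (L + 1) * g1 := by
    rw [integral_add (f := fun x => |ψ x|) (g := fun x => ‖grad ψ x‖)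
      (integrable_of_continuous ψ.contMDiff.continuous.abs)
      (integrable_of_continuous (continuous_norm_grad ψ.contMDiff))]
    simp only [hg]
    rw [add_mul, one_mul]
    exact add_le_add h3 le_rfl
  have h5 : 0 ≤ ∫ x, (|ψ x| + ‖grad ψ x‖) ∂(area M) :=
    integral_nonneg fun _ => add_nonneg (abs_nonneg _) (norm_nonneg _)
  rw [hψ, norm_toH1, ψ.norm_sq, dirichletEnergy_toH1]
  simp only [hg]
  calc _ ≤ K * ((L + 1) * g1) ^ 2 + g2 := by
        refine add_le_add (h2.trans ?_) le_rfl
        exact mul_le_mul_of_nonneg_left (pow_le_pow_left₀ h5 h4 2) hK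
    _ = K * (L + 1) ^ 2 * g1 ^ 2 + g2 := by ring
    _ ≤ K * (L + 1) ^ 2 * (totalArea M * g2) + g2 := by gcongr
    _ = C * g2 := by rw [hC]; ring

/-- The boundary length is carried by the boundary. -/
theorem ae_mem_boundary : ∀ᵐ x ∂(boundaryLength M), x ∈ (𝓡∂ 2).boundary M := by
  have hcl : IsClosed ((𝓡∂ 2).boundary M) :=
    (𝓡∂ 2).isClosed_boundary (n := ∞) (by simp)
  rw [ae_iff]
  have h : boundaryLength M (univ ∩ ((𝓡∂ 2).boundary M)ᶜ) = 0 := by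
    refine isCompact_univ.induction_on
      (p := fun s => boundaryLength M (s ∩ ((𝓡∂ 2).boundary M)ᶜ) = 0) (by simp) ?_ ?_ ?_
    · intro s t hst ht
      exact measure_mono_null (inter_subset_inter_left _ hst) ht
    · intro s t hs ht
      rw [union_inter_distrib_right]
      exact measure_union_null hs ht
    · intro c _
      obtain ⟨r, hb, -⟩ := exists_isBox c (N := univ) univ_mem
      refine ⟨box c r, mem_nhdsWithin_of_mem_nhds
        ((isOpen_box c r).mem_nhds (mem_box_self c hb.pos)), ?_⟩
      have h1 := setLIntegral_boundaryLength_box hb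
        (measurable_one.indicator hcl.measurableSet.compl :
          Measurable (((𝓡∂ 2).boundary M)ᶜ.indicator (1 : M → ℝ≥0∞)))
      rw [setLIntegral_indicator hcl.measurableSet.compl, Pi.one_def, setLIntegral_one,
        inter_comm] at h1
      rw [h1]
      split_ifs with hr
      · have h2 : ∀ t ∈ rangeOne c r, chartPt c 0 t ∈ (𝓡∂ 2).boundary M := by
          intro t ht
          have h0 : |0 - coord c 0 c| < r := by
            rwa [zero_sub, abs_neg, abs_of_nonneg (coord_nonneg c (mem_chart_source _ c))]
          have h3 := hb.mem_target 0 t le_rfl h0 (mem_rangeOne.1 ht)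
          exact (isBoundaryPoint_iff_coord c (chartPt_mem_source h3)).2 (coord_zero_chartPt h3)
        refine (setLIntegral_congr_fun (g := fun _ => 0)
          (measurableSet_Ioo : MeasurableSet (rangeOne c r)) fun t ht => ?_).trans (by simp)
        simp [h2 t ht]
      · rfl
  rwa [univ_inter] at h

variable {K h : M → ℝ}

theorem energy_eq (hflat : ∀ x : M, gaussianCurvature x = 0) (u : H1 M) :
    energy K h u = 1 / 2 * dirichletEnergy u + ∫ x, 2 * |K x| * Real.exp (toL2 M u x) ∂(area M)
      - 4 * ∫ x, h x * Real.exp (trace M ((1 / 2 : ℝ) • u) x) ∂(boundaryLength M) := by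
  simp only [energy, hflat, mul_zero, zero_mul, zero_add]
  congr 2
  refine integral_congr_ae ?_
  rw [map_smul]
  filter_upwards [Lp.coeFn_smul (1 / 2 : ℝ) (trace M u)] with x hx
  rw [hx, Pi.smul_apply, smul_eq_mul]
  ring_nf

variable (M) in
/-- The common constants in the exponential bounds on the surface and on its boundary. -/
theorem exists_expBound : ∃ ε B : ℝ, 0 < ε ∧ 0 ≤ B ∧ ExpBound (area M) ε B ∧
    ExpBound (boundaryLength M) ε B := by
  obtain ⟨ε, B, hε, hB, h⟩ := exists_integral_abs_exp_sub_one_le M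
  exact ⟨ε, B, hε, hB, fun φ hφ => (h φ hφ).1, fun φ hφ => (h φ hφ).2⟩

theorem exists_abs_le_of_continuous {f : M → ℝ} (hf : Continuous f) :
    ∃ C : ℝ, 0 ≤ C ∧ ∀ x, |f x| ≤ C := by
  obtain ⟨C, hC⟩ := isCompact_univ.exists_bound_of_continuousOn hf.continuousOn
  exact ⟨|C|, abs_nonneg _, fun x => (hC x (mem_univ x)).trans (le_abs_self C)⟩

theorem continuous_energy (hflat : ∀ x : M, gaussianCurvature x = 0) (hK : Continuous K)
    (hh : Continuous h) : Continuous (energy K h) := by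
  obtain ⟨ε, B, hε, hB, h1, h2⟩ := exists_expBound M
  rw [funext (energy_eq hflat)]
  obtain ⟨C, -, hC⟩ := exists_abs_le_of_continuous (continuous_const.mul hK.abs :
    Continuous fun x => 2 * |K x|)
  obtain ⟨H, -, hH⟩ := exists_abs_le_of_continuous hh
  have c1 := isRestriction_toL2.continuous_integral_exp h1 hε hB
    (continuous_const.mul hK.abs : Continuous fun x => 2 * |K x|).aestronglyMeasurable
    (.of_forall hC)
  have c2 := (isRestriction_trace.continuous_integral_exp h2 hε hB hh.aestronglyMeasurable
    (.of_forall hH)).comp (continuous_const_smul (1 / 2 : ℝ))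
  exact ((continuous_const.mul continuous_dirichletEnergy).add c1).sub (continuous_const.mul c2)

/-- On the elements of `H¹` with small Dirichlet integral, the boundary integral of `h e^(u/2)` is
close to `e^(mean u / 2) ∮ h`. -/
theorem exists_energy_lower_bound [ConnectedSpace M] (hflat : ∀ x : M, gaussianCurvature x = 0)
    (hh : Continuous h) : ∃ r L : ℝ, 0 < r ∧ 0 ≤ L ∧
      ∀ u : H1 M, dirichletEnergy u ≤ r ^ 2 →
        1 / 2 * dirichletEnergy u - 4 * (Real.exp (mean u / 2) *
          (∫ x, h x ∂(boundaryLength M) + L * √(dirichletEnergy u))) ≤ energy K h u := by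
  obtain ⟨ε, B, hε, hB, -, h2⟩ := exists_expBound M
  obtain ⟨C, hC, hP⟩ := exists_norm_sub_mean_le M
  obtain ⟨H, hH0, hH⟩ := exists_abs_le_of_continuous hh
  refine ⟨ε / (C + 1), H * (B * C), by positivity, by positivity, fun u hu => ?_⟩
  set D := dirichletEnergy u with hD
  set w := (1 / 2 : ℝ) • (u - mean u • oneH1 M) with hw
  have hsq : √D ≤ ε / (C + 1) := Real.sqrt_le_iff.2 ⟨by positivity, hu⟩
  have hs0 := Real.sqrt_nonneg D
  have hwn : ‖w‖ ≤ C * √D / 2 := by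
    rw [hw, norm_smul, Real.norm_of_nonneg (by norm_num)]
    linarith [hP u]
  have hwε : ‖w‖ < ε := by
    have h3 : C * √D ≤ C * (ε / (C + 1)) := by gcongr
    have h4 : C * (ε / (C + 1)) ≤ ε := by
      rw [mul_div_assoc', div_le_iff₀ (by positivity)]
      nlinarith
    linarith
  have hT := isRestriction_trace (M := M)
  have hint : Integrable (fun x => Real.exp (trace M w x) - 1) (boundaryLength M) :=
    hT.integrable_exp_sub_one h2 hwε
  have h3 : ∫ x, h x * (Real.exp (trace M w x) - 1) ∂(boundaryLength M) ≤ H * (B * C) * √D := by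
    calc _ ≤ ∫ x, H * |Real.exp (trace M w x) - 1| ∂(boundaryLength M) := by
          refine (Real.le_norm_self _).trans ((norm_integral_le_of_norm_le (hint.abs.const_mul H)
            (.of_forall fun x => ?_)))
          rw [norm_mul]
          exact mul_le_mul_of_nonneg_right (hH x) (abs_nonneg _)
      _ ≤ H * (B * ‖w‖) := by
          rw [integral_const_mul]
          exact mul_le_mul_of_nonneg_left (hT.integral_abs_exp_sub_one_le h2 hB hwε) hH0
      _ ≤ H * (B * (C * √D)) := by
          have : ‖w‖ ≤ C * √D := by
            have := mul_nonneg hC hs0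
            linarith
          gcongr
      _ = _ := by ring
  have h4 : ∫ x, h x * Real.exp (trace M ((1 / 2 : ℝ) • u) x) ∂(boundaryLength M)
      = Real.exp (mean u / 2) * (∫ x, h x ∂(boundaryLength M)
        + ∫ x, h x * (Real.exp (trace M w x) - 1) ∂(boundaryLength M)) := by
    rw [← integral_add (integrable_of_continuous hh) (hint.bdd_mul hh.aestronglyMeasurable
      (.of_forall hH)), ← integral_const_mul]
    refine integral_congr_ae ?_
    have hdec : (1 / 2 : ℝ) • u = (mean u / 2) • oneH1 M + w := by
      rw [hw, smul_sub, smul_smul]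
      ring_nf
      abel
    rw [hdec, map_add]
    filter_upwards [Lp.coeFn_add (trace M ((mean u / 2) • oneH1 M)) (trace M w),
      hT.smul_oneH1 (mean u / 2)] with x hx hx2
    rw [hx, Pi.add_apply, hx2, Real.exp_add]
    ring
  have h5 : 0 ≤ ∫ x, 2 * |K x| * Real.exp (toL2 M u x) ∂(area M) :=
    integral_nonneg fun _ => by positivity
  rw [energy_eq hflat, h4]
  have h6 := mul_le_mul_of_nonneg_left (add_le_add_right h3 (∫ x, h x ∂(boundaryLength M)))
    (Real.exp_pos (mean u / 2)).le
  linarith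

theorem energy_smul_oneH1 (hflat : ∀ x : M, gaussianCurvature x = 0) (a : ℝ) :
    energy K h (a • oneH1 M) = Real.exp a * ∫ x, 2 * |K x| ∂(area M)
      - 4 * (Real.exp (a / 2) * ∫ x, h x ∂(boundaryLength M)) := by
  rw [energy_eq hflat, dirichletEnergy_smul_oneH1, mul_zero, zero_add, smul_smul,
    ← integral_const_mul (Real.exp a), ← integral_const_mul (Real.exp (a / 2))]
  refine congrArg₂ (· - ·) (integral_congr_ae ?_) (congrArg (4 * ·) (integral_congr_ae ?_))
  · filter_upwards [isRestriction_toL2.smul_oneH1 a] with x hx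
    rw [hx, mul_comm]
  · filter_upwards [isRestriction_trace.smul_oneH1 (1 / 2 * a)] with x hx
    rw [hx, mul_comm, one_div_mul_eq_div]

/-- Very negative constants lie in a region of `H¹` where the energy is positive, and on whose
frontier it exceeds the energy of the constant. Hence the energy has mountain-pass geometry as soon
as it takes a negative value. -/
theorem exists_mountain_pass [ConnectedSpace M] (hflat : ∀ x : M, gaussianCurvature x = 0)
    (hK : Continuous K) (hh : Continuous h) (hint : ∫ x, h x ∂(boundaryLength M) < 0)
    {u₁ : H1 M} (hu₁ : energy K h u₁ < 0) : ∃ u₀ : H1 M,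
      (∀ γ : Path u₀ u₁, ∃ t, ∀ s, energy K h (γ s) ≤ energy K h (γ t)) ∧
      max (energy K h u₀) (energy K h u₁) < minMaxLevel K h u₀ u₁ ∧
      0 < max (energy K h u₀) (energy K h u₁) := by
  obtain ⟨r, L, hr, hL, hlow⟩ := exists_energy_lower_bound (K := K) hflat hh
  have hcont := continuous_energy hflat hK hh
  set a := -∫ x, h x ∂(boundaryLength M) with ha
  have ha0 : 0 < a := by linarith
  have hlow' : ∀ u : H1 M, dirichletEnergy u ≤ r ^ 2 →
      1 / 2 * √(dirichletEnergy u) ^ 2 + 4 * (Real.exp (mean u / 2) * a)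
        - 4 * (Real.exp (mean u / 2) * (L * √(dirichletEnergy u))) ≤ energy K h u := by
    intro u hu
    have := hlow u hu
    rw [Real.sq_sqrt (dirichletEnergy_nonneg u)]
    rw [show ∫ x, h x ∂(boundaryLength M) = -a by rw [ha, neg_neg]] at this
    linarith
  -- `δ` is the bound for `e^(mean u / 2)` in the region
  set δ := min (a / (4 * (L ^ 2 + 1))) (r / (16 * (L + 1))) with hδ
  have hδ0 : 0 < δ := lt_min (by positivity) (by positivity)
  have hδ1 : δ * (4 * L ^ 2) ≤ a := by
    have h1 : δ * (4 * (L ^ 2 + 1)) ≤ a := by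
      rw [← le_div_iff₀ (by positivity)]
      exact min_le_left _ _
    linarith
  have hδ2 : δ * (16 * L) ≤ r := by
    have h1 : δ * (16 * (L + 1)) ≤ r := by
      rw [← le_div_iff₀ (by positivity)]
      exact min_le_right _ _
    linarith
  set b := min (2 * δ * a) (r ^ 2 / 4) with hb
  have hb0 : 0 < b := lt_min (by positivity) (by positivity)
  have hmean : ∀ u : H1 M, dirichletEnergy u ≤ r ^ 2 → Real.exp (mean u / 2) ≤ δ →
      2 * Real.exp (mean u / 2) * a ≤ energy K h u := by
    intro u hu hm
    refine le_trans ?_ (hlow' u hu)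
    have hy := Real.exp_pos (mean u / 2)
    set y := Real.exp (mean u / 2)
    set x := √(dirichletEnergy u)
    have h1 : y * (4 * L ^ 2) ≤ a := (mul_le_mul_of_nonneg_right hm (by positivity)).trans hδ1
    have h2 := mul_le_mul_of_nonneg_left h1 hy.le
    nlinarith [sq_nonneg (x - 4 * y * L)]
  let Q : H1 M → ℝ := fun u => max (dirichletEnergy u / r ^ 2) (Real.exp (mean u / 2) / δ)
  have hQ : Continuous Q :=
    (continuous_dirichletEnergy.div_const _).max
      ((Real.continuous_exp.comp (continuous_mean.div_const 2)).div_const _)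
  have hQ1 : ∀ u, Q u ≤ 1 → dirichletEnergy u ≤ r ^ 2 ∧ Real.exp (mean u / 2) ≤ δ := by
    intro u hu
    obtain ⟨h1, h2⟩ := max_le_iff.1 hu
    rw [div_le_one (by positivity)] at h1
    rw [div_le_one hδ0] at h2
    exact ⟨h1, h2⟩
  have hfrontier : ∀ u, Q u = 1 → b ≤ energy K h u := by
    intro u hu
    obtain ⟨h1, h2⟩ := hQ1 u hu.le
    rcases max_choice (dirichletEnergy u / r ^ 2) (Real.exp (mean u / 2) / δ) with h3 | h3
    · have h4 : dirichletEnergy u = r ^ 2 := by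
        have : dirichletEnergy u / r ^ 2 = 1 := h3.symm.trans hu
        rwa [div_eq_one_iff_eq (by positivity)] at this
      refine (min_le_right _ _).trans (le_trans ?_ (hlow' u h1))
      rw [h4, Real.sqrt_sq hr.le]
      have h5 : Real.exp (mean u / 2) * (L * r) ≤ δ * (L * r) := by gcongr
      have h6 : δ * (16 * L) * r ≤ r * r := mul_le_mul_of_nonneg_right hδ2 hr.le
      have h7 := mul_pos (Real.exp_pos (mean u / 2)) ha0
      nlinarith
    · have h4 : Real.exp (mean u / 2) = δ := by
        have : Real.exp (mean u / 2) / δ = 1 := h3.symm.trans hu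
        rwa [div_eq_one_iff_eq hδ0.ne'] at this
      have h5 := hmean u h1 h2
      rw [h4] at h5
      exact (min_le_left _ _).trans h5
  set k := ∫ x, 2 * |K x| ∂(area M) with hk
  have hk0 : 0 ≤ k := integral_nonneg fun _ => by positivity
  -- the constant `2 log y` has energy `k y² + 4 a y`, which is less than `b` for small `y`
  set y := min (δ / 2) (min 1 (b / (2 * (k + 4 * a)))) with hy
  have hy0 : 0 < y := lt_min (by positivity) (lt_min one_pos (by positivity))
  have hy1 : y ≤ 1 := (min_le_right _ _).trans (min_le_left _ _)
  have hy2 : y * (k + 4 * a) < b := by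
    have h1 : y ≤ b / (2 * (k + 4 * a)) := (min_le_right _ _).trans (min_le_right _ _)
    rw [le_div_iff₀ (by positivity)] at h1
    linarith
  have hy3 : y < δ := (min_le_left _ _).trans_lt (half_lt_self hδ0)
  have he2 : Real.exp (2 * Real.log y / 2) = y := by
    rw [mul_div_cancel_left₀ _ two_ne_zero, Real.exp_log hy0]
  have he1 : Real.exp (2 * Real.log y) = y ^ 2 := by
    rw [two_mul, Real.exp_add, Real.exp_log hy0, sq]
  set u₀ : H1 M := (2 * Real.log y) • oneH1 M with hu₀
  have hE0 : energy K h u₀ = y ^ 2 * k + 4 * (y * a) := by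
    rw [hu₀, energy_smul_oneH1 hflat, he1, he2, ha]
    ring
  have hE0pos : 0 < energy K h u₀ := by
    rw [hE0]
    positivity
  have hE0b : energy K h u₀ < b := by
    rw [hE0]
    have h1 : y ^ 2 * k ≤ y * k := mul_le_mul_of_nonneg_right (by nlinarith) hk0
    linarith
  have hQ0 : Q u₀ ≤ 1 := by
    refine max_le ?_ ?_
    · rw [hu₀, dirichletEnergy_smul_oneH1, zero_div]
      exact zero_le_one
    · rw [hu₀, mean_smul_oneH1, he2, div_le_one hδ0]
      exact hy3.le
  have hQu₁ : 1 ≤ Q u₁ := by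
    by_contra hlt
    obtain ⟨h1, h2⟩ := hQ1 u₁ (not_le.1 hlt).le
    have h3 := hmean u₁ h1 h2
    have := mul_pos (mul_pos two_pos (Real.exp_pos (mean u₁ / 2))) ha0
    linarith
  have hmax : max (energy K h u₀) (energy K h u₁) = energy K h u₀ :=
    max_eq_left (hu₁.le.trans hE0pos.le)
  refine ⟨u₀, fun γ => ?_, ?_, ?_⟩
  · obtain ⟨t, -, ht⟩ := isCompact_univ.exists_isMaxOn univ_nonempty
      (hcont.comp γ.continuous).continuousOn
    exact ⟨t, fun s => ht (mem_univ s)⟩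
  · rw [hmax]
    refine hE0b.trans_le ?_
    have : Nonempty (Path u₀ u₁) := ⟨(PathConnectedSpace.somePath u₀ u₁)⟩
    refine le_ciInf fun γ => ?_
    obtain ⟨t, ht⟩ := mem_range_of_exists_le_of_exists_ge (hQ.comp γ.continuous)
      (c := 1) ⟨0, by simpa using hQ0⟩ ⟨1, by simpa using hQu₁⟩
    refine (hfrontier _ ht).trans (le_ciSup (f := fun t => energy K h (γ t)) ?_ t)
    exact (isCompact_range (hcont.comp γ.continuous)).bddAbove
  · rw [hmax]
    exact hE0pos

end MountainPass

/-! ### The one-dimensional integral behind the concentration of the energy -/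

section OneDimensional

theorem lintegral_inv_sq_le {a m r : ℝ} (ha : 0 < a) (hm : 0 < m) (hr : 0 < r) :
    ∫⁻ s in Ioo 0 r, ENNReal.ofReal (1 / (a * s + m) ^ 2) ≤ ENNReal.ofReal (1 / a * (1 / m)) := by
  have hpos : ∀ s, 0 ≤ s → 0 < a * s + m := fun s hs => by positivity
  have hcont : ContinuousOn (fun s => 1 / (a * s + m) ^ 2) (Icc 0 r) := by
    refine ContinuousOn.div continuousOn_const (by fun_prop) fun s hs => ?_
    exact (pow_pos (hpos s hs.1) 2).ne'
  have hint : IntegrableOn (fun s => 1 / (a * s + m) ^ 2) (Ioo 0 r) :=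
    (hcont.integrableOn_Icc).mono_set Ioo_subset_Icc_self
  rw [← ofReal_integral_eq_lintegral_ofReal hint (.of_forall fun s => by positivity)]
  refine ENNReal.ofReal_le_ofReal ?_
  have hderiv : ∀ s ∈ uIcc 0 r, HasDerivAt (fun s => -(1 / a * (1 / (a * s + m))))
      (1 / (a * s + m) ^ 2) s := fun s hs => by
    rw [uIcc_of_le hr.le] at hs
    have h1 := (hpos s hs.1).ne'
    have h2 := (((hasDerivAt_id s).const_mul a).add_const m).inv h1
    have h3 := (h2.const_mul (1 / a)).neg
    convert! h3 using 1
    · funext z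
      simp
    · simp only [id]
      field_simp
  have hii : IntervalIntegrable (fun s => 1 / (a * s + m) ^ 2) volume 0 r := by
    refine ContinuousOn.intervalIntegrable ?_
    rwa [uIcc_of_le hr.le]
  rw [← integral_Ioc_eq_integral_Ioo, ← intervalIntegral.integral_of_le hr.le,
    intervalIntegral.integral_eq_sub_of_hasDerivAt hderiv hii]
  have h1 : 0 < 1 / a * (1 / (a * r + m)) := by
    have := hpos r hr.le
    positivity
  simp only [mul_zero, zero_add]
  linarith

end OneDimensional

/-! ### Peak functions at a boundary point -/

section Unbounded

variable {M : Type*} [TopologicalSpace M] [ChartedSpace (EuclideanHalfSpace 2) M]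
  [IsManifold (𝓡∂ 2) ∞ M]
  [RiemannianBundle (fun x : M ↦ TangentSpace (𝓡∂ 2) x)]
  [IsContMDiffRiemannianBundle (𝓡∂ 2) ∞ Plane (fun x : M ↦ TangentSpace (𝓡∂ 2) x)]
  [MeasurableSpace M] [BorelSpace M] [CompactSpace M]

variable {K h : M → ℝ}

theorem energy_toH1 (hflat : ∀ x : M, gaussianCurvature x = 0) (φ : SmoothFunction M) :
    energy K h (toH1 M φ) = 1 / 2 * ∫ x, ‖grad φ x‖ ^ 2 ∂(area M)
      + ∫ x, 2 * |K x| * Real.exp (φ x) ∂(area M)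
      - 4 * ∫ x, h x * Real.exp (φ x / 2) ∂(boundaryLength M) := by
  rw [energy_eq hflat, dirichletEnergy_toH1]
  refine congrArg₂ (· - ·) (congrArg₂ (· + ·) rfl (integral_congr_ae ?_))
    (congrArg (fun z : ℝ => 4 * z) (integral_congr_ae ?_))
  · filter_upwards [isRestriction_toL2 φ] with x hx
    rw [hx]
  · rw [map_smul]
    filter_upwards [Lp.coeFn_smul (1 / 2 : ℝ) (trace M (toH1 M φ)), isRestriction_trace φ]
      with x hx hx2
    rw [hx, Pi.smul_apply, hx2, smul_eq_mul, one_div_mul_eq_div]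

theorem contMDiffOn_coord (c : M) (i : Fin 2) : ContMDiffOn (𝓡∂ 2) 𝓘(ℝ, ℝ) ∞ (coord c i)
    (chartAt (EuclideanHalfSpace 2) c).source :=
  ((EuclideanSpace.proj (𝕜 := ℝ) i : Plane →L[ℝ] ℝ).contDiff.contMDiff).comp_contMDiffOn
    (contMDiffOn_extChartAt (I := 𝓡∂ 2))

theorem lengthDensity_pos (c : M) {x : M}
    (hx : x ∈ (chartAt (EuclideanHalfSpace 2) c).source) : 0 < lengthDensity c x := by
  refine Real.sqrt_pos.2 (real_inner_self_pos.2 fun h0 => ?_)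
  have := (coordField_combination_eq_zero c hx (a := 0) (b := 1) (by simp [h0])).2
  norm_num at this

/-- If a smooth function is given near a point `p` by `a y₀ + (y₁ - q)²` in the
chart centred at `p`, then the norm of its gradient at `p` is `a √g₁₁ / √(det g)`. -/
theorem norm_grad_sq_of_eventuallyEq {p : M} {u : M → ℝ}
    (hu : ContMDiff (𝓡∂ 2) 𝓘(ℝ, ℝ) ∞ u) {a : ℝ}
    (hev : u =ᶠ[𝓝 p] fun x => a * coord p 0 x + (coord p 1 x - coord p 1 p) ^ 2) :
    ‖grad u p‖ ^ 2 = (a * lengthDensity p p / areaDensity p p) ^ 2 := by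
  have hp := mem_chart_source (EuclideanHalfSpace 2) p
  have hpt := mem_extChartAt_target (I := 𝓡∂ 2) p
  obtain ⟨L, hL, hi⟩ := exists_hasFDerivWithinAt hu p hpt
  rw [extChartAt_to_inv] at hi
  set q := coord p 1 p with hq
  set y0 := extChartAt (𝓡∂ 2) p p with hy0
  have hev2 : (fun y => u ((extChartAt (𝓡∂ 2) p).symm y)) =ᶠ[𝓝[range (𝓡∂ 2)] y0]
      fun y => a * y 0 + (y 1 - q) ^ 2 := by
    have h1 : {x | u x = a * coord p 0 x + (coord p 1 x - q) ^ 2} ∈ 𝓝 p := hev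
    have h2 := extChartAt_preimage_mem_nhdsWithin (I := 𝓡∂ 2) (s := univ) (x := p)
      (mem_nhdsWithin_of_mem_nhds h1)
    simp only [preimage_univ, univ_inter] at h2
    filter_upwards [h2, extChartAt_target_mem_nhdsWithin (I := 𝓡∂ 2) p] with y hy hyt
    simp only [mem_preimage, mem_ofPred_eq, coord, (extChartAt (𝓡∂ 2) p).right_inv hyt] at hy
    exact hy
  have hpr : ∀ i : Fin 2, HasFDerivAt (fun y : Plane => y i)
      (EuclideanSpace.proj (𝕜 := ℝ) i : Plane →L[ℝ] ℝ) y0 := fun i =>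
    (EuclideanSpace.proj (𝕜 := ℝ) i : Plane →L[ℝ] ℝ).hasFDerivAt
  have hL' := ((hpr 0).const_mul a).add (((hpr 1).sub_const q).pow 2)
  have heq := ((𝓡∂ 2).uniqueDiffOn y0 (extChartAt_target_subset_range p hpt)).eq
    (HasFDerivWithinAt.congr_of_eventuallyEq hL'.hasFDerivWithinAt hev2
      (hev2.eq_of_nhdsWithin (extChartAt_target_subset_range p hpt))) hL
  have hq0 : y0 1 - q = 0 := sub_self _
  have d0 : coordDeriv u p 0 p = a := by
    rw [← hi 0, ← heq]
    simp [hq0]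
  have d1 : coordDeriv u p 1 p = 0 := by
    rw [← hi 1, ← heq]
    simp [hq0]
  have hG := inner_grad_eq u u p hp
  rw [real_inner_self_eq_norm_sq] at hG
  simp only [coordDeriv] at d0 d1
  have h11 : 0 ≤ metricCoeff p 1 1 p := real_inner_self_nonneg
  rw [hG, d0, d1, div_pow, mul_pow, areaDensity, lengthDensity,
    Real.sq_sqrt (gramDet_pos p hp).le, Real.sq_sqrt h11]
  ring

variable [T2Space M]

/-- A nonnegative smooth function which near `p` is `a y₀ + (y₁ - q)²` in the chart centred at `p`
and which, if `p` lies on the boundary, vanishes only there. -/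
theorem exists_peak_function (p : M) {a : ℝ} (ha : 0 < a) :
    ∃ u : M → ℝ, ContMDiff (𝓡∂ 2) 𝓘(ℝ, ℝ) ∞ u ∧
      (u =ᶠ[𝓝 p] fun x => a * coord p 0 x + (coord p 1 x - coord p 1 p) ^ 2) ∧
      (∀ x, 0 ≤ u x) ∧ ∀ x, x ≠ p → coord p 0 p = 0 → 0 < u x := by
  let f : SmoothBumpFunction (𝓡∂ 2) p := Classical.arbitrary _
  let s0 : M → ℝ := fun x => a * coord p 0 x + (coord p 1 x - coord p 1 p) ^ 2
  have hs0 : ContMDiffOn (𝓡∂ 2) 𝓘(ℝ, ℝ) ∞ (fun x => s0 x - 1)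
      (chartAt (EuclideanHalfSpace 2) p).source := by
    have h1 : ContDiff ℝ ∞ fun z : ℝ × ℝ => a * z.1 + (z.2 - coord p 1 p) ^ 2 - 1 := by fun_prop
    exact h1.contMDiff.comp_contMDiffOn
      ((contMDiffOn_coord p 0).prodMk_space (contMDiffOn_coord p 1))
  have hs0n : ∀ x ∈ (chartAt (EuclideanHalfSpace 2) p).source, 0 ≤ s0 x := fun x hx => by
    have := coord_nonneg p hx
    positivity
  have hf0 : ∀ x ∉ (chartAt (EuclideanHalfSpace 2) p).source, f x = 0 := fun x hx => by
    by_contra h0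
    exact hx (f.support_subset_source h0)
  refine ⟨fun x => f x • (s0 x - 1) + 1, (f.contMDiff_smul hs0).add contMDiff_const, ?_,
    fun x => ?_, fun x hx hp0 => ?_⟩
  · filter_upwards [f.eventuallyEq_one] with x hx
    rw [hx]
    simp [s0]
  · change 0 ≤ f x * (s0 x - 1) + 1
    by_cases hx : x ∈ (chartAt (EuclideanHalfSpace 2) p).source
    · have h1 := hs0n x hx
      have h2 := f.nonneg (x := x)
      have h3 := f.le_one (x := x)
      nlinarith [mul_nonneg h2 h1]
    · rw [hf0 x hx]
      simp
  · change 0 < f x * (s0 x - 1) + 1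
    by_cases hxs : x ∈ (chartAt (EuclideanHalfSpace 2) p).source
    · have h1 : 0 < s0 x := by
        refine lt_of_le_of_ne (hs0n x hxs) fun h0 => hx ?_
        have h2 := coord_nonneg p hxs
        have h3 : s0 x = a * coord p 0 x + (coord p 1 x - coord p 1 p) ^ 2 := rfl
        have h4 : coord p 0 x = 0 := by nlinarith [sq_nonneg (coord p 1 x - coord p 1 p)]
        have h5 : coord p 1 x = coord p 1 p := by
          have : (coord p 1 x - coord p 1 p) ^ 2 = 0 := by
            rw [h4, mul_zero, zero_add] at h3
            rw [← h3, ← h0]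
          exact sub_eq_zero.1 (pow_eq_zero_iff two_ne_zero |>.1 this)
        rw [← chartPt_coord p hxs, h4, h5, ← hp0, chartPt_coord p (mem_chart_source _ p)]
      have h2 := f.nonneg (x := x)
      have h3 := f.le_one (x := x)
      rcases h3.lt_or_eq with h4 | h4
      · nlinarith [mul_nonneg h2 h1.le]
      · rw [h4]
        linarith
    · rw [hf0 x hxs]
      simp

/-- The function `-2 log (s + δ)`, for `s ≥ 0` smooth. -/
theorem contMDiff_neg_two_log {s : M → ℝ} (hs : ContMDiff (𝓡∂ 2) 𝓘(ℝ, ℝ) ∞ s)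
    (hs0 : ∀ x, 0 ≤ s x) {δ : ℝ} (hδ : 0 < δ) :
    ContMDiff (𝓡∂ 2) 𝓘(ℝ, ℝ) ∞ fun x => -2 * Real.log (s x + δ) := by
  intro x
  have h1 : ContDiffAt ℝ ∞ (fun z => -2 * Real.log (z + δ)) (s x) :=
    contDiffAt_const.mul ((contDiffAt_id.add contDiffAt_const).log
      (add_pos_of_nonneg_of_pos (hs0 x) hδ).ne')
  exact h1.contMDiffAt.comp x (hs x)

/-- The energy of the test function `-2 log (s + δ)`. -/
theorem energy_neg_two_log (hflat : ∀ x : M, gaussianCurvature x = 0) (hK : Continuous K)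
    {s : M → ℝ} (hs : ContMDiff (𝓡∂ 2) 𝓘(ℝ, ℝ) ∞ s) (hs0 : ∀ x, 0 ≤ s x) {δ : ℝ} (hδ : 0 < δ) :
    energy K h (toH1 M (SmoothFunction.mk _ (contMDiff_neg_two_log hs hs0 hδ)))
      = 2 * ∫ x, (‖grad s x‖ ^ 2 + |K x|) * (1 / (s x + δ) ^ 2) ∂(area M)
        - 4 * ∫ x, h x * (1 / (s x + δ)) ∂(boundaryLength M) := by
  have hpos : ∀ x, 0 < s x + δ := fun x => add_pos_of_nonneg_of_pos (hs0 x) hδ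
  have hc : Continuous fun x => 1 / (s x + δ) ^ 2 :=
    continuous_const.div ((hs.continuous.add continuous_const).pow 2) fun x =>
      (pow_pos (hpos x) 2).ne'
  have hg : ∀ x, ‖grad (SmoothFunction.mk _ (contMDiff_neg_two_log hs hs0 hδ)) x‖ ^ 2
      = 4 * (‖grad s x‖ ^ 2 * (1 / (s x + δ) ^ 2)) := fun x => by
    have h1 : HasDerivAt (fun z => -2 * Real.log (z + δ)) (-2 * (1 / (s x + δ))) (s x) :=
      (((hasDerivAt_id (s x)).add_const δ).log (hpos x).ne').const_mul (-2)
    have h2 := norm_grad_comp hs h1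
    have h3 : ‖grad (SmoothFunction.mk _ (contMDiff_neg_two_log hs hs0 hδ)) x‖
      = |-2 * (1 / (s x + δ))| * ‖grad s x‖ := h2
    rw [h3, mul_pow, sq_abs, mul_pow, one_div_pow]
    ring
  have he : ∀ x, Real.exp (-2 * Real.log (s x + δ)) = 1 / (s x + δ) ^ 2 := fun x => by
    rw [neg_mul, Real.exp_neg, two_mul, Real.exp_add, Real.exp_log (hpos x), one_div, sq]
  have he2 : ∀ x, Real.exp (-2 * Real.log (s x + δ) / 2) = 1 / (s x + δ) := fun x => by
    rw [show -2 * Real.log (s x + δ) / 2 = -Real.log (s x + δ) by ring, Real.exp_neg,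
      Real.exp_log (hpos x), one_div]
  rw [energy_toH1 hflat]
  simp only [hg, SmoothFunction.mk_apply, he, he2]
  rw [integral_const_mul]
  simp only [add_mul, mul_assoc]
  rw [integral_const_mul, integral_add (f := fun x => ‖grad s x‖ ^ 2 * (1 / (s x + δ) ^ 2))
    (g := fun x => |K x| * (1 / (s x + δ) ^ 2))
    (integrable_of_continuous (((continuous_norm_grad hs).pow 2).mul hc))
    (integrable_of_continuous (hK.abs.mul hc))]
  ring

end Unbounded

/-! ### Concentration at a boundary point -/

section Concentration

variable {M : Type*} [TopologicalSpace M] [ChartedSpace (EuclideanHalfSpace 2) M]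
  [IsManifold (𝓡∂ 2) ∞ M]
  [RiemannianBundle (fun x : M ↦ TangentSpace (𝓡∂ 2) x)]
  [IsContMDiffRiemannianBundle (𝓡∂ 2) ∞ Plane (fun x : M ↦ TangentSpace (𝓡∂ 2) x)]
  [MeasurableSpace M] [BorelSpace M]

/-- The integral of `1 / ((t - q)² + δ)` over the second coordinate of a box around `p`, where `q`
is the second coordinate of `p`. -/
def poissonIntegral (p : M) (r δ : ℝ) : ℝ≥0∞ :=
  ∫⁻ t in rangeOne p r, ENNReal.ofReal (1 / ((t - coord p 1 p) ^ 2 + δ))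

theorem le_poissonIntegral {p : M} {r ρ : ℝ} (hρ : 0 < ρ) (hr : ρ ≤ r) :
    ENNReal.ofReal (1 / ρ) ≤ poissonIntegral p r (ρ ^ 2) := by
  calc ENNReal.ofReal (1 / ρ)
      = ∫⁻ _ in rangeOne p ρ, ENNReal.ofReal (1 / (ρ ^ 2 + ρ ^ 2)) := by
        rw [setLIntegral_const, rangeOne, Real.volume_Ioo, ← ENNReal.ofReal_mul (by positivity)]
        congr 1
        field_simp
        ring
    _ ≤ ∫⁻ t in rangeOne p ρ, ENNReal.ofReal (1 / ((t - coord p 1 p) ^ 2 + ρ ^ 2)) := by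
        refine setLIntegral_mono' measurableSet_Ioo fun t ht => ENNReal.ofReal_le_ofReal ?_
        have h1 : (t - coord p 1 p) ^ 2 ≤ ρ ^ 2 :=
          sq_le_sq.2 ((mem_rangeOne.1 ht).le.trans (le_abs_self ρ))
        exact one_div_le_one_div_of_le (by positivity) (by linarith)
    _ ≤ _ := lintegral_mono_set (Ioo_subset_Ioo (by linarith) (by linarith))

theorem poissonIntegral_ne_top {p : M} {r δ : ℝ} (hδ : 0 < δ) : poissonIntegral p r δ ≠ ⊤ := by
  refine ne_top_of_le_ne_top (b := ∫⁻ _ in rangeOne p r, ENNReal.ofReal (1 / δ)) ?_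
    (lintegral_mono fun t => ENNReal.ofReal_le_ofReal
      (one_div_le_one_div_of_le hδ (le_add_of_nonneg_left (sq_nonneg _))))
  rw [setLIntegral_const, rangeOne, Real.volume_Ioo]
  finiteness

variable {p : M} {r a : ℝ} {s : M → ℝ}

theorem lintegral_area_peak_le (hb : IsBox p r) (hp : coord p 0 p = 0) (ha : 0 < a)
    (hs : Continuous s)
    (hsb : ∀ x ∈ box p r, s x = a * coord p 0 x + (coord p 1 x - coord p 1 p) ^ 2) {D : ℝ}
    (hD : ∀ x ∈ box p r, areaDensity p x ≤ D) {δ : ℝ} (hδ : 0 < δ) :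
    ∫⁻ x in box p r, ENNReal.ofReal (1 / (s x + δ) ^ 2) ∂(area M)
      ≤ ENNReal.ofReal (D / a) * poissonIntegral p r δ := by
  have hm : Measurable fun x => ENNReal.ofReal (1 / (s x + δ) ^ 2) := by
    have := hs.measurable
    fun_prop
  have hD0 : 0 ≤ D := (Real.sqrt_nonneg _).trans (hD p (mem_box_self p hb.pos))
  have hrange : rangeZero p r = Ioo 0 r := by
    rw [rangeZero, hp, zero_sub, zero_add, max_eq_left (by linarith [hb.pos])]
  have hmp : ∀ t, 0 < (t - coord p 1 p) ^ 2 + δ := fun t => by positivity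
  let H : ℝ → ℝ → ℝ≥0∞ := fun σ t =>
    ENNReal.ofReal (1 / (a * σ + ((t - coord p 1 p) ^ 2 + δ)) ^ 2)
  have hH : Measurable (Function.uncurry H) := by
    unfold H
    fun_prop
  rw [setLIntegral_area_box hb hm]
  calc _ ≤ ∫⁻ σ in rangeZero p r, ∫⁻ t in rangeOne p r, H σ t * ENNReal.ofReal D := by
        refine setLIntegral_mono' measurableSet_Ioo fun σ hσ =>
          setLIntegral_mono' measurableSet_Ioo fun t ht => ?_
        have h1 := hb.chartPt_mem_box hσ ht
        have h2 := hb.planePt_mem_target hσ ht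
        rw [hsb _ h1, coord_zero_chartPt h2, coord_one_chartPt h2, add_assoc]
        exact mul_le_mul_right (ENNReal.ofReal_le_ofReal (hD _ h1)) _
    _ = (∫⁻ t in rangeOne p r, ∫⁻ σ in Ioo 0 r, H σ t) * ENNReal.ofReal D := by
        simp_rw [lintegral_mul_const' _ _ ENNReal.ofReal_ne_top]
        rw [lintegral_lintegral_swap hH.aemeasurable, hrange]
    _ ≤ (∫⁻ t in rangeOne p r, ENNReal.ofReal (1 / a) *
          ENNReal.ofReal (1 / ((t - coord p 1 p) ^ 2 + δ))) * ENNReal.ofReal D := by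
        refine mul_le_mul_left (lintegral_mono fun t => ?_) _
        rw [← ENNReal.ofReal_mul (by positivity)]
        exact lintegral_inv_sq_le ha (hmp t) hb.pos
    _ = _ := by
        rw [lintegral_const_mul' _ _ ENNReal.ofReal_ne_top, div_eq_mul_one_div D a,
          ENNReal.ofReal_mul hD0, poissonIntegral]
        ring

theorem le_lintegral_boundaryLength_peak (hb : IsBox p r) (hp : coord p 0 p = 0)
    (hs : Continuous s)
    (hsb : ∀ x ∈ box p r, s x = a * coord p 0 x + (coord p 1 x - coord p 1 p) ^ 2) {l : ℝ}
    (hl : ∀ x ∈ box p r, l ≤ lengthDensity p x) {δ : ℝ} :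
    ENNReal.ofReal l * poissonIntegral p r δ
      ≤ ∫⁻ x in box p r, ENNReal.ofReal (1 / (s x + δ)) ∂(boundaryLength M) := by
  have hm : Measurable fun x => ENNReal.ofReal (1 / (s x + δ)) := by
    have := hs.measurable
    fun_prop
  rw [setLIntegral_boundaryLength_box hb hm, if_pos (by rw [hp]; exact hb.pos), poissonIntegral,
    ← lintegral_const_mul' _ _ ENNReal.ofReal_ne_top]
  refine setLIntegral_mono' measurableSet_Ioo fun t ht => ?_
  have h0 : |0 - coord p 0 p| < r := by
    rw [hp, sub_zero, abs_zero]
    exact hb.pos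
  have h1 := hb.chartPt_mem le_rfl h0 (mem_rangeOne.1 ht)
  have h2 := hb.mem_target 0 t le_rfl h0 (mem_rangeOne.1 ht)
  rw [hsb _ h1, coord_zero_chartPt h2, coord_one_chartPt h2, mul_zero, zero_add, mul_comm]
  exact mul_le_mul_right (ENNReal.ofReal_le_ofReal (hl _ h1)) _

variable [CompactSpace M] [T2Space M] {K h : M → ℝ}

/-- The energy of the functions `-2 log (s + δ)` tends to `-∞` as `δ → 0`, where `s ≥ 0` vanishes
only at the boundary point `p`, where its gradient has norm `√|K|`. Indeed, near `p` both the
integral over the surface and the one over the boundary are asymptotic to multiples of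
`∫ dt / (t² + δ)`, and the sum of the coefficients is negative if `h > √|K|` at `p`. -/
theorem exists_energy_lt (hflat : ∀ x : M, gaussianCurvature x = 0) (hK : Continuous K)
    (hh : Continuous h) {p : M} (hp : p ∈ (𝓡∂ 2).boundary M) (hKp : K p ≠ 0)
    (hhp : √|K p| < h p) (R : ℝ) : ∃ u : H1 M, energy K h u < R := by
  have hsrc := mem_chart_source (EuclideanHalfSpace 2) p
  have hp0 : coord p 0 p = 0 := (isBoundaryPoint_iff_coord p hsrc).1 hp
  set k := √|K p| with hk
  have hk0 : 0 < k := Real.sqrt_pos.2 (abs_pos.2 hKp)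
  have hk2 : |K p| = k ^ 2 := (Real.sq_sqrt (abs_nonneg _)).symm
  set d := areaDensity p p with hd
  set l := lengthDensity p p with hl
  have hd0 : 0 < d := areaDensity_pos p hsrc
  have hl0 : 0 < l := lengthDensity_pos p hsrc
  -- with this slope, the gradient of the peak function at `p` has norm `k`
  set a := k * d / l with ha
  have ha0 : 0 < a := by positivity
  obtain ⟨s, hs, hsev, hs0, hspos⟩ := exists_peak_function p ha0
  have hgrad : ‖grad s p‖ ^ 2 = k ^ 2 := by
    rw [norm_grad_sq_of_eventuallyEq hs hsev, ← hd, ← hl, ha]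
    congr 1
    field_simp
  -- the coefficient of `∫ dt / (t² + δ)` up to an error `η` in all the quantities near `p`
  have hη : ∃ η : ℝ, 0 < η ∧ η < h p ∧
      0 < (h p - η) * (l - η) - (k ^ 2 + η) * ((d + η) / a) := by
    have hc : ContinuousAt (fun η : ℝ => (h p - η) * (l - η) - (k ^ 2 + η) * ((d + η) / a)) 0 := by
      fun_prop
    have h0 : 0 < (h p - 0) * (l - 0) - (k ^ 2 + 0) * ((d + 0) / a) := by
      have h1 : (k ^ 2 + 0) * ((d + 0) / a) = k * l := by
        rw [ha]
        field_simp
        ring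
      rw [h1]
      nlinarith
    have hev : ∀ᶠ η in 𝓝[>] (0 : ℝ), 0 < (h p - η) * (l - η) - (k ^ 2 + η) * ((d + η) / a) :=
      (hc.eventually_const_lt h0).filter_mono nhdsWithin_le_nhds
    have hev2 : ∀ᶠ η in 𝓝[>] (0 : ℝ), η < h p :=
      (gt_mem_nhds (hk0.trans hhp)).filter_mono nhdsWithin_le_nhds
    obtain ⟨η, ⟨h1, h2⟩, h3⟩ := ((hev.and hev2).and self_mem_nhdsWithin).exists
    exact ⟨η, h3, h2, h1⟩
  obtain ⟨η, hη0, hηh, hκ⟩ := hη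
  set κ := (h p - η) * (l - η) - (k ^ 2 + η) * ((d + η) / a) with hκdef
  have hnhds := (chartAt (EuclideanHalfSpace 2) p).open_source.mem_nhds hsrc
  have e1 : ∀ᶠ x in 𝓝 p, ‖grad s x‖ ^ 2 < k ^ 2 + η :=
    ((continuous_norm_grad hs).pow 2).continuousAt.eventually_lt_const (by
      simp only [Pi.pow_apply]
      rw [hgrad]
      linarith)
  have e2 : ∀ᶠ x in 𝓝 p, |K x| < k ^ 2 + η :=
    hK.abs.continuousAt.eventually_lt_const (by simp only [hk2]; linarith)
  have e3 : ∀ᶠ x in 𝓝 p, areaDensity p x < d + η :=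
    ((continuousOn_areaDensity p).continuousAt hnhds).eventually_lt_const (by linarith)
  have e4 : ∀ᶠ x in 𝓝 p, l - η < lengthDensity p x :=
    ((continuousOn_lengthDensity p).continuousAt hnhds).eventually_const_lt (by linarith)
  have e5 : ∀ᶠ x in 𝓝 p, h p - η < h x :=
    hh.continuousAt.eventually_const_lt (by linarith)
  obtain ⟨r, hb, hsub⟩ := exists_isBox p
    (inter_mem hsev (inter_mem e1 (inter_mem e2 (inter_mem e3 (inter_mem e4 e5)))))
  have hsb : ∀ x ∈ box p r, s x = a * coord p 0 x + (coord p 1 x - coord p 1 p) ^ 2 :=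
    fun x hx => (hsub hx).1
  have hU := (isOpen_box p r).measurableSet
  obtain ⟨s₁, hs₁, hout⟩ : ∃ s₁, 0 < s₁ ∧ ∀ x ∈ (box p r)ᶜ, s₁ ≤ s x := by
    refine (isOpen_box p r).isClosed_compl.isCompact.exists_forall_le' hs.continuous.continuousOn
      fun x hx => hspos x (fun h0 => hx ?_) hp0
    rw [h0]
    exact mem_box_self p hb.pos
  obtain ⟨P, hP0, hP⟩ := exists_abs_le_of_continuous
    (((continuous_norm_grad hs).pow 2).add hK.abs)
  obtain ⟨H, hH0, hH⟩ := exists_abs_le_of_continuous hh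
  set C := 2 * (P * (1 / s₁ ^ 2) * (area M).real univ)
    + 4 * (H * (1 / s₁) * (boundaryLength M).real univ) with hC
  -- choose `ρ` so small that `C - 4 κ / ρ < R`
  obtain ⟨ρ, hρ0, hρr, hρR⟩ : ∃ ρ : ℝ, 0 < ρ ∧ ρ ≤ r ∧ C - 4 * κ * (1 / ρ) < R := by
    have ht : Tendsto (fun ρ : ℝ => 4 * κ * (1 / ρ)) (𝓝[>] 0) atTop := by
      simp only [one_div]
      exact tendsto_inv_nhdsGT_zero.const_mul_atTop (by positivity)
    have hr' : ∀ᶠ ρ in 𝓝[>] (0 : ℝ), ρ < r := (gt_mem_nhds hb.pos).filter_mono nhdsWithin_le_nhds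
    obtain ⟨ρ, ⟨h1, h2⟩, h3⟩ := ((ht.eventually_gt_atTop (C - R)).and hr' |>.and
      self_mem_nhdsWithin).exists
    exact ⟨ρ, h3, h2.le, by linarith⟩
  set δ := ρ ^ 2 with hδ
  have hδ0 : 0 < δ := by positivity
  refine ⟨_, lt_of_le_of_lt (energy_neg_two_log (h := h) hflat hK hs hs0 hδ0).le ?_⟩
  have hpos : ∀ x, 0 < s x + δ := fun x => add_pos_of_nonneg_of_pos (hs0 x) hδ0
  have hc1 : Continuous fun x => 1 / (s x + δ) :=
    continuous_const.div (hs.continuous.add continuous_const) fun x => (hpos x).ne'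
  have hc2 : Continuous fun x => 1 / (s x + δ) ^ 2 :=
    continuous_const.div ((hs.continuous.add continuous_const).pow 2) fun x =>
      (pow_pos (hpos x) 2).ne'
  set J := (poissonIntegral p r δ).toReal with hJ
  have hJtop := poissonIntegral_ne_top (p := p) (r := r) hδ0
  have hJle : 1 / ρ ≤ J := by
    rw [hJ, ← ENNReal.ofReal_le_iff_le_toReal hJtop]
    exact le_poissonIntegral hρ0 hρr
  set A := ∫ x in box p r, 1 / (s x + δ) ^ 2 ∂(area M) with hA
  set B := ∫ x in box p r, 1 / (s x + δ) ∂(boundaryLength M) with hB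
  have hAle : A ≤ (d + η) / a * J := by
    have h1 := lintegral_area_peak_le hb hp0 ha0 hs.continuous hsb
      (fun x hx => (hsub hx).2.2.2.1.le) hδ0
    rw [← ofReal_integral_eq_lintegral_ofReal (integrable_of_continuous hc2).integrableOn
      (.of_forall fun x => by positivity), ← ENNReal.ofReal_toReal hJtop,
      ← ENNReal.ofReal_mul (by positivity), ENNReal.ofReal_le_ofReal_iff (by positivity)] at h1
    exact h1
  have hBle : (l - η) * J ≤ B := by
    have h1 := le_lintegral_boundaryLength_peak (δ := δ) hb hp0 hs.continuous hsb
      (fun x hx => (hsub hx).2.2.2.2.1.le)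
    have hB0 : 0 ≤ B := setIntegral_nonneg hU fun x _ => (one_div_pos.2 (hpos x)).le
    rcases le_total 0 (l - η) with h2 | h2
    · rw [← ofReal_integral_eq_lintegral_ofReal (integrable_of_continuous hc1).integrableOn
        (.of_forall fun x => (one_div_pos.2 (hpos x)).le), ← ENNReal.ofReal_toReal hJtop,
        ← ENNReal.ofReal_mul h2, ENNReal.ofReal_le_ofReal_iff hB0] at h1
      exact h1
    · exact (mul_nonpos_of_nonpos_of_nonneg h2 ENNReal.toReal_nonneg).trans hB0
  have hsurf : ∫ x, (‖grad s x‖ ^ 2 + |K x|) * (1 / (s x + δ) ^ 2) ∂(area M)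
      ≤ 2 * (k ^ 2 + η) * A + P * (1 / s₁ ^ 2) * (area M).real univ := by
    have hi := ((integrable_of_continuous (μ := area M) hc2).indicator hU).const_mul
      (2 * (k ^ 2 + η))
    calc _ ≤ ∫ x, (2 * (k ^ 2 + η) * (box p r).indicator (fun x => 1 / (s x + δ) ^ 2) x
            + P * (1 / s₁ ^ 2)) ∂(area M) := by
          refine integral_mono (integrable_of_continuous
            ((((continuous_norm_grad hs).pow 2).add hK.abs).mul hc2))
            (hi.add (integrable_const _)) fun x => ?_
          simp only
          have h3 : 0 < 1 / (s x + δ) ^ 2 := one_div_pos.2 (pow_pos (hpos x) 2)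
          by_cases hx : x ∈ box p r
          · rw [indicator_of_mem hx]
            have h1 := (hsub hx).2.1
            have h2 := (hsub hx).2.2.1
            simp only [mem_ofPred_eq] at h1 h2
            have h4 : (‖grad s x‖ ^ 2 + |K x|) * (1 / (s x + δ) ^ 2)
                ≤ 2 * (k ^ 2 + η) * (1 / (s x + δ) ^ 2) :=
              mul_le_mul_of_nonneg_right (by linarith) h3.le
            have h5 : 0 ≤ P * (1 / s₁ ^ 2) := by positivity
            linarith
          · rw [indicator_of_notMem hx, mul_zero, zero_add]
            refine mul_le_mul ((le_abs_self _).trans (hP x)) ?_ h3.le hP0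
            refine one_div_le_one_div_of_le (by positivity) ?_
            exact pow_le_pow_left₀ hs₁.le (by linarith [hout x hx]) 2
      _ = _ := by
          rw [integral_add hi (integrable_const _), integral_const_mul, integral_indicator hU,
            integral_const, smul_eq_mul]
          ring
  have hbdry : (h p - η) * B - H * (1 / s₁) * (boundaryLength M).real univ
      ≤ ∫ x, h x * (1 / (s x + δ)) ∂(boundaryLength M) := by
    have hi := ((integrable_of_continuous (μ := boundaryLength M) hc1).indicator hU).const_mul
      (h p - η)
    calc _ = ∫ x, ((h p - η) * (box p r).indicator (fun x => 1 / (s x + δ)) x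
            - H * (1 / s₁)) ∂(boundaryLength M) := by
          rw [integral_sub hi (integrable_const _), integral_const_mul, integral_indicator hU,
            integral_const, smul_eq_mul]
          ring
      _ ≤ _ := by
          refine integral_mono (hi.sub (integrable_const _))
            (integrable_of_continuous (hh.mul hc1)) fun x => ?_
          simp only
          have h3 : 0 < 1 / (s x + δ) := one_div_pos.2 (hpos x)
          by_cases hx : x ∈ box p r
          · rw [indicator_of_mem hx]
            have h1 := (hsub hx).2.2.2.2.2
            simp only [mem_ofPred_eq] at h1
            have h4 : (h p - η) * (1 / (s x + δ)) ≤ h x * (1 / (s x + δ)) :=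
              mul_le_mul_of_nonneg_right h1.le h3.le
            have h5 : 0 ≤ H * (1 / s₁) := by positivity
            linarith
          · rw [indicator_of_notMem hx, mul_zero, zero_sub]
            have h4 : |h x * (1 / (s x + δ))| ≤ H * (1 / s₁) := by
              rw [abs_mul, abs_of_pos h3]
              refine mul_le_mul (hH x) ?_ h3.le hH0
              exact one_div_le_one_div_of_le hs₁ (by linarith [hout x hx])
            exact (neg_le_neg h4).trans (neg_abs_le _)
  have hJ0 : 0 ≤ J := ENNReal.toReal_nonneg
  have f1 : (k ^ 2 + η) * A ≤ (k ^ 2 + η) * ((d + η) / a * J) := by gcongr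
  have f2 : (h p - η) * ((l - η) * J) ≤ (h p - η) * B :=
    mul_le_mul_of_nonneg_left hBle (by linarith)
  have f3 : κ * (1 / ρ) ≤ κ * J := by gcongr
  have f4 : κ * J = (h p - η) * ((l - η) * J) - (k ^ 2 + η) * ((d + η) / a * J) := by
    rw [hκdef]
    ring
  linarith

end Concentration

end

end RiemannianSurface

/-! ### The mountain-pass geometry and the unboundedness of the energy -/

open RiemannianSurface in
theorem proposition3p3 {M : Type*} [TopologicalSpace M] [T2Space M] [CompactSpace M]
    [ConnectedSpace M] [ChartedSpace (EuclideanHalfSpace 2) M] [IsManifold (𝓡∂ 2) ∞ M]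
    [RiemannianBundle (fun x : M ↦ TangentSpace (𝓡∂ 2) x)]
    [IsContMDiffRiemannianBundle (𝓡∂ 2) ∞ Plane (fun x : M ↦ TangentSpace (𝓡∂ 2) x)]
    [MeasurableSpace M] [BorelSpace M]
    (K h : M → ℝ) (hK : Continuous K) (hh : ContinuousOn h ((𝓡∂ 2).boundary M))
    (hflat : ∀ x : M, gaussianCurvature x = 0)
    (hKneg : ∀ x, K x < 0)
    (hint : ∫ x, h x ∂(boundaryLength M) < 0)
    (hD : ∃ p ∈ (𝓡∂ 2).boundary M, 1 < curvatureRatio K h p) :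
    -- the traces and the integrals in the energy are well defined on the whole Sobolev space
    (∃ C : ℝ, ∀ φ : SmoothFunction M, ‖smoothTrace M φ‖ ≤ C * ‖φ‖) ∧
    (∀ u : H1 M, Integrable (fun x ↦ Real.exp (toL2 M u x)) (area M) ∧
      Integrable (fun x ↦ Real.exp (trace M u x / 2)) (boundaryLength M)) ∧
    -- mountain-pass geometry
    (∃ u₀ u₁ : H1 M,
      (∀ γ : Path u₀ u₁, ∃ t, ∀ s, energy K h (γ s) ≤ energy K h (γ t)) ∧
      max (energy K h u₀) (energy K h u₁) < minMaxLevel K h u₀ u₁ ∧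
      0 < max (energy K h u₀) (energy K h u₁)) ∧
    -- the energy is unbounded below
    ¬ BddBelow (Set.range (fun u : H1 M ↦ energy K h u)) := by
  -- `h` only matters on the boundary, which is closed, so it may be taken continuous on the surface
  obtain ⟨g, hg⟩ := ContinuousMap.exists_restrict_eq
    ((𝓡∂ 2).isClosed_boundary (M := M) (n := ∞) (by simp)) ⟨_, hh.domRestrict⟩
  have hgh : ∀ x ∈ (𝓡∂ 2).boundary M, g x = h x := fun x hx =>
    congrArg (fun f => f ⟨x, hx⟩) hg
  have hae : h =ᵐ[boundaryLength M] g := by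
    filter_upwards [ae_mem_boundary] with x hx
    exact (hgh x hx).symm
  have hE : ∀ u : H1 M, energy K h u = energy K g u := fun u => by
    simp only [energy]
    congr 2
    refine integral_congr_ae ?_
    filter_upwards [hae] with x hx
    rw [hx]
  obtain ⟨p, hp, hDp⟩ := hD
  have hKp : K p ≠ 0 := (hKneg p).ne
  have hhp : √|K p| < g p := by
    rw [curvatureRatio, one_lt_div (Real.sqrt_pos.2 (abs_pos.2 hKp))] at hDp
    rwa [hgh p hp]
  rw [integral_congr_ae hae] at hint
  have hunb := exists_energy_lt hflat hK g.continuous hp hKp hhp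
  obtain ⟨ε, B, hε, hB, h1, h2⟩ := exists_expBound M
  refine ⟨exists_norm_smoothTrace_le M, fun u =>
    ⟨isRestriction_toL2.integrable_exp h1 hε u, ?_⟩, ?_, ?_⟩
  · refine (isRestriction_trace.integrable_exp h2 hε ((1 / 2 : ℝ) • u)).congr ?_
    rw [map_smul]
    filter_upwards [Lp.coeFn_smul (1 / 2 : ℝ) (trace M u)] with x hx
    rw [hx, Pi.smul_apply, smul_eq_mul, one_div_mul_eq_div]
  · obtain ⟨u₁, hu₁⟩ := hunb 0
    obtain ⟨u₀, hu₀⟩ := exists_mountain_pass hflat hK g.continuous hint hu₁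
    simp only [minMaxLevel, hE]
    exact ⟨u₀, u₁, hu₀⟩
  · rintro ⟨R, hR⟩
    obtain ⟨u, hu⟩ := hunb R
    have := hR ⟨u, rfl⟩
    simp only [hE] at this
    exact hu.not_ge this
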